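/- All rings are associative with identity and all modules are unitary left modules. **Definitions over a ring $R$.** Let $C$ be an $R$-module. $\mathrm{Add}_R(C)$ denotes the class of $R$-modules isomorphic to direct summands of direct sums of copies of $C$. A sequence of $R$-modules is $\mathrm{Hom}_R(-,\mathrm{Add}_R(C))$-exact if $\mathrm{Hom}_R(-,F)$ leaves it exact for every $F\in\mathrm{Add}_R(C)$. * $C$ is *w-tilting* if $\mathrm{Ext}^i_R(C,C^{(I)})=0$ for all $i\ge 1$ and all sets $I$, and there is a $\mathrm{Hom}_R(-,\mathrm{Add}_R(C))$-exact exact sequence $0\to R\to A^0\to A^1\to\cdots$ with all $A^i\in\mathrm{Add}_R(C)$. * An $R$-module $M$ is *$G_C$-projective*, written $M\in G_CP(R)$, if there is a $\mathrm{Hom}_R(-,\mathrm{Add}_R(C))$-exact exact sequence $\cdots\to P_1\to P_0\to A^0\to A^1\to\cdots$ with all $P_i$ projective, all $A^i\in\mathrm{Add}_R(C)$ and $M\cong\mathrm{Im}(P_0\to A^0)$. * $G_C\text{-pd}_R(M)\in\{0,1,2,\dots,\infty\}$ is the least $n\ge 0$ for which there is an exact sequence $0\to G_n\to\cdots\to G_0\to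 M\to 0$ with all $G_i\in G_CP(R)$, and $\infty$ if there is no such $n$. **Setting.** Let $A$ and $B$ be rings, $U$ a $(B,A)$-bimodule and $T=\begin{pmatrix}A&0\\U&B\end{pmatrix}$. A $T$-module is identified with a triple $M=\begin{pmatrix}M_1\\M_2\end{pmatrix}_{\varphi^M}$, where $M_1$ is an $A$-module, $M_2$ is a $B$-module and $\varphi^M:U\otimes_AM_1\to M_2$ is $B$-linear; here $T$ acts by $\begin{pmatrix}a&0\\u&b\end{pmatrix}\begin{pmatrix}x\\y\end{pmatrix}=\begin{pmatrix}ax\\ \varphi^M(u\otimes x)+by\end{pmatrix}$. For an $A$-module $C_1$ and a $B$-module $C_2$ put $\mathbf p(C_1,C_2)=\begin{pmatrix}C_1\\(U\otimes_AC_1)\oplus C_2\end{pmatrix}$, with the canonical inclusion as structure map, and $$SG_{C_2}\text{-}PD(B)=\sup\{G_{C_2}\text{-pd}_B(U\otimes_AG)\mid G\in G_{C_1}P(A)\}.$$ The bimodule $U$ is *$C$-compatible*, where $C=\mathbf p(C_1,C_2)$, if (a) $U\otimes_A\mathbf X_1$ is exact for every exact sequence $\mathbf X_1:\cdots\to P^1_1\to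 P^0_1\to C^0_1\to C^1_1\to\cdots$ of $A$-modules with all $P_1^i$ projective and all $C_1^i\in\mathrm{Add}_A(C_1)$; and (b) $\mathrm{Hom}_B(\mathbf X_2,U\otimes_AX)$ is exact for every $X\in\mathrm{Add}_A(C_1)$ and every $\mathrm{Hom}_B(-,\mathrm{Add}_B(C_2))$-exact exact sequence $\mathbf X_2:\cdots\to P^1_2\to P^0_2\to C^0_2\to C^1_2\to\cdots$ of $B$-modules with all $P_2^i$ projective and all $C_2^i\in\mathrm{Add}_B(C_2)$. **Theorem.** Let $C=\mathbf p(C_1,C_2)$ be a w-tilting $T$-module, let $U$ be $C$-compatible, and assume that $SG_{C_2}\text{-}PD(B)<\infty$. Then for every $T$-module $M=\begin{pmatrix}M_1\\M_2\end{pmatrix}_{\varphi^M}$, $$\max\{G_{C_1}\text{-pd}_A(M_1),\ G_{C_2}\text{-pd}_B(M_2)-SG_{C_2}\text{-}PD(B)\}\ \le\ G_C\text{-pd}_T(M)$$ and $$G_C\text{-pd}_T(M)\ \le\ \max\{G_{C_1}\text{-pd}_A(M_1)+SG_{C_2}\text{-}PD(B)+1,\ G_{C_2}\text{-pd}_B(M_2)\},$$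 where $\infty\pm k=\infty$ for every integer $k\ge 0$. -/

import Mathlib

open scoped TensorProduct

set_option linter.unusedSectionVars false

universe u

namespace RelGor

/-! ## Relative Gorenstein projectivity over an arbitrary (associative, unital) ring

Modules are left modules.  A ring and its modules live in the same universe `u`, so that "set",
"direct sum of copies" and "module" have their usual (small) meaning. -/

section OneRing

variable (R : Type u) [Ring R]

/-- `Add_R(C)`: the modules isomorphic to a direct summand of a direct sum `C^(I)`. -/
def IsAdd (C X : Type u) [AddCommGroup C] [Module R C] [AddCommGroup X] [Module R X] : Prop :=
  ∃ (I : Type u) (Y : ModuleCat.{u} R), Nonempty ((X × Y) ≃ₗ[R] (I →₀ C))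

/-- A two-sided infinite sequence `⋯ → P₁ → P₀ → A⁰ → A¹ → ⋯` of `R`-modules. -/
structure TwoSided where
  P : ℕ → ModuleCat.{u} R
  A : ℕ → ModuleCat.{u} R
  dP : ∀ n, P (n + 1) →ₗ[R] P n
  mid : P 0 →ₗ[R] A 0
  dA : ∀ n, A n →ₗ[R] A (n + 1)

variable {R}

/-- The sequence is exact (at every term). -/
def TwoSided.IsExact (S : TwoSided R) : Prop :=
  (∀ n, Function.Exact (S.dP (n + 1)) (S.dP n)) ∧
  Function.Exact (S.dP 0) S.mid ∧
  Function.Exact S.mid (S.dA 0) ∧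
  (∀ n, Function.Exact (S.dA n) (S.dA (n + 1)))

/-- The sequence `Hom_R(S, F)`, that is
`⋯ → Hom(A¹, F) → Hom(A⁰, F) → Hom(P₀, F) → Hom(P₁, F) → ⋯`, is exact (at every term). -/
def TwoSided.HomExact (S : TwoSided R) (F : Type u) [AddCommGroup F] [Module R F] : Prop :=
  (∀ n, Function.Exact (fun g : S.A (n + 2) →ₗ[R] F => g ∘ₗ S.dA (n + 1))
      (fun g : S.A (n + 1) →ₗ[R] F => g ∘ₗ S.dA n)) ∧
  Function.Exact (fun g : S.A 1 →ₗ[R] F => g ∘ₗ S.dA 0) (fun g : S.A 0 →ₗ[R] F => g ∘ₗ S.mid) ∧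
  Function.Exact (fun g : S.A 0 →ₗ[R] F => g ∘ₗ S.mid) (fun g : S.P 0 →ₗ[R] F => g ∘ₗ S.dP 0) ∧
  (∀ n, Function.Exact (fun g : S.P n →ₗ[R] F => g ∘ₗ S.dP n)
      (fun g : S.P (n + 1) →ₗ[R] F => g ∘ₗ S.dP (n + 1)))

/-- All `Pᵢ` are projective and all `Aⁱ` lie in `Add_R(C)`. -/
def TwoSided.ProjAdd (S : TwoSided R) (C : Type u) [AddCommGroup C] [Module R C] : Prop :=
  (∀ n, Module.Projective R (S.P n)) ∧ ∀ n, IsAdd R C (S.A n)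

/-- The sequence is `Hom_R(-, Add_R(C))`-exact. -/
def TwoSided.HomAddExact (S : TwoSided R) (C : Type u) [AddCommGroup C] [Module R C] : Prop :=
  ∀ F : ModuleCat.{u} R, IsAdd R C F → S.HomExact F

variable (R)

/-- `M` is `G_C`-projective: there is a `Hom_R(-, Add_R(C))`-exact exact sequence
`⋯ → P₁ → P₀ → A⁰ → A¹ → ⋯` with all `Pᵢ` projective, all `Aⁱ` in `Add_R(C)`, and
`M ≅ Im (P₀ → A⁰)`. -/
def IsGProj (C M : Type u) [AddCommGroup C] [Module R C] [AddCommGroup M] [Module R M] : Prop :=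
  ∃ S : TwoSided R, S.IsExact ∧ S.ProjAdd C ∧ S.HomAddExact C ∧
    Nonempty (M ≃ₗ[R] LinearMap.range S.mid)

/-- `G_C-pd(M) ≤ n`: there is an exact sequence `0 → Gₙ → ⋯ → G₀ → M → 0` with all `Gᵢ`
`G_C`-projective (written as a sequence indexed by `ℕ` which vanishes beyond `n`). -/
def GpdLE (C M : Type u) [AddCommGroup C] [Module R C] [AddCommGroup M] [Module R M]
    (n : ℕ) : Prop :=
  ∃ (G : ℕ → ModuleCat.{u} R) (d : ∀ i, G (i + 1) →ₗ[R] G i) (ε : G 0 →ₗ[R] M),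
    Function.Surjective ε ∧ Function.Exact (d 0) ε ∧
    (∀ i, Function.Exact (d (i + 1)) (d i)) ∧
    (∀ i, i ≤ n → IsGProj R C (G i)) ∧
    ∀ i, n < i → Subsingleton (G i)

/-- The `G_C`-projective dimension `G_C-pd(M)`: the least `n` with `G_C-pd(M) ≤ n`, and `∞` if
there is none. -/
noncomputable def gpd (C M : Type u) [AddCommGroup C] [Module R C] [AddCommGroup M] [Module R M] :
    ℕ∞ :=
  ⨅ (n : ℕ) (_ : GpdLE R C M n), (n : ℕ∞)

/-- `C` is weakly Wakamatsu tilting (w-tilting): `Ext^i_R(C, C^(I)) = 0` for all `i ≥ 1` and all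
sets `I`, and there is a `Hom_R(-, Add_R(C))`-exact exact sequence `0 → R → A⁰ → A¹ → ⋯` with all
`Aⁱ` in `Add_R(C)`. -/
structure IsWTilting (C : Type u) [AddCommGroup C] [Module R C] : Prop where
  ext_eq_zero : ∀ (I : Type u) (i : ℕ), 1 ≤ i →
    Subsingleton (CategoryTheory.Abelian.Ext (ModuleCat.of R C) (ModuleCat.of R (I →₀ C)) i)
  exists_coresolution : ∃ (A : ℕ → ModuleCat.{u} R) (ε : R →ₗ[R] A 0)
    (d : ∀ n, A n →ₗ[R] A (n + 1)),
    (∀ n, IsAdd R C (A n)) ∧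
    (Function.Injective ε ∧ Function.Exact ε (d 0) ∧ ∀ n, Function.Exact (d n) (d (n + 1))) ∧
    ∀ F : ModuleCat.{u} R, IsAdd R C F →
      (Function.Surjective (fun g : A 0 →ₗ[R] F => g ∘ₗ ε) ∧
       Function.Exact (fun g : A 1 →ₗ[R] F => g ∘ₗ d 0) (fun g : A 0 →ₗ[R] F => g ∘ₗ ε) ∧
       ∀ n, Function.Exact (fun g : A (n + 2) →ₗ[R] F => g ∘ₗ d (n + 1))
         (fun g : A (n + 1) →ₗ[R] F => g ∘ₗ d n))

end OneRing

/-! ## The tensor product `U ⊗_A M` over a noncommutative ring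

`U` is a `(B, A)`-bimodule: a left `B`-module and a right `A`-module (i.e. a left module over the
opposite ring of `A`) whose two actions commute. -/

section Bimodule

variable (A B U : Type u) [Ring A] [Ring B] [AddCommGroup U] [Module B U] [Module Aᵐᵒᵖ U]
  [SMulCommClass B Aᵐᵒᵖ U]

/-- The relations `ua ⊗ m = u ⊗ am`.  The set of all `ua ⊗ m - u ⊗ am` is stable under `B`, so its
`B`-span is the subgroup that it generates. -/
def balancedRel (M : Type u) [AddCommGroup M] [Module A M] : Submodule B (U ⊗[ℤ] M) :=
  Submodule.span B
    {z | ∃ (u : U) (a : A) (m : M), z = (MulOpposite.op a • u) ⊗ₜ[ℤ] m - u ⊗ₜ[ℤ] (a • m)}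

/-- The left `B`-module `U ⊗_A M`. -/
abbrev BTensor (M : Type u) [AddCommGroup M] [Module A M] : Type u :=
  (U ⊗[ℤ] M) ⧸ balancedRel A B U M

/-- The element `u ⊗ m` of `U ⊗_A M`. -/
def BTensor.tmul {M : Type u} [AddCommGroup M] [Module A M] (u : U) (m : M) : BTensor A B U M :=
  (balancedRel A B U M).mkQ (u ⊗ₜ[ℤ] m)

variable {A} in
/-- The `B`-linear map `1_U ⊗ f : U ⊗_A M → U ⊗_A N`. -/
noncomputable def BTensor.map {M N : Type u} [AddCommGroup M] [Module A M] [AddCommGroup N]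
    [Module A N] (f : M →ₗ[A] N) : BTensor A B U M →ₗ[B] BTensor A B U N :=
  Submodule.mapQ (balancedRel A B U M) (balancedRel A B U N)
    (TensorProduct.AlgebraTensorModule.map (LinearMap.id : U →ₗ[B] U)
      f.toAddMonoidHom.toIntLinearMap)
    (by
      refine Submodule.span_le.2 ?_
      rintro _ ⟨u, a, m, rfl⟩
      refine Submodule.subset_span ⟨u, a, f m, ?_⟩
      simp)

variable {A} in
/-- The sequence `U ⊗_A S` of `B`-modules. -/
noncomputable def TwoSided.tensor (S : TwoSided A) : TwoSided B where
  P n := ModuleCat.of B (BTensor A B U (S.P n))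
  A n := ModuleCat.of B (BTensor A B U (S.A n))
  dP n := BTensor.map B U (S.dP n)
  mid := BTensor.map B U S.mid
  dA n := BTensor.map B U (S.dA n)

/-- `U` is `C`-compatible, for `C = p(C₁, C₂)`:
(a) `U ⊗_A X₁` is exact for every exact sequence `X₁ = (⋯ → P₁ → P₀ → A⁰ → A¹ → ⋯)` of
`A`-modules with all `Pᵢ` projective and all `Aⁱ` in `Add_A(C₁)`;
(b) `Hom_B(X₂, U ⊗_A Add_A(C₁))` is exact for every `Hom_B(-, Add_B(C₂))`-exact exact sequence
`X₂ = (⋯ → P₁ → P₀ → A⁰ → A¹ → ⋯)` of `B`-modules with all `Pᵢ` projective and all `Aⁱ` in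
`Add_B(C₂)`. -/
structure IsCompatible (C₁ C₂ : Type u) [AddCommGroup C₁] [Module A C₁]
    [AddCommGroup C₂] [Module B C₂] : Prop where
  tensor_exact : ∀ S : TwoSided A, S.IsExact → S.ProjAdd C₁ → (S.tensor B U).IsExact
  hom_exact : ∀ S : TwoSided B, S.IsExact → S.ProjAdd C₂ → S.HomAddExact C₂ →
    ∀ X : ModuleCat.{u} A, IsAdd A C₁ X → S.HomExact (BTensor A B U X)

/-- `SG_{C₂}-PD(B) = sup {G_{C₂}-pd_B(U ⊗_A G) | G a G_{C₁}-projective A-module}`. -/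
noncomputable def sgpd (C₁ C₂ : Type u) [AddCommGroup C₁] [Module A C₁]
    [AddCommGroup C₂] [Module B C₂] : ℕ∞ :=
  ⨆ (G : ModuleCat.{u} A) (_ : IsGProj A C₁ G), gpd B C₂ (BTensor A B U G)

/-! ## The triangular matrix ring and its modules -/

/-- The formal triangular matrix ring `T = (A 0; U B)`; `⟨a, u, b⟩` is the matrix with rows
`(a, 0)` and `(u, b)`. -/
@[ext]
structure TriRing where
  a : A
  u : U
  b : B

namespace TriRing

variable {A B U}

instance : Zero (TriRing A B U) := ⟨⟨0, 0, 0⟩⟩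
instance : One (TriRing A B U) := ⟨⟨1, 0, 1⟩⟩
instance : Add (TriRing A B U) := ⟨fun s t => ⟨s.a + t.a, s.u + t.u, s.b + t.b⟩⟩
instance : Neg (TriRing A B U) := ⟨fun s => ⟨-s.a, -s.u, -s.b⟩⟩
/-- `(a 0; u b) (a' 0; u' b') = (aa' 0; ua' + bu' bb')`. -/
instance : Mul (TriRing A B U) :=
  ⟨fun s t => ⟨s.a * t.a, MulOpposite.op t.a • s.u + s.b • t.u, s.b * t.b⟩⟩

@[simp] theorem zero_a : (0 : TriRing A B U).a = 0 := rfl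
@[simp] theorem zero_u : (0 : TriRing A B U).u = 0 := rfl
@[simp] theorem zero_b : (0 : TriRing A B U).b = 0 := rfl
@[simp] theorem one_a : (1 : TriRing A B U).a = 1 := rfl
@[simp] theorem one_u : (1 : TriRing A B U).u = 0 := rfl
@[simp] theorem one_b : (1 : TriRing A B U).b = 1 := rfl
@[simp] theorem add_a (s t : TriRing A B U) : (s + t).a = s.a + t.a := rfl
@[simp] theorem add_u (s t : TriRing A B U) : (s + t).u = s.u + t.u := rfl
@[simp] theorem add_b (s t : TriRing A B U) : (s + t).b = s.b + t.b := rfl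
@[simp] theorem neg_a (s : TriRing A B U) : (-s).a = -s.a := rfl
@[simp] theorem neg_u (s : TriRing A B U) : (-s).u = -s.u := rfl
@[simp] theorem neg_b (s : TriRing A B U) : (-s).b = -s.b := rfl
@[simp] theorem mul_a (s t : TriRing A B U) : (s * t).a = s.a * t.a := rfl
@[simp] theorem mul_u (s t : TriRing A B U) :
    (s * t).u = MulOpposite.op t.a • s.u + s.b • t.u := rfl
@[simp] theorem mul_b (s t : TriRing A B U) : (s * t).b = s.b * t.b := rfl

instance : Ring (TriRing A B U) where
  add_assoc _ _ _ := by ext <;> simp [add_assoc]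
  zero_add _ := by ext <;> simp
  add_zero _ := by ext <;> simp
  add_comm _ _ := by ext <;> simp [add_comm]
  neg_add_cancel _ := by ext <;> simp
  mul_assoc s t r := by
    ext
    · simp [mul_assoc]
    · simp [mul_smul, smul_add, smul_comm, add_assoc]
    · simp [mul_assoc]
  one_mul _ := by ext <;> simp
  mul_one _ := by ext <;> simp
  zero_mul _ := by ext <;> simp
  mul_zero _ := by ext <;> simp
  left_distrib _ _ _ := by
    ext
    · simp [mul_add]
    · simp [add_smul, smul_add]; abel
    · simp [mul_add]
  right_distrib _ _ _ := by
    ext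
    · simp [add_mul]
    · simp [add_smul, smul_add]; abel
    · simp [add_mul]
  nsmul := nsmulRec
  zsmul := zsmulRec

end TriRing

section TriModule

variable {A B U}
variable {M₁ M₂ : Type u} [AddCommGroup M₁] [Module A M₁] [AddCommGroup M₂] [Module B M₂]

/-- The left `T`-module `(M₁; M₂)_φ` given by a triple `(M₁, M₂, φ : U ⊗_A M₁ → M₂)`: the column
vectors `(x; y)` with `x ∈ M₁`, `y ∈ M₂`, on which `T` acts by
`(a 0; u b) (x; y) = (ax; φ(u ⊗ x) + by)`. -/
@[nolint unusedArguments]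
def TriModule (_φ : BTensor A B U M₁ →ₗ[B] M₂) : Type u := M₁ × M₂

variable (φ : BTensor A B U M₁ →ₗ[B] M₂)

instance : AddCommGroup (TriModule φ) := inferInstanceAs (AddCommGroup (M₁ × M₂))

instance : SMul (TriRing A B U) (TriModule φ) :=
  ⟨fun t z => ((t.a • z.1, φ (BTensor.tmul A B U t.u z.1) + t.b • z.2) : M₁ × M₂)⟩

theorem BTensor.add_tmul (u v : U) (x : M₁) :
    BTensor.tmul A B U (u + v) x = BTensor.tmul A B U u x + BTensor.tmul A B U v x := by
  simp [BTensor.tmul, TensorProduct.add_tmul]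

theorem BTensor.tmul_add (u : U) (x y : M₁) :
    BTensor.tmul A B U u (x + y) = BTensor.tmul A B U u x + BTensor.tmul A B U u y := by
  simp [BTensor.tmul, TensorProduct.tmul_add]

theorem BTensor.zero_tmul (x : M₁) : BTensor.tmul A B U 0 x = 0 := by
  simp [BTensor.tmul]

theorem BTensor.tmul_zero (u : U) : BTensor.tmul A B U u (0 : M₁) = 0 := by
  simp [BTensor.tmul]

theorem BTensor.smul_tmul (b : B) (u : U) (x : M₁) :
    BTensor.tmul A B U (b • u) x = b • BTensor.tmul A B U u x := rfl

theorem BTensor.op_smul_tmul (a : A) (u : U) (x : M₁) :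
    BTensor.tmul A B U (MulOpposite.op a • u) x = BTensor.tmul A B U u (a • x) :=
  (Submodule.Quotient.eq _).2 (Submodule.subset_span ⟨u, a, x, rfl⟩)

instance : Module (TriRing A B U) (TriModule φ) where
  one_smul z := by
    refine Prod.ext (one_smul A z.1) ?_
    change φ (BTensor.tmul A B U 0 z.1) + (1 : B) • z.2 = z.2
    simp [BTensor.zero_tmul]
  mul_smul s t z := by
    refine Prod.ext (mul_smul s.a t.a z.1) ?_
    change φ (BTensor.tmul A B U (MulOpposite.op t.a • s.u + s.b • t.u) z.1) + (s.b * t.b) • z.2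
      = φ (BTensor.tmul A B U s.u (t.a • z.1))
        + s.b • (φ (BTensor.tmul A B U t.u z.1) + t.b • z.2)
    rw [BTensor.add_tmul, BTensor.op_smul_tmul, BTensor.smul_tmul, map_add, map_smul, smul_add,
      mul_smul, add_assoc]
  smul_zero t := by
    refine Prod.ext (smul_zero t.a) ?_
    change φ (BTensor.tmul A B U t.u (0 : M₁)) + t.b • (0 : M₂) = 0
    simp [BTensor.tmul_zero]
  smul_add t z w := by
    refine Prod.ext (smul_add t.a z.1 w.1) ?_
    change φ (BTensor.tmul A B U t.u (z.1 + w.1)) + t.b • (z.2 + w.2)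
      = (φ (BTensor.tmul A B U t.u z.1) + t.b • z.2)
        + (φ (BTensor.tmul A B U t.u w.1) + t.b • w.2)
    rw [BTensor.tmul_add, map_add, smul_add]; abel
  add_smul s t z := by
    refine Prod.ext (add_smul s.a t.a z.1) ?_
    change φ (BTensor.tmul A B U (s.u + t.u) z.1) + (s.b + t.b) • z.2
      = (φ (BTensor.tmul A B U s.u z.1) + s.b • z.2)
        + (φ (BTensor.tmul A B U t.u z.1) + t.b • z.2)
    rw [BTensor.add_tmul, map_add, add_smul]; abel
  zero_smul z := by
    refine Prod.ext (zero_smul A z.1) ?_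
    change φ (BTensor.tmul A B U 0 z.1) + (0 : B) • z.2 = 0
    simp [BTensor.zero_tmul]

end TriModule

/-- The `T`-module `p(C₁, C₂) = (C₁; (U ⊗_A C₁) ⊕ C₂)`, whose structure map is the inclusion
`U ⊗_A C₁ → (U ⊗_A C₁) ⊕ C₂`. -/
abbrev PModule (C₁ C₂ : Type u) [AddCommGroup C₁] [Module A C₁] [AddCommGroup C₂] [Module B C₂] :
    Type u :=
  TriModule (LinearMap.inl B (BTensor A B U C₁) C₂)

end Bimodule

end RelGor

/-! Everything rests on one description of relative Gorenstein projectivity (`isGProj_iff`): `M` is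
`G_C`-projective iff `Ext^i(M, F) = 0` for all `i ≥ 1` and `F ∈ Add(C)`, and `M` has a `Hom(-,
Add(C))`-exact coresolution by `Add(C)`. The projective half of the defining sequence is thus
replaced by a vanishing condition. Both conditions can be verified one short exact sequence at a
time (`ExtVan.of_class`, `IsGProj.of_class`): it suffices to find a class of modules closed under
taking a suitable syzygy or cosyzygy. When `C` is w-tilting, projectives are `G_C`-projective, and
the `G_C`-projectives are closed under extensions and kernels of epimorphisms, so `G_C`-pd obeys the
usual inequalities in short exact sequences (`PdLE.extension`, `PdLE.coker`, `PdLE.ker`).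

Over `T`, a `G_C`-projective triple `(M₁; M₂)_φ` has `φ` injective, `M₁` `G_{C₁}`-projective and
`coker φ` `G_{C₂}`-projective (`IsGProj.structure_injective`, `IsGProj.fst`,
`IsGProj.coker_structure`). In the other direction it is enough that `p(G, Q)` is `G_C`-projective
for `G` and `Q` relative Gorenstein projective (`IsGProj.pModule`). Compatibility (a) makes `U ⊗ -`
exact on the sequences involved; compatibility (b) gives `Ext(Q, U ⊗ X) = 0` for `Q`
`G_{C₂}`-projective and `X ∈ Add(C₁)`.

Let `k` be the supremum `SG_{C₂}-PD(B)`. Lower bound: in a `G_C`-projective resolution of `M`, the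
first components are `G_{C₁}`-projective, while each second component is an extension of a
`G_{C₂}`-projective by some `U ⊗ G`, hence has dimension at most `k`. A resolution of length `n`
therefore bounds the dimension of `M₂` by `n + k`. Upper bound: cover `M` by `p(G, F)` with `G → M₁`
from a resolution and `F` free over `M₂`. The second term `(U ⊗ G) ⊕ F` has dimension at most `k`,
so the dimension of the second component drops by one at each step while it exceeds `k`. After `m +
1` steps, `m` being the dimension of `M₁`, the first component is zero, and `(0; L)` is resolved by
the modules `(0; Q)`. -/

namespace RelGor

/-! ### Short exact sequences and vanishing of Ext -/

section Ext

open CategoryTheory Abelian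

variable {R : Type u} [Ring R]

/-- `0 → K → X → M → 0` is exact. -/
structure SES {K X M : Type*} [AddCommGroup K] [Module R K] [AddCommGroup X] [Module R X]
    [AddCommGroup M] [Module R M] (f : K →ₗ[R] X) (g : X →ₗ[R] M) : Prop where
  inj : Function.Injective f
  exact : Function.Exact f g
  surj : Function.Surjective g

variable (R) in
/-- `Ext^i_R(M, F) = 0` for all `i ≥ 1`. -/
def ExtVan (M F : Type u) [AddCommGroup M] [Module R M] [AddCommGroup F] [Module R F] : Prop :=
  ∀ i : ℕ, 1 ≤ i → Subsingleton (Ext (ModuleCat.of R M) (ModuleCat.of R F) i)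

variable {K X M N F F' : Type u} [AddCommGroup K] [Module R K] [AddCommGroup X] [Module R X]
    [AddCommGroup M] [Module R M] [AddCommGroup N] [Module R N]
    [AddCommGroup F] [Module R F] [AddCommGroup F'] [Module R F']

theorem SES.comp_eq_zero {f : K →ₗ[R] X} {g : X →ₗ[R] M} (h : SES f g) : g ∘ₗ f = 0 :=
  h.exact.linearMap_comp_eq_zero

theorem SES.ker_subtype (g : X →ₗ[R] M) (hg : Function.Surjective g) :
    SES (LinearMap.ker g).subtype g :=
  ⟨Subtype.val_injective, LinearMap.exact_subtype_ker_map g, hg⟩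

theorem SES.mkQ_range (f : K →ₗ[R] X) (hf : Function.Injective f) :
    SES f (LinearMap.range f).mkQ :=
  ⟨hf, LinearMap.exact_map_mkQ_range f, Submodule.mkQ_surjective _⟩

theorem SES.shortExact {f : K →ₗ[R] X} {g : X →ₗ[R] M} (h : SES f g) :
    (ShortComplex.mk (ModuleCat.ofHom f) (ModuleCat.ofHom g)
      (by rw [← ModuleCat.ofHom_comp, h.comp_eq_zero]; rfl)).ShortExact :=
  ModuleCat.shortComplex_shortExact _ h.exact h.inj h.surj

/-- A linear map that vanishes on the image of `f` factors through `g`. -/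
theorem SES.desc {f : K →ₗ[R] X} {g : X →ₗ[R] M} (h : SES f g) (k : X →ₗ[R] N)
    (hk : k ∘ₗ f = 0) : ∃ k' : M →ₗ[R] N, k' ∘ₗ g = k := by
  have hle : LinearMap.ker g ≤ LinearMap.ker k := by
    rw [h.exact.linearMap_ker_eq]
    rintro _ ⟨x, rfl⟩
    exact LinearMap.congr_fun hk x
  refine ⟨(LinearMap.ker g).liftQ k hle ∘ₗ (g.quotKerEquivOfSurjective h.surj).symm, ?_⟩
  ext x
  have : (g.quotKerEquivOfSurjective h.surj).symm (g x) = (LinearMap.ker g).mkQ x := by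
    rw [LinearEquiv.symm_apply_eq]; rfl
  simp [this]

/-- A linear map whose composite with `g` vanishes factors through `f`. -/
theorem SES.lift {f : K →ₗ[R] X} {g : X →ₗ[R] M} (h : SES f g) (k : N →ₗ[R] X)
    (hk : g ∘ₗ k = 0) : ∃ k' : N →ₗ[R] K, f ∘ₗ k' = k := by
  have hr : ∀ n, k n ∈ LinearMap.range f := fun n => (h.exact _).1 (LinearMap.congr_fun hk n)
  refine ⟨(LinearEquiv.ofInjective f h.inj).symm ∘ₗ k.codRestrict _ hr, ?_⟩
  ext n
  have := (LinearEquiv.ofInjective f h.inj).apply_symm_apply ⟨k n, hr n⟩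
  exact congrArg Subtype.val this

theorem SES.of_left_equiv {f : K →ₗ[R] X} {g : X →ₗ[R] M} (h : SES f g) (e : N ≃ₗ[R] K) :
    SES (f ∘ₗ e.toLinearMap) g :=
  ⟨h.inj.comp e.injective,
    fun x => (h.exact x).trans
      ⟨fun ⟨y, hy⟩ => ⟨e.symm y, by simpa using hy⟩, fun ⟨y, hy⟩ => ⟨e y, hy⟩⟩, h.surj⟩

theorem SES.of_right_equiv {f : K →ₗ[R] X} {g : X →ₗ[R] M} (h : SES f g) (e : M ≃ₗ[R] N) :
    SES f (e.toLinearMap ∘ₗ g) :=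
  ⟨h.inj, fun x => by rw [← h.exact x]; simp, e.surjective.comp h.surj⟩

theorem SES.of_mid_equiv {f : K →ₗ[R] X} {g : X →ₗ[R] M} (h : SES f g) (e : X ≃ₗ[R] N) :
    SES (e.toLinearMap ∘ₗ f) (g ∘ₗ e.symm.toLinearMap) :=
  ⟨e.injective.comp h.inj, fun x => by
    refine (h.exact (e.symm x)).trans ?_
    simp [LinearEquiv.eq_symm_apply], h.surj.comp e.symm.surjective⟩

theorem SES.inl_snd : SES (LinearMap.inl R M N) (LinearMap.snd R M N) :=
  ⟨LinearMap.inl_injective, Function.Exact.inl_snd, LinearMap.snd_surjective⟩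

theorem SES.id_zero [Subsingleton N] : SES (LinearMap.id : M →ₗ[R] M) (0 : M →ₗ[R] N) :=
  ⟨Function.injective_id, fun x => by simp, fun y => ⟨0, Subsingleton.elim _ _⟩⟩

theorem SES.zero_id [Subsingleton N] : SES (0 : N →ₗ[R] M) (LinearMap.id : M →ₗ[R] M) :=
  ⟨Function.injective_of_subsingleton _, fun x => by simp [eq_comm], Function.surjective_id⟩

theorem ExtVan.extend (hM : ExtVan R M F) {f : K →ₗ[R] X} {g : X →ₗ[R] M} (h : SES f g)
    (k : K →ₗ[R] F) : ∃ k' : X →ₗ[R] F, k' ∘ₗ f = k := by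
  have := hM 1 le_rfl
  obtain ⟨x, hx⟩ := Ext.contravariant_sequence_exact₁ h.shortExact (ModuleCat.of R F)
    (Ext.mk₀ (ModuleCat.ofHom k)) (add_zero 1) (Subsingleton.elim _ _)
  obtain ⟨y, rfl⟩ := Ext.addEquiv₀.symm.surjective x
  refine ⟨y.hom, ?_⟩
  simp only [Ext.addEquiv₀_symm_apply, Ext.mk₀_comp_mk₀] at hx
  have := Ext.addEquiv₀.symm.injective (a₁ := ModuleCat.ofHom f ≫ y) (a₂ := ModuleCat.ofHom k) hx
  simpa using congrArg ModuleCat.Hom.hom this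

theorem ExtVan.of_projective [Module.Projective R M] : ExtVan R M F := by
  intro i hi
  obtain ⟨j, rfl⟩ := Nat.exists_eq_add_of_le' hi
  have : Projective (ModuleCat.of R M) :=
    (IsProjective.iff_projective (R := R) (P := M)).1 inferInstance
  exact Ext.subsingleton_of_projective _ _ j

theorem ExtVan.ker {f : K →ₗ[R] X} {g : X →ₗ[R] M} (h : SES f g)
    (hX : ExtVan R X F) (hM : ExtVan R M F) : ExtVan R K F := by
  intro i hi
  refine subsingleton_of_forall_eq 0 fun x => ?_
  have := hM (1 + i) (by omega)
  have := hX i hi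
  obtain ⟨y, rfl⟩ := Ext.contravariant_sequence_exact₁ h.shortExact (ModuleCat.of R F) x
    (n₁ := 1 + i) rfl (Subsingleton.elim _ _)
  rw [Subsingleton.elim y 0, Ext.comp_zero]

theorem ExtVan.mid {f : K →ₗ[R] X} {g : X →ₗ[R] M} (h : SES f g)
    (hK : ExtVan R K F) (hM : ExtVan R M F) : ExtVan R X F := by
  intro i hi
  refine subsingleton_of_forall_eq 0 fun x => ?_
  have := hK i hi
  have := hM i hi
  obtain ⟨y, rfl⟩ := Ext.contravariant_sequence_exact₂ h.shortExact (ModuleCat.of R F) x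
    (Subsingleton.elim _ _)
  rw [Subsingleton.elim y 0, Ext.comp_zero]

theorem SES.subsingleton_ext_one {f : K →ₗ[R] X} {g : X →ₗ[R] M} (h : SES f g)
    (hX : ExtVan R X F) (hext : ∀ k : K →ₗ[R] F, ∃ k' : X →ₗ[R] F, k' ∘ₗ f = k) :
    Subsingleton (Ext (ModuleCat.of R M) (ModuleCat.of R F) 1) := by
  refine subsingleton_of_forall_eq 0 fun x => ?_
  have := hX 1 le_rfl
  obtain ⟨y, rfl⟩ := Ext.contravariant_sequence_exact₃ h.shortExact (ModuleCat.of R F) x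
    (Subsingleton.elim _ _) (n₀ := 0) rfl
  obtain ⟨k, rfl⟩ := Ext.addEquiv₀.symm.surjective y
  obtain ⟨k', hk'⟩ := hext k.hom
  have : Ext.addEquiv₀.symm k = (Ext.mk₀ (ModuleCat.ofHom f)).comp
      (Ext.mk₀ (ModuleCat.ofHom k')) (zero_add 0) := by
    rw [Ext.mk₀_comp_mk₀, Ext.addEquiv₀_symm_apply]
    exact congrArg Ext.mk₀ (ModuleCat.hom_ext hk'.symm)
  rw [this]
  exact h.shortExact.extClass_comp_assoc _

theorem SES.subsingleton_ext_succ {f : K →ₗ[R] X} {g : X →ₗ[R] M} (h : SES f g)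
    (hX : ExtVan R X F) {i : ℕ} (hK : Subsingleton (Ext (ModuleCat.of R K) (ModuleCat.of R F) i)) :
    Subsingleton (Ext (ModuleCat.of R M) (ModuleCat.of R F) (i + 1)) := by
  refine subsingleton_of_forall_eq 0 fun x => ?_
  have := hX (i + 1) (by omega)
  obtain ⟨y, rfl⟩ := Ext.contravariant_sequence_exact₃ h.shortExact (ModuleCat.of R F) x
    (Subsingleton.elim _ _) (n₀ := i) (add_comm _ _)
  have hy : y = 0 := hK.elim _ _
  rw [hy, Ext.comp_zero]

/-- Extendability of maps along `f` kills the connecting map into `Ext^1(M, F)`, so only the higher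
degrees need the vanishing for `K`. -/
theorem ExtVan.coker {f : K →ₗ[R] X} {g : X →ₗ[R] M} (h : SES f g)
    (hX : ExtVan R X F) (hK : ExtVan R K F)
    (hext : ∀ k : K →ₗ[R] F, ∃ k' : X →ₗ[R] F, k' ∘ₗ f = k) : ExtVan R M F := by
  intro i hi
  obtain ⟨j, rfl⟩ := Nat.exists_eq_add_of_le' hi
  rcases Nat.eq_zero_or_pos j with rfl | hj
  · exact h.subsingleton_ext_one hX hext
  · exact h.subsingleton_ext_succ hX (hK j hj)

theorem ExtVan.retract_left {i : M →ₗ[R] N} {p : N →ₗ[R] M} (hip : p ∘ₗ i = LinearMap.id)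
    (h : ExtVan R N F) : ExtVan R M F := by
  intro n hn
  have := h n hn
  refine subsingleton_of_forall_eq 0 fun x => ?_
  have h1 : x = (Ext.mk₀ (ModuleCat.ofHom i)).comp
      ((Ext.mk₀ (ModuleCat.ofHom p)).comp x (zero_add n)) (zero_add n) := by
    rw [Ext.mk₀_comp_mk₀_assoc, ← ModuleCat.ofHom_comp, hip]
    exact (Ext.mk₀_id_comp x).symm
  rw [h1, Subsingleton.elim (Ext.comp _ x _) 0, Ext.comp_zero]

theorem ExtVan.retract_right {i : F →ₗ[R] F'} {p : F' →ₗ[R] F} (hip : p ∘ₗ i = LinearMap.id)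
    (h : ExtVan R M F') : ExtVan R M F := by
  intro n hn
  have := h n hn
  refine subsingleton_of_forall_eq 0 fun x => ?_
  have h1 : x = (x.comp (Ext.mk₀ (ModuleCat.ofHom i)) (add_zero n)).comp
      (Ext.mk₀ (ModuleCat.ofHom p)) (add_zero n) := by
    rw [Ext.comp_assoc_of_second_deg_zero, Ext.mk₀_comp_mk₀, ← ModuleCat.ofHom_comp, hip]
    exact (Ext.comp_mk₀_id x).symm
  rw [h1, Subsingleton.elim (Ext.comp x _ _) 0, Ext.zero_comp]

theorem ExtVan.prod_right (h : ExtVan R M F) (h' : ExtVan R M F') : ExtVan R M (F × F') := by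
  intro n hn
  have := h n hn
  have := h' n hn
  refine subsingleton_of_forall_eq 0 fun x => ?_
  obtain ⟨y, rfl⟩ := Ext.covariant_sequence_exact₂ (ModuleCat.of R M)
    (SES.inl_snd (R := R) (M := F) (N := F')).shortExact x (Subsingleton.elim _ _)
  rw [Subsingleton.elim y 0, Ext.zero_comp]

/-- A class of modules all of whose members have a projective presentation with kernel in the
class along which linear maps to `F` extend consists of modules with `Ext^i(-, F) = 0`. -/
theorem ExtVan.of_class (𝒢 : ModuleCat.{u} R → Prop)
    (h𝒢 : ∀ M, 𝒢 M → ∃ (K P : ModuleCat.{u} R) (f : K →ₗ[R] P) (g : P →ₗ[R] M),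
      𝒢 K ∧ Module.Projective R P ∧ SES f g ∧ ∀ k : K →ₗ[R] F, ∃ k' : P →ₗ[R] F, k' ∘ₗ f = k)
    (M : ModuleCat.{u} R) (hM : 𝒢 M) : ExtVan R M F := by
  intro i hi
  induction i, hi using Nat.le_induction generalizing M with
  | base =>
    obtain ⟨K, P, f, g, -, hP, h, hext⟩ := h𝒢 M hM
    exact h.subsingleton_ext_one .of_projective hext
  | succ i hi ih =>
    obtain ⟨K, P, f, g, hK, hP, h, -⟩ := h𝒢 M hM
    exact h.subsingleton_ext_succ .of_projective (ih K hK)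

/-- The canonical surjection from a free module. -/
theorem exists_free_ses (R : Type u) [Ring R] (M : Type u) [AddCommGroup M] [Module R M] :
    ∃ (K : ModuleCat.{u} R) (f : K →ₗ[R] (M →₀ R)) (g : (M →₀ R) →ₗ[R] M), SES f g :=
  ⟨ModuleCat.of R (LinearMap.ker (Finsupp.linearCombination R (id : M → M))), _, _,
    SES.ker_subtype _ (Finsupp.linearCombination_id_surjective R M)⟩

theorem SES.finsupp (I : Type u) {f : K →ₗ[R] X} {g : X →ₗ[R] M} (h : SES f g) :
    SES (Finsupp.mapRange.linearMap (α := I) f) (Finsupp.mapRange.linearMap (α := I) g) := by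
  refine ⟨Finsupp.mapRange_injective _ (map_zero f) h.inj, fun x => ⟨fun hx => ?_, ?_⟩,
    Finsupp.mapRange_surjective _ (map_zero g) h.surj⟩
  · have hr : ∀ i, x i ∈ Set.range f := fun i => (h.exact _).1 (by
      simpa using DFunLike.congr_fun hx i)
    choose y hy using hr
    refine ⟨Finsupp.onFinset x.support y fun i hi => ?_, ?_⟩
    · rw [Finsupp.mem_support_iff]
      intro h0
      exact hi (h.inj (by rw [hy, h0, map_zero]))
    · ext i
      simp [hy]
  · rintro ⟨y, rfl⟩
    ext i
    simpa using h.exact.apply_apply_eq_zero (y i)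

/-- Direct sums of free presentations are projective presentations of the direct sum, and maps out
of a direct sum are extended one coordinate at a time. -/
theorem ExtVan.finsupp (I : Type u) (h : ExtVan R M F) : ExtVan R (I →₀ M) F := by
  refine ExtVan.of_class (fun N => ∃ M : ModuleCat.{u} R, ExtVan R M F ∧
    Nonempty (N ≃ₗ[R] (I →₀ M))) ?_ (ModuleCat.of R (I →₀ M))
    ⟨ModuleCat.of R M, h, ⟨LinearEquiv.refl _ _⟩⟩
  rintro N ⟨M, hM, ⟨e⟩⟩
  obtain ⟨K, f, g, hs⟩ := exists_free_ses R M
  refine ⟨ModuleCat.of R (I →₀ K), ModuleCat.of R (I →₀ M →₀ R), _, _,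
    ⟨K, ExtVan.ker hs .of_projective hM, ⟨LinearEquiv.refl _ _⟩⟩,
    inferInstanceAs (Module.Projective R (I →₀ M →₀ R)),
    (hs.finsupp I).of_right_equiv e.symm, fun k => ?_⟩
  choose k' hk' using fun i => hM.extend hs (k ∘ₗ Finsupp.lsingle i)
  refine ⟨Finsupp.lsum ℕ k', ?_⟩
  ext i x
  simpa using LinearMap.congr_fun (hk' i) x

end Ext

/-! ### Closure properties of `Add(C)` -/

section Add

variable {R : Type u} [Ring R]
variable {C X Y Z : Type u} [AddCommGroup C] [Module R C] [AddCommGroup X] [Module R X]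
    [AddCommGroup Y] [Module R Y] [AddCommGroup Z] [Module R Z]

theorem isAdd_iff_retract : IsAdd R C X ↔
    ∃ (I : Type u) (i : X →ₗ[R] (I →₀ C)) (p : (I →₀ C) →ₗ[R] X), p ∘ₗ i = LinearMap.id := by
  constructor
  · rintro ⟨I, Y, ⟨e⟩⟩
    exact ⟨I, e.toLinearMap ∘ₗ LinearMap.inl R X Y, LinearMap.fst R X Y ∘ₗ e.symm.toLinearMap,
      by ext; simp⟩
  · rintro ⟨I, i, p, h⟩
    have hi : ∀ x, p (i x) = x := fun x => LinearMap.congr_fun h x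
    refine ⟨I, ModuleCat.of R (LinearMap.ker p), ⟨LinearEquiv.ofBijective
      (i.coprod (LinearMap.ker p).subtype) ⟨?_, fun z => ⟨(p z, ⟨z - i (p z), ?_⟩), ?_⟩⟩⟩⟩
    · rw [injective_iff_map_eq_zero]
      rintro ⟨x, y⟩ hxy
      simp only [LinearMap.coprod_apply, Submodule.subtype_apply] at hxy
      have hx : x = 0 := by
        have := congrArg p hxy
        rwa [map_add, hi, y.2, map_zero, add_zero] at this
      subst hx
      rw [map_zero, zero_add] at hxy
      exact Prod.ext rfl (Subtype.ext hxy)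
    · simp [hi]
    · simp

theorem IsAdd.retract (h : IsAdd R C X) {i : Y →ₗ[R] X} {p : X →ₗ[R] Y}
    (hip : p ∘ₗ i = LinearMap.id) : IsAdd R C Y := by
  obtain ⟨I, i', p', h'⟩ := isAdd_iff_retract.1 h
  refine isAdd_iff_retract.2 ⟨I, i' ∘ₗ i, p ∘ₗ p', ?_⟩
  rw [LinearMap.comp_assoc, ← LinearMap.comp_assoc i i' p', h', LinearMap.id_comp, hip]

theorem IsAdd.of_equiv (h : IsAdd R C X) (e : X ≃ₗ[R] Y) : IsAdd R C Y :=
  h.retract (i := e.symm.toLinearMap) (p := e.toLinearMap) (by ext; simp)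

theorem IsAdd.finsupp_self (I : Type u) : IsAdd R C (I →₀ C) :=
  isAdd_iff_retract.2 ⟨I, LinearMap.id, LinearMap.id, rfl⟩

theorem IsAdd.of_subsingleton [Subsingleton X] : IsAdd R C X :=
  isAdd_iff_retract.2 ⟨PEmpty, 0, 0, Subsingleton.elim _ _⟩

theorem IsAdd.self : IsAdd R C C :=
  (IsAdd.finsupp_self (R := R) (C := C) PUnit).of_equiv (Finsupp.uniqueLinearEquiv R C PUnit.unit)

theorem IsAdd.prod (hX : IsAdd R C X) (hY : IsAdd R C Y) : IsAdd R C (X × Y) := by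
  obtain ⟨I, i, p, h⟩ := isAdd_iff_retract.1 hX
  obtain ⟨J, j, q, h'⟩ := isAdd_iff_retract.1 hY
  refine ((IsAdd.finsupp_self (R := R) (C := C) (I ⊕ J)).of_equiv
    (Finsupp.sumFinsuppLEquivProdFinsupp R)).retract (i := i.prodMap j) (p := p.prodMap q) ?_
  rw [LinearMap.prodMap_comp, h, h', LinearMap.prodMap_id]

theorem IsAdd.finsupp (I : Type u) (hX : IsAdd R C X) : IsAdd R C (I →₀ X) := by
  obtain ⟨J, i, p, h⟩ := isAdd_iff_retract.1 hX
  refine ((IsAdd.finsupp_self (R := R) (C := C) (I × J)).of_equiv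
    (Finsupp.curryLinearEquiv R)).retract (i := Finsupp.mapRange.linearMap i)
    (p := Finsupp.mapRange.linearMap p) ?_
  rw [← Finsupp.mapRange.linearMap_comp, h, Finsupp.mapRange.linearMap_id]

end Add

/-! ### `G_C`-projectivity as Ext-vanishing plus a coresolution -/

section Resolutions

variable {R : Type u} [Ring R]
variable {M N F : Type u} [AddCommGroup M] [Module R M] [AddCommGroup N] [Module R N]
    [AddCommGroup F] [Module R F]

variable (R) in
/-- `M` has a projective resolution that stays exact under `Hom(-, F)`, `F ∈ 𝓕`. -/
def HasRes (𝓕 : ModuleCat.{u} R → Prop) (M : Type u) [AddCommGroup M] [Module R M] : Prop :=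
  ∃ (P : ℕ → ModuleCat.{u} R) (d : ∀ n, P (n + 1) →ₗ[R] P n) (ε : P 0 →ₗ[R] M),
    (∀ n, Module.Projective R (P n)) ∧ Function.Surjective ε ∧ Function.Exact (d 0) ε ∧
    (∀ n, Function.Exact (d (n + 1)) (d n)) ∧
    ∀ F, 𝓕 F → ∀ n, Function.Exact (fun g : P n →ₗ[R] F => g ∘ₗ d n)
      (fun g : P (n + 1) →ₗ[R] F => g ∘ₗ d (n + 1))

variable (R) in
/-- `M` has an `Add(C)`-coresolution that stays exact under `Hom(-, F)`, `F ∈ 𝓕`. -/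
def HasCores (C : Type u) [AddCommGroup C] [Module R C] (𝓕 : ModuleCat.{u} R → Prop)
    (M : Type u) [AddCommGroup M] [Module R M] : Prop :=
  ∃ (A : ℕ → ModuleCat.{u} R) (ε : M →ₗ[R] A 0) (d : ∀ n, A n →ₗ[R] A (n + 1)),
    (∀ n, IsAdd R C (A n)) ∧
    (Function.Injective ε ∧ Function.Exact ε (d 0) ∧ ∀ n, Function.Exact (d n) (d (n + 1))) ∧
    ∀ F : ModuleCat.{u} R, 𝓕 F →
      (Function.Surjective (fun g : A 0 →ₗ[R] F => g ∘ₗ ε) ∧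
       Function.Exact (fun g : A 1 →ₗ[R] F => g ∘ₗ d 0) (fun g : A 0 →ₗ[R] F => g ∘ₗ ε) ∧
       ∀ n, Function.Exact (fun g : A (n + 2) →ₗ[R] F => g ∘ₗ d (n + 1))
         (fun g : A (n + 1) →ₗ[R] F => g ∘ₗ d n))

/-- In a spliced sequence `f'g`, `fg'`, exactness follows from that of the short pieces. -/
theorem SES.exact_splice {K X L Y Z : Type u} [AddCommGroup K] [Module R K] [AddCommGroup X]
    [Module R X] [AddCommGroup L] [Module R L] [AddCommGroup Y] [Module R Y] [AddCommGroup Z]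
    [Module R Z] {f : K →ₗ[R] X} {g : X →ₗ[R] L} (h : SES f g) {p : Y →ₗ[R] K}
    (hp : Function.Surjective p) {i : L →ₗ[R] Z} (hi : Function.Injective i) :
    Function.Exact (f ∘ₗ p) (i ∘ₗ g) := by
  intro x
  rw [LinearMap.comp_apply, map_eq_zero_iff i hi, h.exact x]
  constructor
  · rintro ⟨k, rfl⟩
    obtain ⟨y, rfl⟩ := hp k
    exact ⟨y, rfl⟩
  · rintro ⟨y, rfl⟩
    exact ⟨p y, rfl⟩

theorem SES.hom_exact_splice {K X L Y Z : Type u} [AddCommGroup K] [Module R K] [AddCommGroup X]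
    [Module R X] [AddCommGroup L] [Module R L] [AddCommGroup Y] [Module R Y] [AddCommGroup Z]
    [Module R Z] {f : K →ₗ[R] X} {g : X →ₗ[R] L} (h : SES f g) {p : Y →ₗ[R] K}
    (hp : Function.Surjective p) {i : L →ₗ[R] Z}
    (hi : ∀ k : L →ₗ[R] F, ∃ k' : Z →ₗ[R] F, k' ∘ₗ i = k) :
    Function.Exact (fun k : Z →ₗ[R] F => k ∘ₗ (i ∘ₗ g)) (fun k : X →ₗ[R] F => k ∘ₗ (f ∘ₗ p)) := by
  intro k
  constructor
  · intro hk
    obtain ⟨k₁, rfl⟩ := h.desc k (LinearMap.ext fun x => by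
      obtain ⟨y, rfl⟩ := hp x
      exact LinearMap.congr_fun hk y)
    obtain ⟨k₂, rfl⟩ := hi k₁
    exact ⟨k₂, rfl⟩
  · rintro ⟨k', rfl⟩
    refine LinearMap.ext fun y => ?_
    simp [h.exact.apply_apply_eq_zero]

/-- Any free resolution works: if `Ext(M, F)` vanishes, dimension shifting makes it vanish on all
syzygies, and then maps to `F` extend along each inclusion of a syzygy. -/
theorem hasRes (M : Type u) [AddCommGroup M] [Module R M] :
    HasRes R (fun F => ExtVan R M F) M := by
  choose K f g h using fun N : ModuleCat.{u} R => exists_free_ses R N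
  let N : ℕ → ModuleCat.{u} R := fun n => 
    Nat.rec (motive := fun _ => ModuleCat.{u} R) (ModuleCat.of R M) (fun _ N => K N) n
  have hN : ∀ F : ModuleCat.{u} R, ExtVan R M F → ∀ n, ExtVan R (N n).carrier F := fun F hF n => by
    induction n with
    | zero => exact hF
    | succ n ih => exact ExtVan.ker (h (N n)) .of_projective ih
  refine ⟨fun n => ModuleCat.of R (N n →₀ R), fun n => f (N n) ∘ₗ g (N (n + 1)), g (N 0),
    fun n => inferInstanceAs (Module.Projective R (N n →₀ R)), (h (N 0)).surj, ?_, fun n => ?_,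
    fun F hF n => ?_⟩
  · exact (h (N 0)).exact_splice (h (N 1)).surj (i := LinearMap.id) Function.injective_id
  · exact (h (N (n + 1))).exact_splice (h (N (n + 2))).surj (h (N n)).inj
  · exact (h (N (n + 1))).hom_exact_splice (h (N (n + 2))).surj
      ((hN F hF n).extend (h (N n)))

/-- The kernel of the augmentation has a resolution of the same kind, so the class of modules with
such resolutions is closed under this syzygy and `ExtVan.of_class` applies. -/
theorem HasRes.extVan {𝓕 : ModuleCat.{u} R → Prop} (h : HasRes R 𝓕 M) (F : ModuleCat.{u} R)
    (hF : 𝓕 F) : ExtVan R M F := by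
  refine ExtVan.of_class (fun N => HasRes R 𝓕 N) ?_ (ModuleCat.of R M) h
  rintro N ⟨P, d, ε, hP, hs, he, hd, hF'⟩
  refine ⟨ModuleCat.of R (LinearMap.ker ε), P 0, (LinearMap.ker ε).subtype, ε, ?_, hP 0,
    SES.ker_subtype ε hs, fun k => ?_⟩
  · refine ⟨fun n => P (n + 1), fun n => d (n + 1), (d 0).codRestrict _ fun x => ?_,
      fun n => hP _, ?_, ?_, fun n => hd (n + 1), fun F hF n => hF' F hF (n + 1)⟩
    · exact he.apply_apply_eq_zero x
    · rintro ⟨x, hx⟩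
      obtain ⟨y, rfl⟩ := (he x).1 hx
      exact ⟨y, rfl⟩
    · intro x
      rw [← hd 0 x]
      exact Subtype.ext_iff
  · let q : P 1 →ₗ[R] LinearMap.ker ε := (d 0).codRestrict _ he.apply_apply_eq_zero
    -- A map `k` on the syzygy becomes a cocycle on `P 1`; exactness of the Hom sequence there makes
    -- it a coboundary, which is the required extension to `P 0`.
    obtain ⟨k', hk'⟩ := (hF' F hF 0 (k ∘ₗ q)).1 (by
      refine LinearMap.ext fun x => ?_
      have : q (d 1 x) = 0 := Subtype.ext ((hd 0).apply_apply_eq_zero x)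
      simp [this])
    refine ⟨k', LinearMap.ext ?_⟩
    rintro ⟨x, hx⟩
    obtain ⟨y, rfl⟩ := (he x).1 hx
    exact LinearMap.congr_fun hk' y

variable {C : Type u} [AddCommGroup C] [Module R C] {𝓕 : ModuleCat.{u} R → Prop}

/-- Coinductive construction: cosyzygies are chosen again and again inside the class and the short
exact sequences are spliced. -/
theorem HasCores.of_class (𝒢 : ModuleCat.{u} R → Prop)
    (h𝒢 : ∀ M, 𝒢 M → ∃ (A N : ModuleCat.{u} R) (f : M →ₗ[R] A) (g : A →ₗ[R] N),
      IsAdd R C A ∧ 𝒢 N ∧ SES f g ∧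
      ∀ F : ModuleCat.{u} R, 𝓕 F → ∀ k : M →ₗ[R] F, ∃ k' : A →ₗ[R] F, k' ∘ₗ f = k)
    (M : ModuleCat.{u} R) (hM : 𝒢 M) : HasCores R C 𝓕 M := by
  choose A K f g hA hK h hF using fun N : {N // 𝒢 N} => h𝒢 N.1 N.2
  let N : ℕ → {N // 𝒢 N} := fun n => Nat.rec ⟨M, hM⟩ (fun _ N => ⟨K N, hK N⟩) n
  refine ⟨fun n => A (N n), f (N 0), fun n => f (N (n + 1)) ∘ₗ g (N n), fun n => hA _,
    ⟨(h (N 0)).inj, ?_, fun n => ?_⟩, fun F hF' => ⟨hF (N 0) F hF', ?_, fun n => ?_⟩⟩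
  · exact (h (N 0)).exact_splice (p := LinearMap.id) Function.surjective_id (h (N 1)).inj
  · exact (h (N (n + 1))).exact_splice (h (N n)).surj (h (N (n + 2))).inj
  · exact (h (N 0)).hom_exact_splice (p := LinearMap.id) Function.surjective_id (hF (N 1) F hF')
  · exact (h (N (n + 1))).hom_exact_splice (h (N n)).surj (hF (N (n + 2)) F hF')

theorem HasCores.exists_ses (hM : HasCores R C 𝓕 M) :
    ∃ (A N : ModuleCat.{u} R) (f : M →ₗ[R] A) (g : A →ₗ[R] N),
      IsAdd R C A ∧ HasCores R C 𝓕 N ∧ SES f g ∧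
      ∀ F : ModuleCat.{u} R, 𝓕 F → ∀ k : M →ₗ[R] F, ∃ k' : A →ₗ[R] F, k' ∘ₗ f = k := by
  obtain ⟨A, ε, d, hA, ⟨hi, he, hd⟩, hF⟩ := hM
  refine ⟨A 0, ModuleCat.of R (LinearMap.range (d 0)), ε, (d 0).rangeRestrict, hA 0,
    ⟨fun n => A (n + 1), (LinearMap.range (d 0)).subtype, fun n => d (n + 1), fun n => hA _,
      ⟨Subtype.val_injective, ?_, fun n => hd _⟩, fun F h => ⟨fun k => ?_, ?_,
        fun n => (hF F h).2.2 (n + 1)⟩⟩, ⟨hi, ?_, (d 0).surjective_rangeRestrict⟩,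
    fun F h => (hF F h).1⟩
  · intro x
    rw [hd 0 x]
    simp
  · obtain ⟨k', hk'⟩ := ((hF F h).2.1 (k ∘ₗ (d 0).rangeRestrict)).1 (by
      refine LinearMap.ext fun x => ?_
      have : (d 0).rangeRestrict (ε x) = 0 := Subtype.ext (he.apply_apply_eq_zero x)
      simp [this])
    refine ⟨k', LinearMap.ext ?_⟩
    rintro ⟨_, x, rfl⟩
    exact LinearMap.congr_fun hk' x
  · intro k
    rw [← (hF F h).2.2 0 k]
    constructor
    · intro hk
      exact LinearMap.ext fun x => LinearMap.congr_fun hk ⟨d 0 x, x, rfl⟩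
    · intro hk
      refine LinearMap.ext ?_
      rintro ⟨_, x, rfl⟩
      exact LinearMap.congr_fun hk x
  · intro x
    rw [← he x]
    exact Subtype.ext_iff

theorem TwoSided.hasRes (S : TwoSided R) (hS : S.IsExact)
    (hP : ∀ n, Module.Projective R (S.P n)) (e : M ≃ₗ[R] LinearMap.range S.mid) :
    HasRes R (fun F => S.HomExact F) M := by
  refine ⟨S.P, S.dP, e.symm.toLinearMap ∘ₗ S.mid.rangeRestrict, hP,
    e.symm.surjective.comp S.mid.surjective_rangeRestrict, fun x => ?_, hS.1,
    fun F hF => hF.2.2.2⟩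
  rw [← hS.2.1 x, LinearMap.comp_apply, LinearEquiv.coe_coe, LinearEquiv.map_eq_zero_iff]
  exact Subtype.ext_iff

/-- Cutting the two-sided sequence at `M` gives a projective resolution, whose Hom-exactness amounts
to Ext-vanishing, and a coresolution. Conversely any free resolution of `M` may be glued to the
coresolution, so the left half need not be constructed with care. -/
theorem isGProj_iff : IsGProj R C M ↔
    (∀ F : ModuleCat.{u} R, IsAdd R C F → ExtVan R M F) ∧
      HasCores R C (fun F => IsAdd R C F) M := by
  constructor
  · rintro ⟨S, ⟨e₁, e₂, e₃, e₄⟩, ⟨hP, hA⟩, hS, ⟨e⟩⟩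
    let q : S.P 0 →ₗ[R] M := e.symm.toLinearMap ∘ₗ S.mid.rangeRestrict
    let i : M →ₗ[R] S.A 0 := (LinearMap.range S.mid).subtype ∘ₗ e.toLinearMap
    have hq : Function.Surjective q := e.symm.surjective.comp S.mid.surjective_rangeRestrict
    have hi : Function.Injective i := Subtype.val_injective.comp e.injective
    have hiq : i ∘ₗ q = S.mid := by ext; simp [i, q]
    have hiq' : ∀ x, i (q x) = S.mid x := LinearMap.congr_fun hiq
    constructor
    · exact fun F hF => (S.hasRes ⟨e₁, e₂, e₃, e₄⟩ hP e).extVan F (hS F hF)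
    · refine ⟨S.A, i, S.dA, hA, ⟨hi, fun x => ?_, e₄⟩, fun F hF => ⟨fun k => ?_, fun k => ?_,
        (hS F hF).1⟩⟩
      · rw [e₃ x, ← hiq]
        constructor
        · rintro ⟨y, rfl⟩; exact ⟨_, rfl⟩
        · rintro ⟨y, rfl⟩
          obtain ⟨z, rfl⟩ := hq y
          exact ⟨z, rfl⟩
      · obtain ⟨k', hk'⟩ := ((hS F hF).2.2.1 (k ∘ₗ q)).1 (by
          refine LinearMap.ext fun x => ?_
          have : q (S.dP 0 x) = 0 := hi (by
            rw [hiq', map_zero]; exact e₂.apply_apply_eq_zero x)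
          simp [this])
        refine ⟨k', LinearMap.ext fun x => ?_⟩
        obtain ⟨z, rfl⟩ := hq x
        have := LinearMap.congr_fun hk' z
        simpa [hiq'] using this
      · rw [← (hS F hF).2.1 k, ← hiq]
        constructor
        · intro h
          exact LinearMap.ext fun x => LinearMap.congr_fun h (q x)
        · intro h
          refine LinearMap.ext fun x => ?_
          obtain ⟨z, rfl⟩ := hq x
          exact LinearMap.congr_fun h z
  · rintro ⟨hE, A, i, dA, hA, ⟨hi, hiA, hdA⟩, hF⟩
    obtain ⟨P, dP, q, hP, hq, hPq, hdP, hPF⟩ := hasRes (R := R) M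
    refine ⟨⟨P, A, dP, i ∘ₗ q, dA⟩, ⟨hdP, ?_, ?_, hdA⟩, ⟨hP, hA⟩, fun F hF' =>
      ⟨(hF F hF').2.2, ?_, ?_, hPF F (hE F hF')⟩,
      ⟨(LinearEquiv.ofInjective i hi).trans (LinearEquiv.ofEq _ _ ?_)⟩⟩
    · intro x
      rw [← hPq x]
      exact map_eq_zero_iff i hi
    · intro x
      rw [hiA x]
      constructor
      · rintro ⟨y, rfl⟩
        obtain ⟨z, rfl⟩ := hq y
        exact ⟨z, rfl⟩
      · rintro ⟨z, rfl⟩; exact ⟨_, rfl⟩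
    · intro k
      rw [← (hF F hF').2.1 k]
      constructor
      · intro h
        refine LinearMap.ext fun x => ?_
        obtain ⟨z, rfl⟩ := hq x
        exact LinearMap.congr_fun h z
      · intro h
        exact LinearMap.ext fun x => LinearMap.congr_fun h (q x)
    · intro k
      constructor
      · intro hk
        have hle : LinearMap.ker q ≤ LinearMap.ker k := by
          rintro x hx
          obtain ⟨y, rfl⟩ := (hPq x).1 hx
          exact LinearMap.congr_fun hk y
        obtain ⟨k₁, rfl⟩ := (SES.ker_subtype q hq).desc k
          (LinearMap.ext fun x => hle x.2)
        obtain ⟨k₂, rfl⟩ := (hF F hF').1 k₁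
        exact ⟨k₂, rfl⟩
      · rintro ⟨k', rfl⟩
        refine LinearMap.ext fun x => ?_
        simp [hPq.apply_apply_eq_zero]
    · exact (LinearMap.range_comp_of_range_eq_top i (LinearMap.range_eq_top.2 hq)).symm

end Resolutions

/-! ### Diagram lemmas: horseshoes, composites and pullbacks -/

section Diagrams

/-- The cokernels of the monomorphisms in a horseshoe diagram form a short exact sequence. -/
theorem SES.horseshoe_coker {R : Type u} [Ring R] {K X M A K' B M' : Type u}
    [AddCommGroup K] [Module R K] [AddCommGroup X] [Module R X] [AddCommGroup M] [Module R M]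
    [AddCommGroup A] [Module R A] [AddCommGroup K'] [Module R K']
    [AddCommGroup B] [Module R B] [AddCommGroup M'] [Module R M']
    {f : K →ₗ[R] X} {g : X →ₗ[R] M} (h : SES f g)
    {a : K →ₗ[R] A} {a' : A →ₗ[R] K'} (ha : SES a a') {b : M →ₗ[R] B} {b' : B →ₗ[R] M'}
    (hb : SES b b') (c : X →ₗ[R] A) (hc : c ∘ₗ f = a) :
    ∃ (Q : ModuleCat.{u} R) (p : A × B →ₗ[R] Q) (i : K' →ₗ[R] Q) (j : Q →ₗ[R] M'),
      SES (c.prod (b ∘ₗ g)) p ∧ SES i j := by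
  have hcf : ∀ k, c (f k) = a k := LinearMap.congr_fun hc
  have hs : SES (c.prod (b ∘ₗ g)) (LinearMap.range (c.prod (b ∘ₗ g))).mkQ := by
    refine SES.mkQ_range _ ?_
    rw [injective_iff_map_eq_zero]
    intro x hx
    have h2 : b (g x) = 0 := congrArg Prod.snd hx
    rw [map_eq_zero_iff b hb.inj, h.exact x] at h2
    obtain ⟨k, rfl⟩ := h2
    have h1 : c (f k) = 0 := congrArg Prod.fst hx
    rw [hcf, map_eq_zero_iff a ha.inj] at h1
    rw [h1, map_zero]
  obtain ⟨i, hi⟩ := ha.desc ((LinearMap.range (c.prod (b ∘ₗ g))).mkQ ∘ₗ LinearMap.inl R A B)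
    (LinearMap.ext fun k => (hs.exact _).2 ⟨f k, by
      simp [hcf, h.exact.apply_apply_eq_zero]⟩)
  obtain ⟨j, hj⟩ := hs.desc (b' ∘ₗ LinearMap.snd R A B)
    (LinearMap.ext fun x => hb.exact.apply_apply_eq_zero _)
  have hi' : ∀ x, i (a' x) = (LinearMap.range (c.prod (b ∘ₗ g))).mkQ (x, 0) :=
    LinearMap.congr_fun hi
  have hj' : ∀ x, j ((LinearMap.range (c.prod (b ∘ₗ g))).mkQ x) = b' x.2 := LinearMap.congr_fun hj
  refine ⟨ModuleCat.of R _, _, i, j, hs, ?_, fun q => ⟨fun hq => ?_, ?_⟩, fun m => ?_⟩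
  · rw [injective_iff_map_eq_zero]
    intro k hk
    obtain ⟨x, rfl⟩ := ha.surj k
    rw [hi', hs.exact] at hk
    obtain ⟨y, hy⟩ := hk
    have h2 : b (g y) = 0 := congrArg Prod.snd hy
    rw [map_eq_zero_iff b hb.inj, h.exact y] at h2
    obtain ⟨k, rfl⟩ := h2
    have h1 : c (f k) = x := congrArg Prod.fst hy
    rw [← h1, hcf]
    exact ha.exact.apply_apply_eq_zero k
  · obtain ⟨⟨x, y⟩, rfl⟩ := hs.surj q
    rw [hj', hb.exact] at hq
    obtain ⟨m, rfl⟩ := hq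
    obtain ⟨z, rfl⟩ := h.surj m
    refine ⟨a' (x - c z), ?_⟩
    rw [hi', ← sub_eq_zero, ← map_sub, hs.exact]
    exact ⟨-z, by simp⟩
  · rintro ⟨k, rfl⟩
    obtain ⟨x, rfl⟩ := ha.surj k
    rw [hi', hj', map_zero]
  · obtain ⟨y, rfl⟩ := hb.surj m
    exact ⟨_, hj' (0, y)⟩

/-- Third isomorphism theorem for `K ⊆ X ⊆ A`: `A/K` is an extension of `A/X` by `X/K`. -/
theorem SES.coker_comp {R : Type u} [Ring R] {K X M A X' : Type u}
    [AddCommGroup K] [Module R K] [AddCommGroup X] [Module R X] [AddCommGroup M] [Module R M]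
    [AddCommGroup A] [Module R A] [AddCommGroup X'] [Module R X']
    {f : K →ₗ[R] X} {g : X →ₗ[R] M} (h : SES f g)
    {a : X →ₗ[R] A} {a' : A →ₗ[R] X'} (ha : SES a a') :
    ∃ (Q : ModuleCat.{u} R) (p : A →ₗ[R] Q) (i : M →ₗ[R] Q) (j : Q →ₗ[R] X'),
      SES (a ∘ₗ f) p ∧ SES i j := by
  have hs := SES.mkQ_range (a ∘ₗ f) (ha.inj.comp h.inj)
  obtain ⟨i, hi⟩ := h.desc ((LinearMap.range (a ∘ₗ f)).mkQ ∘ₗ a)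
    (LinearMap.ext fun x => hs.exact.apply_apply_eq_zero x)
  obtain ⟨j, hj⟩ := hs.desc a' (LinearMap.ext fun x => ha.exact.apply_apply_eq_zero _)
  have hi' : ∀ x, i (g x) = (LinearMap.range (a ∘ₗ f)).mkQ (a x) := LinearMap.congr_fun hi
  have hj' : ∀ x, j ((LinearMap.range (a ∘ₗ f)).mkQ x) = a' x := LinearMap.congr_fun hj
  refine ⟨ModuleCat.of R _, _, i, j, hs, ?_, fun q => ⟨fun hq => ?_, ?_⟩, fun m => ?_⟩
  · rw [injective_iff_map_eq_zero]
    intro m hm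
    obtain ⟨x, rfl⟩ := h.surj m
    rw [hi', hs.exact] at hm
    obtain ⟨k, hk⟩ := hm
    rw [← ha.inj hk]
    exact h.exact.apply_apply_eq_zero k
  · obtain ⟨y, rfl⟩ := hs.surj q
    rw [hj', ha.exact] at hq
    obtain ⟨x, rfl⟩ := hq
    exact ⟨g x, hi' x⟩
  · rintro ⟨k, rfl⟩
    obtain ⟨x, rfl⟩ := h.surj k
    rw [hi', hj']
    exact ha.exact.apply_apply_eq_zero x
  · obtain ⟨y, rfl⟩ := ha.surj m
    exact ⟨_, hj' y⟩

/-- Dual of `SES.coker_comp`: the preimage of `K` in a cover `H` of `X` is an extension of `K` by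
the kernel of the cover. -/
theorem SES.ker_comp {R : Type u} [Ring R] {K X M K' H : Type u}
    [AddCommGroup K] [Module R K] [AddCommGroup X] [Module R X] [AddCommGroup M] [Module R M]
    [AddCommGroup K'] [Module R K'] [AddCommGroup H] [Module R H]
    {f : K →ₗ[R] X} {g : X →ₗ[R] M} (h : SES f g)
    {a : K' →ₗ[R] H} {a' : H →ₗ[R] X} (ha : SES a a') :
    ∃ (L : ModuleCat.{u} R) (l : L →ₗ[R] H) (i : K' →ₗ[R] L) (j : L →ₗ[R] K),
      SES l (g ∘ₗ a') ∧ SES i j := by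
  have hs := SES.ker_subtype (g ∘ₗ a') (h.surj.comp ha.surj)
  obtain ⟨i, hi⟩ := hs.lift a (LinearMap.ext fun x => by simp [ha.exact.apply_apply_eq_zero])
  obtain ⟨j, hj⟩ := h.lift (a' ∘ₗ (LinearMap.ker (g ∘ₗ a')).subtype)
    (LinearMap.ext fun x => x.2)
  have hi' : ∀ x, ((i x : LinearMap.ker (g ∘ₗ a')) : H) = a x := LinearMap.congr_fun hi
  have hj' : ∀ x : LinearMap.ker (g ∘ₗ a'), f (j x) = a' x := LinearMap.congr_fun hj
  refine ⟨ModuleCat.of R _, _, i, j, hs, fun x y hxy => ha.inj (by rw [← hi', hxy, hi']),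
    fun x => ?_, fun k => ?_⟩
  · rw [← map_eq_zero_iff f h.inj, hj', ha.exact]
    constructor
    · rintro ⟨y, hy⟩
      exact ⟨y, Subtype.ext ((hi' y).trans hy)⟩
    · rintro ⟨y, rfl⟩
      exact ⟨y, (hi' y).symm⟩
  · obtain ⟨x, hx⟩ := ha.surj (f k)
    refine ⟨⟨x, ?_⟩, h.inj ?_⟩
    · simp [hx, h.exact.apply_apply_eq_zero]
    · rw [hj', hx]

/-- The kernels of the epimorphisms in a horseshoe diagram form a short exact sequence. -/
theorem SES.horseshoe_ker {R : Type u} [Ring R] {K X M A K' B M' : Type u}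
    [AddCommGroup K] [Module R K] [AddCommGroup X] [Module R X] [AddCommGroup M] [Module R M]
    [AddCommGroup A] [Module R A] [AddCommGroup K'] [Module R K']
    [AddCommGroup B] [Module R B] [AddCommGroup M'] [Module R M']
    {f : K →ₗ[R] X} {g : X →ₗ[R] M} (h : SES f g)
    {a' : K' →ₗ[R] A} {a : A →ₗ[R] K} (ha : SES a' a) {b' : M' →ₗ[R] B} {b : B →ₗ[R] M}
    (hb : SES b' b) (c : B →ₗ[R] X) (hc : g ∘ₗ c = b) :
    ∃ (L : ModuleCat.{u} R) (l : L →ₗ[R] A × B) (i : K' →ₗ[R] L) (j : L →ₗ[R] M'),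
      SES l ((f ∘ₗ a).coprod c) ∧ SES i j := by
  have hgc : ∀ x, g (c x) = b x := LinearMap.congr_fun hc
  have hgf : ∀ x, g (f x) = 0 := h.exact.apply_apply_eq_zero
  have hs := SES.ker_subtype ((f ∘ₗ a).coprod c) (fun x => by
    obtain ⟨y, hy⟩ := hb.surj (g x)
    obtain ⟨k, hk⟩ := (h.exact (x - c y)).1 (by rw [map_sub, hgc, hy, sub_self])
    obtain ⟨z, rfl⟩ := ha.surj k
    exact ⟨(z, y), by simp [hk]⟩)
  obtain ⟨i, hi⟩ := hs.lift (LinearMap.inl R A B ∘ₗ a')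
    (LinearMap.ext fun x => by simp [ha.exact.apply_apply_eq_zero])
  obtain ⟨j, hj⟩ := hb.lift (LinearMap.snd R A B ∘ₗ (LinearMap.ker ((f ∘ₗ a).coprod c)).subtype)
    (LinearMap.ext fun x => by
      have : f (a x.1.1) + c x.1.2 = 0 := x.2
      have := congrArg g this
      rwa [map_add, hgf, hgc, zero_add, map_zero] at this)
  have hi' : ∀ x, ((i x : LinearMap.ker ((f ∘ₗ a).coprod c)) : A × B) = (a' x, 0) :=
    LinearMap.congr_fun hi
  have hj' : ∀ x : LinearMap.ker ((f ∘ₗ a).coprod c), b' (j x) = x.1.2 := LinearMap.congr_fun hj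
  refine ⟨ModuleCat.of R _, _, i, j, hs, fun x y hxy => ha.inj ?_, fun x => ?_, fun m => ?_⟩
  · have := (hi' x).symm.trans ((congrArg Subtype.val hxy).trans (hi' y))
    exact congrArg Prod.fst this
  · rw [← map_eq_zero_iff b' hb.inj, hj']
    constructor
    · intro hx
      have h1 : f (a x.1.1) = 0 := by
        have : f (a x.1.1) + c x.1.2 = 0 := x.2
        rwa [hx, map_zero, add_zero] at this
      rw [map_eq_zero_iff f h.inj, ha.exact] at h1
      obtain ⟨y, hy⟩ := h1
      exact ⟨y, Subtype.ext ((hi' y).trans (Prod.ext hy hx.symm))⟩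
    · rintro ⟨y, rfl⟩
      rw [hi']
  · obtain ⟨k, hk⟩ := (h.exact (c (b' m))).1 (by
      rw [hgc, hb.exact.apply_apply_eq_zero])
    obtain ⟨x, rfl⟩ := ha.surj k
    refine ⟨⟨(-x, b' m), by simp [hk]⟩, hb.inj (by rw [hj'])⟩

/-- The fibre product of `X` and `X'` over `M`, the object behind Schanuel's lemma; it serves to
compare two covers of `M`. -/
theorem SES.pullback {R : Type u} [Ring R] {K X M K' X' : Type u}
    [AddCommGroup K] [Module R K] [AddCommGroup X] [Module R X] [AddCommGroup M] [Module R M]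
    [AddCommGroup K'] [Module R K'] [AddCommGroup X'] [Module R X']
    {f : K →ₗ[R] X} {g : X →ₗ[R] M} (h : SES f g)
    {f' : K' →ₗ[R] X'} {g' : X' →ₗ[R] M} (h' : SES f' g') :
    ∃ (Z : ModuleCat.{u} R) (i : K →ₗ[R] Z) (p : Z →ₗ[R] X') (i' : K' →ₗ[R] Z) (p' : Z →ₗ[R] X),
      SES i p ∧ SES i' p' := by
  let Z := LinearMap.ker ((g ∘ₗ LinearMap.fst R X X') - (g' ∘ₗ LinearMap.snd R X X'))
  have hZ : ∀ z : X × X', z ∈ Z ↔ g z.1 = g' z.2 := fun z => by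
    simp [Z, LinearMap.mem_ker, sub_eq_zero]
  refine ⟨ModuleCat.of R Z,
    (LinearMap.inl R X X' ∘ₗ f).codRestrict Z fun k => (hZ _).2 ?_, LinearMap.snd R X X' ∘ₗ Z.subtype,
    (LinearMap.inr R X X' ∘ₗ f').codRestrict Z fun k => (hZ _).2 ?_, LinearMap.fst R X X' ∘ₗ Z.subtype,
    ⟨fun x y hxy => h.inj ?_, ?_, fun x => ?_⟩, ⟨fun x y hxy => h'.inj ?_, ?_, fun x => ?_⟩⟩
  · simp [h.exact.apply_apply_eq_zero]
  · simp [h'.exact.apply_apply_eq_zero]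
  · exact congrArg (fun z : Z => z.1.1) hxy
  · rintro ⟨⟨x, x'⟩, hz⟩
    constructor
    · rintro (rfl : x' = 0)
      have : g x = 0 := by simpa using (hZ _).1 hz
      obtain ⟨k, rfl⟩ := (h.exact x).1 this
      exact ⟨k, rfl⟩
    · rintro ⟨k, hk⟩
      exact (congrArg (fun z : Z => z.1.2) hk).symm
  · obtain ⟨y, hy⟩ := h.surj (g' x)
    exact ⟨⟨(y, x), (hZ _).2 hy⟩, rfl⟩
  · exact congrArg (fun z : Z => z.1.2) hxy
  · rintro ⟨⟨x, x'⟩, hz⟩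
    constructor
    · rintro (rfl : x = 0)
      have : g' x' = 0 := by simpa using ((hZ _).1 hz).symm
      obtain ⟨k, rfl⟩ := (h'.exact x').1 this
      exact ⟨k, rfl⟩
    · rintro ⟨k, hk⟩
      exact (congrArg (fun z : Z => z.1.1) hk).symm
  · obtain ⟨y, hy⟩ := h'.surj (g x)
    exact ⟨⟨(x, y), (hZ _).2 hy.symm⟩, rfl⟩

end Diagrams

/-! ### Closure properties of `G_C`-projective modules -/

section GProj

variable {R : Type u} [Ring R] {C : Type u} [AddCommGroup C] [Module R C]
variable {K X M N : Type u} [AddCommGroup K] [Module R K] [AddCommGroup X] [Module R X]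
    [AddCommGroup M] [Module R M] [AddCommGroup N] [Module R N]

variable (R C) in
/-- `Ext^i_R(M, F) = 0` for all `i ≥ 1` and all `F ∈ Add_R(C)`. -/
def IsPerp (M : Type u) [AddCommGroup M] [Module R M] : Prop :=
  ∀ F : ModuleCat.{u} R, IsAdd R C F → ExtVan R M F

theorem IsPerp.extVan (hM : IsPerp R C M) (hN : IsAdd R C N) : ExtVan R M N :=
  hM (ModuleCat.of R N) hN

theorem isPerp_iff : IsPerp R C M ↔ ∀ I : Type u, ExtVan R M (I →₀ C) := by
  constructor
  · exact fun h I => h (ModuleCat.of R (I →₀ C)) (.finsupp_self I)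
  · intro h F hF
    obtain ⟨I, i, p, hip⟩ := isAdd_iff_retract.1 hF
    exact (h I).retract_right hip

theorem IsPerp.of_isAdd (hC : IsPerp R C C) (hM : IsAdd R C M) : IsPerp R C M := by
  intro F hF
  obtain ⟨I, i, p, hip⟩ := isAdd_iff_retract.1 hM
  exact ((hC F hF).finsupp I).retract_left hip

theorem IsGProj.isPerp (h : IsGProj R C M) : IsPerp R C M := (isGProj_iff.1 h).1

theorem IsGProj.of_equiv (h : IsGProj R C M) (e : M ≃ₗ[R] N) : IsGProj R C N := by
  obtain ⟨S, h₁, h₂, h₃, ⟨e'⟩⟩ := h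
  exact ⟨S, h₁, h₂, h₃, ⟨e.symm.trans e'⟩⟩

/-- Hom-exactness of the spliced coresolution costs nothing here: each cosyzygy lies in the class,
hence is orthogonal to `Add(C)`, so maps extend along every embedding. No assumption on `C` enters,
which permits its use for `C₁` and `C₂` before anything is known about them. -/
theorem IsGProj.of_class (𝒢 : ModuleCat.{u} R → Prop)
    (h𝒢 : ∀ M, 𝒢 M → IsPerp R C M ∧ ∃ (A N : ModuleCat.{u} R) (f : M →ₗ[R] A) (g : A →ₗ[R] N),
      IsAdd R C A ∧ 𝒢 N ∧ SES f g) (M : ModuleCat.{u} R) (hM : 𝒢 M) : IsGProj R C M := by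
  refine isGProj_iff.2 ⟨(h𝒢 M hM).1, HasCores.of_class 𝒢 ?_ M hM⟩
  intro M hM
  obtain ⟨-, A, N, f, g, hA, hN, h⟩ := h𝒢 M hM
  exact ⟨A, N, f, g, hA, hN, h, fun F hF => ((h𝒢 N hN).1 F hF).extend h⟩

/-- The cosyzygy `N` keeps a coresolution; its `Ext^1` vanishes by Hom-exactness at `M`, and its
higher Ext by shifting, where self-orthogonality of `C` disposes of the middle term. -/
theorem IsGProj.exists_ses (hC : IsPerp R C C) (h : IsGProj R C M) :
    ∃ (A N : ModuleCat.{u} R) (f : M →ₗ[R] A) (g : A →ₗ[R] N),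
      IsAdd R C A ∧ IsGProj R C N ∧ SES f g := by
  obtain ⟨hM, hM'⟩ := isGProj_iff.1 h
  obtain ⟨A, N, f, g, hA, hN, h, hext⟩ := hM'.exists_ses
  exact ⟨A, N, f, g, hA, isGProj_iff.2 ⟨fun F hF => ExtVan.coker h (hC.of_isAdd hA F hF) (hM F hF)
    (hext F hF), hN⟩, h⟩

theorem IsGProj.of_isAdd (hC : IsPerp R C C) (hM : IsAdd R C M) : IsGProj R C M :=
  IsGProj.of_class (fun N => IsAdd R C N) (fun N hN => ⟨hC.of_isAdd hN, N, ModuleCat.of R PUnit,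
    _, _, hN, .of_subsingleton, SES.id_zero⟩) (ModuleCat.of R M) hM

theorem IsGProj.of_subsingleton (hC : IsPerp R C C) [Subsingleton M] : IsGProj R C M :=
  .of_isAdd hC .of_subsingleton

theorem IsGProj.of_ses (hC : IsPerp R C C) {f : M →ₗ[R] X} {g : X →ₗ[R] N} (h : SES f g)
    (hM : IsPerp R C M) (hX : IsAdd R C X) (hN : IsGProj R C N) : IsGProj R C M := by
  refine IsGProj.of_class (fun L => IsGProj R C L ∨ L = ModuleCat.of R M) ?_ (ModuleCat.of R M)
    (Or.inr rfl)
  rintro L (hL | rfl)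
  · obtain ⟨A, N, f, g, hA, hN, h⟩ := hL.exists_ses hC
    exact ⟨hL.isPerp, A, N, f, g, hA, Or.inl hN, h⟩
  · exact ⟨hM, ModuleCat.of R X, ModuleCat.of R N, f, g, hX, Or.inl hN, h⟩

theorem IsGProj.extension (hC : IsPerp R C C) {f : K →ₗ[R] X} {g : X →ₗ[R] M} (h : SES f g)
    (hK : IsGProj R C K) (hM : IsGProj R C M) : IsGProj R C X := by
  refine IsGProj.of_class (fun X => ∃ (K M : ModuleCat.{u} R) (f : K →ₗ[R] X) (g : X →ₗ[R] M),
    SES f g ∧ IsGProj R C K ∧ IsGProj R C M) ?_ (ModuleCat.of R X)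
    ⟨ModuleCat.of R K, ModuleCat.of R M, f, g, h, hK, hM⟩
  rintro X ⟨K, M, f, g, h, hK, hM⟩
  refine ⟨fun F hF => ExtVan.mid h (hK.isPerp F hF) (hM.isPerp F hF), ?_⟩
  obtain ⟨A, K', a, a', hA, hK', ha⟩ := hK.exists_ses hC
  obtain ⟨B, M', b, b', hB, hM', hb⟩ := hM.exists_ses hC
  obtain ⟨c, hc⟩ := (hM.isPerp A hA).extend h a
  obtain ⟨Q, p, i, j, hs, hij⟩ := h.horseshoe_coker ha hb c hc
  exact ⟨ModuleCat.of R (A × B), Q, _, p, hA.prod hB, ⟨K', M', i, j, hij, hK', hM'⟩, hs⟩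

/-- Embed `X` in some `A ∈ Add(C)` with `G_C`-projective cokernel `X'`. The cokernel of `K → A` is
an extension of `X'` by `M`, hence `G_C`-projective, and so `K` has a cosyzygy of the right kind. -/
theorem IsGProj.ker (hC : IsPerp R C C) {f : K →ₗ[R] X} {g : X →ₗ[R] M} (h : SES f g)
    (hX : IsGProj R C X) (hM : IsGProj R C M) : IsGProj R C K := by
  obtain ⟨A, X', a, a', hA, hX', ha⟩ := hX.exists_ses hC
  obtain ⟨Q, p, i, j, hs, hij⟩ := h.coker_comp ha
  exact .of_ses hC hs (fun F hF => ExtVan.ker h (hX.isPerp F hF) (hM.isPerp F hF)) hA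
    (.extension hC hij hM hX')

theorem IsGProj.prod (hC : IsPerp R C C) (hM : IsGProj R C M) (hN : IsGProj R C N) :
    IsGProj R C (M × N) :=
  .extension hC SES.inl_snd hM hN

theorem IsGProj.finsupp (hC : IsPerp R C C) (I : Type u) (hM : IsGProj R C M) :
    IsGProj R C (I →₀ M) := by
  refine IsGProj.of_class (fun N => ∃ M : ModuleCat.{u} R, IsGProj R C M ∧
    N = ModuleCat.of R (I →₀ M)) ?_ (ModuleCat.of R (I →₀ M)) ⟨ModuleCat.of R M, hM, rfl⟩
  rintro _ ⟨M, hM, rfl⟩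
  obtain ⟨A, N, f, g, hA, hN, h⟩ := hM.exists_ses hC
  exact ⟨fun F hF => (hM.isPerp F hF).finsupp I, ModuleCat.of R (I →₀ A),
    ModuleCat.of R (I →₀ N), _, _, hA.finsupp I, ⟨N, hN, rfl⟩, h.finsupp I⟩

variable (R C) in
/-- `C` is self-orthogonal and `R` is `G_C`-projective. -/
structure IsWT : Prop where
  perp : IsPerp R C C
  ring : IsGProj R C R

/-- The coresolution clause of w-tilting is the coresolution half of `isGProj_iff` for `R`; the Ext
half is automatic because `R` is projective. -/
theorem IsWTilting.isWT (h : IsWTilting R C) : IsWT R C :=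
  ⟨isPerp_iff.2 h.ext_eq_zero,
    isGProj_iff.2 ⟨fun _ _ => .of_projective, h.exists_coresolution⟩⟩

theorem IsWT.free (h : IsWT R C) (I : Type u) : IsGProj R C (I →₀ R) := h.ring.finsupp h.perp I

/-- The Eilenberg swindle: a direct summand of `M` is the kernel of a surjective endomorphism of
a direct sum of copies of `M`. -/
theorem exists_ses_of_retract {i : N →ₗ[R] M} {p : M →ₗ[R] N} (hip : p ∘ₗ i = LinearMap.id) :
    ∃ (f : N →ₗ[R] (ULift.{u} ℕ →₀ M)) (g : (ULift.{u} ℕ →₀ M) →ₗ[R] (ULift.{u} ℕ →₀ M)),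
      SES f g := by
  have hpi : ∀ x, p (i x) = x := LinearMap.congr_fun hip
  let e : M →ₗ[R] M := i ∘ₗ p
  have he : ∀ x, e (e x) = e x := fun x => by simp [e, hpi]
  let up : ULift.{u} ℕ → ULift.{u} ℕ := fun n => ⟨n.down + 1⟩
  have hup : Function.Injective up := fun m n h => by
    have := congrArg ULift.down h
    exact ULift.ext _ _ (by simpa [up] using this)
  let s : (ULift.{u} ℕ →₀ M) →ₗ[R] (ULift.{u} ℕ →₀ M) := Finsupp.lcomapDomain up hup
  -- With `e = i ∘ p` idempotent, `g` is the identity on the `(1 - e)M` parts and the left shift on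
  -- the `eM` parts. Its kernel is therefore `eM ≅ N` in degree `0`.
  let g : (ULift.{u} ℕ →₀ M) →ₗ[R] (ULift.{u} ℕ →₀ M) :=
    Finsupp.mapRange.linearMap (LinearMap.id - e) + Finsupp.mapRange.linearMap e ∘ₗ s
  have hg : ∀ x n, g x n = x n - e (x n) + e (x (up n)) := fun x n => by
    simp [g, s, Finsupp.lcomapDomain]
  refine ⟨Finsupp.lsingle ⟨0⟩ ∘ₗ i, g, ?_, ?_, ?_⟩
  · refine (Finsupp.single_injective _).comp fun x y h => ?_
    rw [← hpi x, h, hpi]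
  · intro x
    constructor
    · intro hx
      have h1 : ∀ n, x n - e (x n) + e (x (up n)) = 0 := fun n => by rw [← hg, hx]; rfl
      have h2 : ∀ n, e (x (up n)) = 0 := fun n => by
        have := congrArg e (h1 n)
        simpa [he] using this
      have h3 : ∀ n, x n = e (x n) := fun n => by
        have := h1 n
        rwa [h2, add_zero, sub_eq_zero] at this
      refine ⟨p (x ⟨0⟩), ?_⟩
      ext ⟨n⟩
      cases n with
      | zero => simpa [e] using (h3 ⟨0⟩).symm
      | succ n =>
        have : x ⟨n + 1⟩ = 0 := (h3 ⟨n + 1⟩).trans (h2 ⟨n⟩)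
        rw [this]
        simp
    · rintro ⟨y, rfl⟩
      ext ⟨n⟩
      rw [hg]
      cases n with
      | zero => simp [e, hpi, up]
      | succ n => simp [up]
  · intro y
    -- The preimage keeps the `(1 - e)M` parts of `y` and shifts the `eM` parts one place to the
    -- right.
    refine ⟨Finsupp.mapRange.linearMap (LinearMap.id - e) y +
      Finsupp.mapDomain up (Finsupp.mapRange.linearMap e y), ?_⟩
    ext n
    rw [hg, Finsupp.add_apply, Finsupp.add_apply, Finsupp.mapDomain_apply hup]
    have hz : ∃ z, Finsupp.mapDomain up (Finsupp.mapRange.linearMap e y) n = e z := by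
      rcases n with ⟨n⟩
      cases n with
      | zero =>
        refine ⟨0, ?_⟩
        rw [map_zero]
        refine Finsupp.mapDomain_of_notMem_range _ _ ?_
        rintro ⟨m, hm⟩
        simpa [up] using congrArg ULift.down hm
      | succ n =>
        refine ⟨y ⟨n⟩, ?_⟩
        have := Finsupp.mapDomain_apply hup (Finsupp.mapRange.linearMap e y) ⟨n⟩
        simpa [up] using this
    obtain ⟨z, hz⟩ := hz
    rw [hz]
    simp [he]

/-- Free modules are direct sums of copies of the `G_C`-projective module `R`. For a summand of a
free module, the swindle replaces closure under summands by closure under kernels of epimorphisms.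
-/
theorem IsWT.projective (h : IsWT R C) [Module.Projective R M] : IsGProj R C M := by
  obtain ⟨i, hi⟩ := Module.projective_lifting_property (Finsupp.linearCombination R (id : M → M))
    LinearMap.id (Finsupp.linearCombination_id_surjective R M)
  obtain ⟨f, g, hs⟩ := exists_ses_of_retract hi
  have := (h.free M).finsupp h.perp (ULift.{u} ℕ)
  exact .ker h.perp hs this this

end GProj

/-! ### Relative Gorenstein dimension in short exact sequences -/

section Dimension

variable (R : Type u) [Ring R] (C : Type u) [AddCommGroup C] [Module R C]

/-- Inductive form of `G_C-pd(M) ≤ n`. -/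
def PdLE : ℕ → ∀ (M : Type u) [AddCommGroup M] [Module R M], Prop
  | 0, M, _, _ => IsGProj R C M
  | n + 1, M, _, _ => ∃ (K G : ModuleCat.{u} R) (f : K →ₗ[R] G) (g : G →ₗ[R] M),
      SES f g ∧ IsGProj R C G ∧ PdLE n K

variable {R C}
variable {K X M N : Type u} [AddCommGroup K] [Module R K] [AddCommGroup X] [Module R X]
    [AddCommGroup M] [Module R M] [AddCommGroup N] [Module R N]

theorem PdLE.of_equiv {n : ℕ} (h : PdLE R C n M) (e : M ≃ₗ[R] N) : PdLE R C n N := by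
  cases n with
  | zero => exact IsGProj.of_equiv h e
  | succ n =>
    obtain ⟨K, G, f, g, hs, hG, hK⟩ := h
    exact ⟨K, G, f, _, hs.of_right_equiv e, hG, hK⟩

theorem PdLE.of_ses {n : ℕ} {f : K →ₗ[R] X} {g : X →ₗ[R] M} (hs : SES f g) (hX : IsGProj R C X)
    (hK : PdLE R C n K) : PdLE R C (n + 1) M :=
  ⟨ModuleCat.of R K, ModuleCat.of R X, f, g, hs, hX, hK⟩

theorem IsGProj.pdLE (h : IsWT R C) (hM : IsGProj R C M) (n : ℕ) : PdLE R C n M := by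
  induction n generalizing M with
  | zero => exact hM
  | succ n ih =>
    exact .of_ses (K := PUnit) SES.zero_id hM (ih (.of_subsingleton h.perp))

/-- Horseshoe over the given cover of `K` and a free cover of `M`; the syzygy of `M` is again
`G_C`-projective, so the induction continues. It is proved before `PdLE.extension`, whose syzygy
step depends on it through `PdLE.ker_of_gproj`. -/
theorem PdLE.extension_gproj (h : IsWT R C) {n : ℕ} {f : K →ₗ[R] X} {g : X →ₗ[R] M}
    (hs : SES f g) (hK : PdLE R C n K) (hM : IsGProj R C M) : PdLE R C n X := by
  induction n generalizing K X M with
  | zero => exact IsGProj.extension h.perp hs hK hM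
  | succ n ih =>
    obtain ⟨K', H, a', a, ha, hH, hK'⟩ := hK
    obtain ⟨M', b', b, hb⟩ := exists_free_ses R M
    obtain ⟨c, hc⟩ := Module.projective_lifting_property g b hs.surj
    obtain ⟨L, l, i, j, hl, hij⟩ := hs.horseshoe_ker ha hb c hc
    exact .of_ses hl (hH.prod h.perp (h.free M)) (ih hij hK' (.ker h.perp hb (h.free M) hM))

theorem PdLE.ker_of_gproj_right (h : IsWT R C) {n : ℕ} {f : K →ₗ[R] X} {g : X →ₗ[R] M}
    (hs : SES f g) (hX : PdLE R C n X) (hM : IsGProj R C M) : PdLE R C n K := by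
  cases n with
  | zero => exact IsGProj.ker h.perp hs hX hM
  | succ n =>
    obtain ⟨X', H, a', a, ha, hH, hX'⟩ := hX
    obtain ⟨L, l, i, j, hl, hij⟩ := hs.ker_comp ha
    exact .of_ses hij (.ker h.perp hl hH hM) hX'

/-- Every syzygy with respect to `G_C`-projective modules lowers the dimension. -/
theorem PdLE.ker_of_gproj (h : IsWT R C) {n : ℕ} {f : K →ₗ[R] X} {g : X →ₗ[R] M}
    (hs : SES f g) (hX : IsGProj R C X) (hM : PdLE R C (n + 1) M) : PdLE R C n K := by
  obtain ⟨K', G', f', g', hs', hG', hK'⟩ := hM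
  -- Schanuel: the fibre product `Z` is an extension of `X` by `K'`, so its dimension is at most
  -- `n`, and it is also an extension of `G'` by `K`.
  obtain ⟨Z, i, p, i', p', h₁, h₂⟩ := hs.pullback hs'
  exact .ker_of_gproj_right h h₁ (.extension_gproj h h₂ hK' hX) hG'

theorem PdLE.succ (h : IsWT R C) {n : ℕ} (hM : PdLE R C n M) : PdLE R C (n + 1) M := by
  induction n generalizing M with
  | zero => exact IsGProj.pdLE h hM 1
  | succ n ih =>
    obtain ⟨K, G, f, g, hs, hG, hK⟩ := hM
    exact .of_ses hs hG (ih hK)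

theorem PdLE.mono (h : IsWT R C) {n m : ℕ} (hnm : n ≤ m) (hM : PdLE R C n M) :
    PdLE R C m M := by
  induction m, hnm using Nat.le_induction with
  | base => exact hM
  | succ m _ ih => exact ih.succ h

theorem PdLE.extension (h : IsWT R C) {n : ℕ} {f : K →ₗ[R] X} {g : X →ₗ[R] M}
    (hs : SES f g) (hK : PdLE R C n K) (hM : PdLE R C n M) : PdLE R C n X := by
  induction n generalizing K X M with
  | zero => exact IsGProj.extension h.perp hs hK hM
  | succ n ih =>
    obtain ⟨K', H, a', a, ha, hH, hK'⟩ := hK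
    obtain ⟨M', b', b, hb⟩ := exists_free_ses R M
    obtain ⟨c, hc⟩ := Module.projective_lifting_property g b hs.surj
    obtain ⟨L, l, i, j, hl, hij⟩ := hs.horseshoe_ker ha hb c hc
    exact .of_ses hl (hH.prod h.perp (h.free M)) (ih hij hK' (.ker_of_gproj h hb (h.free M) hM))

/-- A cover `H` of `X` also covers `M`, with kernel an extension of `K` by the syzygy of `X`; both
have dimension at most `n`. -/
theorem PdLE.coker (h : IsWT R C) {n : ℕ} {f : K →ₗ[R] X} {g : X →ₗ[R] M}
    (hs : SES f g) (hK : PdLE R C n K) (hX : PdLE R C (n + 1) X) : PdLE R C (n + 1) M := by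
  obtain ⟨X', H, a', a, ha, hH, hX'⟩ := hX
  obtain ⟨L, l, i, j, hl, hij⟩ := hs.ker_comp ha
  exact .of_ses hl hH (.extension h hij hX' hK)

theorem PdLE.ker (h : IsWT R C) {n : ℕ} {f : K →ₗ[R] X} {g : X →ₗ[R] M}
    (hs : SES f g) (hX : PdLE R C n X) (hM : PdLE R C (n + 1) M) : PdLE R C n K := by
  cases n with
  | zero => exact .ker_of_gproj h hs hX hM
  | succ n =>
    obtain ⟨X', H, a', a, ha, hH, hX'⟩ := hX
    obtain ⟨L, l, i, j, hl, hij⟩ := hs.ker_comp ha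
    exact .coker h hij hX' (.ker_of_gproj h hl hH hM)

theorem GpdLE.pdLE {n : ℕ} (hM : GpdLE R C M n) : PdLE R C n M := by
  induction n generalizing M with
  | zero =>
    obtain ⟨G, d, ε, hε, he, -, hG, h0⟩ := hM
    have := h0 1 one_pos
    refine (hG 0 le_rfl).of_equiv (LinearEquiv.ofBijective ε ⟨?_, hε⟩)
    rw [injective_iff_map_eq_zero]
    intro x hx
    obtain ⟨y, rfl⟩ := (he x).1 hx
    rw [Subsingleton.elim y 0, map_zero]
  | succ n ih =>
    obtain ⟨G, d, ε, hε, he, hd, hG, h0⟩ := hM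
    refine .of_ses (SES.ker_subtype ε hε) (hG 0 (Nat.zero_le _)) (ih
      ⟨fun i => G (i + 1), fun i => d (i + 1), (d 0).codRestrict _ he.apply_apply_eq_zero, ?_, ?_,
        fun i => hd (i + 1), fun i hi => hG (i + 1) (by omega), fun i hi => h0 (i + 1) (by omega)⟩)
    · rintro ⟨x, hx⟩
      obtain ⟨y, rfl⟩ := (he x).1 hx
      exact ⟨y, rfl⟩
    · intro x
      rw [← hd 0 x]
      exact Subtype.ext_iff

theorem PdLE.gpdLE {n : ℕ} (hM : PdLE R C n M) : GpdLE R C M n := by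
  induction n generalizing M with
  | zero =>
    let G : ℕ → ModuleCat.{u} R := fun i => match i with
      | 0 => ModuleCat.of R M
      | _ + 1 => ModuleCat.of R PUnit
    have hs : ∀ i, Subsingleton (G (i + 1)) := fun i => inferInstanceAs (Subsingleton PUnit)
    refine ⟨G, fun i => 0, (LinearMap.id : M →ₗ[R] M), Function.surjective_id, fun x => ?_,
      fun i x => ?_, fun i hi => ?_, fun i hi => ?_⟩
    · simp [eq_comm]
    · have := hs i
      exact ⟨fun _ => ⟨0, Subsingleton.elim _ _⟩, fun _ => rfl⟩
    · obtain rfl : i = 0 := by omega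
      exact hM
    · obtain ⟨j, rfl⟩ := Nat.exists_eq_add_of_le' hi
      exact hs j
  | succ n ih =>
    obtain ⟨K, G₀, f, g, hs, hG₀, hK⟩ := hM
    obtain ⟨G, d, ε, hε, he, hd, hG, h0⟩ := ih hK
    let G' : ℕ → ModuleCat.{u} R := fun i => match i with
      | 0 => G₀
      | i + 1 => G i
    let d' : ∀ i, G' (i + 1) →ₗ[R] G' i := fun i => match i with
      | 0 => f ∘ₗ ε
      | i + 1 => d i
    refine ⟨G', d', g, hs.surj, ?_, fun i => ?_, fun i hi => ?_, fun i hi => ?_⟩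
    · exact hs.exact_splice hε (i := LinearMap.id) Function.injective_id
    · cases i with
      | zero =>
        intro x
        rw [← he x]
        exact map_eq_zero_iff f hs.inj
      | succ i => exact hd i
    · cases i with
      | zero => exact hG₀
      | succ i => exact hG i (by omega)
    · cases i with
      | zero => omega
      | succ i => exact h0 i (by omega)

/-- The infimum defining `gpd` is controlled by one inequality because `PdLE` is monotone in `n`;
monotonicity uses that `0` is `G_C`-projective. -/
theorem gpd_le_iff (h : IsWT R C) {n : ℕ} : gpd R C M ≤ n ↔ PdLE R C n M := by
  constructor
  · intro hn
    by_contra hM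
    have : ((n + 1 : ℕ) : ℕ∞) ≤ gpd R C M := by
      refine le_iInf₂ fun m hm => ?_
      by_contra hlt
      rw [Nat.cast_le, not_le] at hlt
      exact hM (hm.pdLE.mono h (by omega))
    have := this.trans hn
    rw [Nat.cast_le] at this
    omega
  · exact fun hM => iInf₂_le n hM.gpdLE

end Dimension

/-! ### The functor `U ⊗_A -`: universal property, right exactness, direct sums -/

section Tensor

variable {A B U : Type u} [Ring A] [Ring B] [AddCommGroup U] [Module B U] [Module Aᵐᵒᵖ U]
  [SMulCommClass B Aᵐᵒᵖ U]
variable {K M N : Type u} [AddCommGroup K] [Module A K] [AddCommGroup M] [Module A M]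
  [AddCommGroup N] [Module A N] {Y : Type*} [AddCommGroup Y] [Module B Y]

@[elab_as_elim]
theorem BTensor.induction_on {p : BTensor A B U M → Prop} (z : BTensor A B U M) (zero : p 0)
    (tmul : ∀ (u : U) (m : M), p (BTensor.tmul A B U u m)) (add : ∀ x y, p x → p y → p (x + y)) : p z := by
  obtain ⟨z, rfl⟩ := (balancedRel A B U M).mkQ_surjective z
  induction z using TensorProduct.induction_on with
  | zero => rwa [map_zero]
  | tmul u m => exact tmul u m
  | add x y hx hy => rw [map_add]; exact add _ _ hx hy

theorem BTensor.hom_ext {f g : BTensor A B U M →ₗ[B] Y}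
    (h : ∀ u m, f (BTensor.tmul A B U u m) = g (BTensor.tmul A B U u m)) : f = g := by
  refine LinearMap.ext fun z => ?_
  induction z using BTensor.induction_on with
  | zero => simp
  | tmul u m => exact h u m
  | add x y hx hy => rw [map_add, map_add, hx, hy]

@[simp]
theorem BTensor.map_tmul (f : M →ₗ[A] N) (u : U) (m : M) :
    BTensor.map B U f (BTensor.tmul A B U u m) = BTensor.tmul A B U u (f m) := rfl

theorem BTensor.map_id :
    BTensor.map B U (LinearMap.id : M →ₗ[A] M) = LinearMap.id :=
  BTensor.hom_ext fun _ _ => rfl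

theorem BTensor.map_comp (g : M →ₗ[A] N) (f : K →ₗ[A] M) :
    BTensor.map B U (g ∘ₗ f) = BTensor.map B U g ∘ₗ BTensor.map B U f :=
  BTensor.hom_ext fun _ _ => rfl

theorem BTensor.map_zero : BTensor.map B U (0 : M →ₗ[A] N) = 0 :=
  BTensor.hom_ext fun u m => by simp [BTensor.tmul_zero]

/-- The universal property of `U ⊗_A M`. -/
theorem BTensor.exists_lift (β : U → M → Y) (hu : ∀ u v m, β (u + v) m = β u m + β v m)
    (hm : ∀ u m m', β u (m + m') = β u m + β u m') (hb : ∀ (b : B) u m, β (b • u) m = b • β u m)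
    (ha : ∀ (a : A) u m, β (MulOpposite.op a • u) m = β u (a • m)) :
    ∃ f : BTensor A B U M →ₗ[B] Y, ∀ u m, f (BTensor.tmul A B U u m) = β u m := by
  let β' : U →ₗ[B] M →ₗ[ℤ] Y :=
    { toFun := fun u => (AddMonoidHom.mk' (β u) (hm u)).toIntLinearMap
      map_add' := fun u v => LinearMap.ext fun m => hu u v m
      map_smul' := fun b u => LinearMap.ext fun m => hb b u m }
  refine ⟨(balancedRel A B U M).liftQ (TensorProduct.AlgebraTensorModule.lift β')
    (Submodule.span_le.2 ?_), fun u m => rfl⟩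
  rintro _ ⟨u, a, m, rfl⟩
  simp [β', ha]

theorem BTensor.map_surjective {g : M →ₗ[A] N} (hg : Function.Surjective g) :
    Function.Surjective (BTensor.map B U g) := by
  intro z
  induction z using BTensor.induction_on with
  | zero => exact ⟨0, _root_.map_zero _⟩
  | tmul u m =>
    obtain ⟨x, rfl⟩ := hg m
    exact ⟨BTensor.tmul A B U u x, rfl⟩
  | add x y hx hy =>
    obtain ⟨x, rfl⟩ := hx
    obtain ⟨y, rfl⟩ := hy
    exact ⟨x + y, map_add _ _ _⟩

theorem BTensor.map_exact {f : K →ₗ[A] M} {g : M →ₗ[A] N} (hfg : Function.Exact f g)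
    (hg : Function.Surjective g) :
    Function.Exact (BTensor.map B U f) (BTensor.map B U g) := by
  have hq : ∀ z, (LinearMap.range (BTensor.map B U f)).mkQ (BTensor.map B U f z) = 0 := fun z => by
    simp
  -- Modulo the image of `U ⊗ f`, the class of `u ⊗ m` depends only on `g m`. Hence `u ⊗ n` can be
  -- sent to the class of `u ⊗ m` for any preimage `m` of `n`, which inverts the map from the
  -- cokernel to `U ⊗ N`.
  have key : ∀ (u : U) (m m' : M), g m = g m' →
      (LinearMap.range (BTensor.map B U f)).mkQ (BTensor.tmul A B U u m) =
        (LinearMap.range (BTensor.map B U f)).mkQ (BTensor.tmul A B U u m') := by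
    intro u m m' h
    obtain ⟨k, hk⟩ := (hfg (m - m')).1 (by rw [map_sub, h, sub_self])
    obtain rfl : m = f k + m' := by rw [hk]; abel
    rw [BTensor.tmul_add, map_add, ← BTensor.map_tmul, hq, zero_add]
  obtain ⟨s, hs⟩ := BTensor.exists_lift (A := A) (B := B) (U := U) (M := N)
    (fun u n => (LinearMap.range (BTensor.map B U f)).mkQ
      (BTensor.tmul A B U u (Function.surjInv hg n)))
    (fun u v m => by rw [BTensor.add_tmul, map_add])
    (fun u m m' => by
      rw [← map_add, ← BTensor.tmul_add]
      exact key _ _ _ (by simp [Function.surjInv_eq]))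
    (fun b u m => by rw [BTensor.smul_tmul, map_smul])
    (fun a u m => by
      rw [BTensor.op_smul_tmul]
      exact key _ _ _ (by simp [Function.surjInv_eq]))
  have hs' : s ∘ₗ BTensor.map B U g = (LinearMap.range (BTensor.map B U f)).mkQ :=
    BTensor.hom_ext fun u m => (hs u (g m)).trans (key _ _ _ (Function.surjInv_eq hg _))
  intro z
  constructor
  · intro hz
    have := LinearMap.congr_fun hs' z
    rw [LinearMap.comp_apply, hz, _root_.map_zero] at this
    exact (Submodule.Quotient.mk_eq_zero _).1 this.symm
  · rintro ⟨y, rfl⟩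
    rw [← LinearMap.comp_apply, ← BTensor.map_comp, hfg.linearMap_comp_eq_zero, BTensor.map_zero]
    rfl

theorem SES.tensor {f : K →ₗ[A] M} {g : M →ₗ[A] N} (h : SES f g)
    (hf : Function.Injective (BTensor.map B U f)) :
    SES (BTensor.map B U f) (BTensor.map B U g) :=
  ⟨hf, BTensor.map_exact h.exact h.surj, BTensor.map_surjective h.surj⟩

/-- The comparison map `U ⊗ M^(I) → (U ⊗ M)^(I)` is an isomorphism. -/
theorem BTensor.exists_finsupp (I : Type u) :
    ∃ (s : BTensor A B U (I →₀ M) →ₗ[B] (I →₀ BTensor A B U M))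
      (t : (I →₀ BTensor A B U M) →ₗ[B] BTensor A B U (I →₀ M)),
      (∀ u m i, s (BTensor.tmul A B U u m) i = BTensor.tmul A B U u (m i)) ∧
      t ∘ₗ s = LinearMap.id ∧ s ∘ₗ t = LinearMap.id := by
  obtain ⟨s, hs⟩ := BTensor.exists_lift (A := A) (B := B) (U := U) (M := I →₀ M)
    (fun u m => m.mapRange (BTensor.tmul A B U u) (BTensor.tmul_zero u))
    (fun u v m => by ext i; simp [BTensor.add_tmul])
    (fun u m m' => by ext i; simp [BTensor.tmul_add])
    (fun b u m => by ext i; simp [BTensor.smul_tmul])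
    (fun a u m => by ext i; simp [BTensor.op_smul_tmul])
  have hs' : ∀ u i m, s (BTensor.tmul A B U u (Finsupp.single i m)) =
      Finsupp.single i (BTensor.tmul A B U u m) := fun u i m => by
    rw [hs, Finsupp.mapRange_single]
  refine ⟨s, Finsupp.lsum ℕ fun i => BTensor.map B U (Finsupp.lsingle i), fun u m i => by
    rw [hs]; rfl, BTensor.hom_ext fun u m => ?_, ?_⟩
  · induction m using Finsupp.induction_linear with
    | zero => simp [BTensor.tmul_zero]
    | add x y hx hy => rw [BTensor.tmul_add, map_add, map_add, hx, hy]
    | single i m =>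
      rw [LinearMap.comp_apply, hs']
      simp
  · refine Finsupp.lhom_ext' fun i => BTensor.hom_ext fun u m => ?_
    have := hs' u i m
    simpa using this

end Tensor

/-! ### Morphisms and short exact sequences of triples -/

section Triples

variable {A B U : Type u} [Ring A] [Ring B] [AddCommGroup U] [Module B U] [Module Aᵐᵒᵖ U]
  [SMulCommClass B Aᵐᵒᵖ U]


variable {M₁ M₂ N₁ N₂ K₁ K₂ : Type u} [AddCommGroup M₁] [Module A M₁] [AddCommGroup M₂] [Module B M₂]
  [AddCommGroup N₁] [Module A N₁] [AddCommGroup N₂] [Module B N₂]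
  [AddCommGroup K₁] [Module A K₁] [AddCommGroup K₂] [Module B K₂]
  {φ : BTensor A B U M₁ →ₗ[B] M₂} {ψ : BTensor A B U N₁ →ₗ[B] N₂} {κ : BTensor A B U K₁ →ₗ[B] K₂}

theorem TriModule.smul_def (t : TriRing A B U) (z : TriModule φ) :
    t • z = ((t.a • z.1, φ (BTensor.tmul A B U t.u z.1) + t.b • z.2) : M₁ × M₂) := rfl

/-- The morphism of triples given by its two components. -/
def TriModule.hom (f₁ : M₁ →ₗ[A] N₁) (f₂ : M₂ →ₗ[B] N₂) (h : f₂ ∘ₗ φ = ψ ∘ₗ BTensor.map B U f₁) :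
    TriModule φ →ₗ[TriRing A B U] TriModule ψ where
  toFun z := ((f₁ z.1, f₂ z.2) : N₁ × N₂)
  map_add' z w := Prod.ext (map_add f₁ z.1 w.1) (map_add f₂ z.2 w.2)
  map_smul' t z := by
    refine Prod.ext (map_smul f₁ t.a z.1) ?_
    change f₂ (φ (BTensor.tmul A B U t.u z.1) + t.b • z.2) =
      ψ (BTensor.tmul A B U t.u (f₁ z.1)) + t.b • f₂ z.2
    rw [map_add, map_smul]
    exact congrArg (· + t.b • f₂ z.2) (LinearMap.congr_fun h _)

/-- Every linear map between triples is given by two components. -/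
theorem TriModule.exists_hom (f : TriModule φ →ₗ[TriRing A B U] TriModule ψ) :
    ∃ (f₁ : M₁ →ₗ[A] N₁) (f₂ : M₂ →ₗ[B] N₂) (h : f₂ ∘ₗ φ = ψ ∘ₗ BTensor.map B U f₁),
      f = TriModule.hom f₁ f₂ h := by
  let mk : M₁ → M₂ → TriModule φ := fun x y => ((x, y) : M₁ × M₂)
  -- Commuting with the two diagonal idempotents of `T` forces the off-diagonal components of `f` to
  -- vanish; commuting with the matrices `⟨0, u, 0⟩` gives compatibility with the structure maps.
  have h12 : ∀ x, (f (mk x 0)).2 = 0 := fun x => by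
    have h := map_smul f (⟨1, 0, 0⟩ : TriRing A B U) (mk x 0)
    have e : (⟨1, 0, 0⟩ : TriRing A B U) • mk x 0 = mk x 0 := by
      refine Prod.ext (one_smul A x) ?_
      change φ (BTensor.tmul A B U 0 x) + (0 : B) • (0 : M₂) = 0
      simp [BTensor.zero_tmul]
    rw [e] at h
    rw [h]
    change ψ (BTensor.tmul A B U 0 _) + (0 : B) • _ = 0
    simp [BTensor.zero_tmul]
  have h21 : ∀ y, (f (mk 0 y)).1 = 0 := fun y => by
    have h := map_smul f (⟨0, 0, 1⟩ : TriRing A B U) (mk 0 y)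
    have e : (⟨0, 0, 1⟩ : TriRing A B U) • mk 0 y = mk 0 y := by
      refine Prod.ext (smul_zero _) ?_
      change φ (BTensor.tmul A B U 0 (0 : M₁)) + (1 : B) • y = y
      simp [BTensor.zero_tmul]
    rw [e] at h
    rw [h]
    exact zero_smul A _
  have hadd : ∀ x y x' y', mk (x + x') (y + y') = mk x y + mk x' y' := fun _ _ _ _ => rfl
  let f₁ : M₁ →ₗ[A] N₁ :=
    { toFun := fun x => (f (mk x 0)).1
      map_add' := fun x y => by
        have := hadd x 0 y 0
        rw [add_zero] at this
        rw [this, map_add]; rfl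
      map_smul' := fun a x => by
        have e : mk (a • x) 0 = (⟨a, 0, 0⟩ : TriRing A B U) • mk x 0 := by
          refine Prod.ext rfl ?_
          change 0 = φ (BTensor.tmul A B U 0 x) + (0 : B) • (0 : M₂)
          simp [BTensor.zero_tmul]
        rw [e, map_smul]; rfl }
  let f₂ : M₂ →ₗ[B] N₂ :=
    { toFun := fun y => (f (mk 0 y)).2
      map_add' := fun x y => by
        have := hadd 0 x 0 y
        rw [add_zero] at this
        rw [this, map_add]; rfl
      map_smul' := fun b y => by
        have e : mk 0 (b • y) = (⟨0, 0, b⟩ : TriRing A B U) • mk 0 y := by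
          refine Prod.ext (smul_zero _).symm ?_
          change b • y = φ (BTensor.tmul A B U 0 (0 : M₁)) + b • y
          simp [BTensor.zero_tmul]
        rw [e, map_smul]
        change ψ (BTensor.tmul A B U 0 _) + b • _ = b • _
        simp [BTensor.zero_tmul] }
  have hf : ∀ z, f z = ((f₁ z.1, f₂ z.2) : N₁ × N₂) := fun z => by
    have e : z = mk z.1 0 + mk 0 z.2 :=
      Prod.ext (add_zero z.1).symm (zero_add z.2).symm
    conv_lhs => rw [e, map_add]
    refine Prod.ext ?_ ?_
    · exact (congrArg ((f (mk z.1 0)).1 + ·) (h21 z.2)).trans (add_zero _)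
    · exact (congrArg (· + (f (mk 0 z.2)).2) (h12 z.1)).trans (zero_add _)
  refine ⟨f₁, f₂, BTensor.hom_ext fun u m => ?_, LinearMap.ext hf⟩
  have e : mk 0 (φ (BTensor.tmul A B U u m)) = (⟨0, u, 0⟩ : TriRing A B U) • mk m 0 := by
    refine Prod.ext (zero_smul A m).symm ?_
    change φ (BTensor.tmul A B U u m) = φ (BTensor.tmul A B U u m) + (0 : B) • (0 : M₂)
    simp
  change (f (mk 0 (φ (BTensor.tmul A B U u m)))).2 = ψ (BTensor.tmul A B U u (f₁ m))
  rw [e, map_smul]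
  change ψ (BTensor.tmul A B U u (f₁ m)) + (0 : B) • _ = _
  simp

theorem TriModule.hom_comp (f₁ : K₁ →ₗ[A] M₁) (f₂ : K₂ →ₗ[B] M₂) (h : f₂ ∘ₗ κ = φ ∘ₗ BTensor.map B U f₁)
    (g₁ : M₁ →ₗ[A] N₁) (g₂ : M₂ →ₗ[B] N₂) (h' : g₂ ∘ₗ φ = ψ ∘ₗ BTensor.map B U g₁) :
    TriModule.hom g₁ g₂ h' ∘ₗ TriModule.hom f₁ f₂ h = TriModule.hom (g₁ ∘ₗ f₁) (g₂ ∘ₗ f₂) (by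
      rw [BTensor.map_comp, ← LinearMap.comp_assoc, ← h', LinearMap.comp_assoc, h,
        LinearMap.comp_assoc]) := rfl

theorem TriModule.hom_eq_iff {f₁ g₁ : M₁ →ₗ[A] N₁} {f₂ g₂ : M₂ →ₗ[B] N₂}
    (hf : f₂ ∘ₗ φ = ψ ∘ₗ BTensor.map B U f₁) (hg : g₂ ∘ₗ φ = ψ ∘ₗ BTensor.map B U g₁) :
    TriModule.hom f₁ f₂ hf = TriModule.hom g₁ g₂ hg ↔ f₁ = g₁ ∧ f₂ = g₂ := by
  constructor
  · intro h
    constructor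
    · ext x
      exact congrArg Prod.fst (LinearMap.congr_fun h ((x, 0) : M₁ × M₂))
    · ext x
      exact congrArg Prod.snd (LinearMap.congr_fun h ((0, x) : M₁ × M₂))
  · rintro ⟨rfl, rfl⟩; rfl

theorem TriModule.ses_iff {f₁ : K₁ →ₗ[A] M₁} {f₂ : K₂ →ₗ[B] M₂} (h : f₂ ∘ₗ κ = φ ∘ₗ BTensor.map B U f₁)
    {g₁ : M₁ →ₗ[A] N₁} {g₂ : M₂ →ₗ[B] N₂} (h' : g₂ ∘ₗ φ = ψ ∘ₗ BTensor.map B U g₁) :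
    SES (TriModule.hom f₁ f₂ h) (TriModule.hom g₁ g₂ h') ↔ SES f₁ g₁ ∧ SES f₂ g₂ := by
  constructor
  · rintro ⟨hi, he, hs⟩
    refine ⟨⟨fun x y hxy => ?_, fun x => ?_, fun x => ?_⟩,
      ⟨fun x y hxy => ?_, fun x => ?_, fun x => ?_⟩⟩
    · exact congrArg Prod.fst (@hi ((x, 0) : K₁ × K₂) ((y, 0) : K₁ × K₂)
        (Prod.ext hxy rfl))
    · constructor
      · intro hx
        obtain ⟨y, hy⟩ := (he ((x, 0) : M₁ × M₂)).1 (Prod.ext hx (map_zero g₂))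
        exact ⟨y.1, congrArg Prod.fst hy⟩
      · rintro ⟨y, rfl⟩
        exact congrArg Prod.fst (he.apply_apply_eq_zero ((y, 0) : K₁ × K₂))
    · obtain ⟨y, hy⟩ := hs ((x, 0) : N₁ × N₂)
      exact ⟨y.1, congrArg Prod.fst hy⟩
    · exact congrArg Prod.snd (@hi ((0, x) : K₁ × K₂) ((0, y) : K₁ × K₂)
        (Prod.ext rfl hxy))
    · constructor
      · intro hx
        obtain ⟨y, hy⟩ := (he ((0, x) : M₁ × M₂)).1 (Prod.ext (map_zero g₁) hx)
        exact ⟨y.2, congrArg Prod.snd hy⟩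
      · rintro ⟨y, rfl⟩
        exact congrArg Prod.snd (he.apply_apply_eq_zero ((0, y) : K₁ × K₂))
    · obtain ⟨y, hy⟩ := hs ((0, x) : N₁ × N₂)
      exact ⟨y.2, congrArg Prod.snd hy⟩
  · rintro ⟨⟨hi, he, hs⟩, ⟨hi', he', hs'⟩⟩
    refine ⟨fun x y hxy => Prod.ext (hi (congrArg Prod.fst hxy)) (hi' (congrArg Prod.snd hxy)),
      fun x => ⟨fun hx => ?_, ?_⟩, fun x => ?_⟩
    · obtain ⟨y, hy⟩ := (he x.1).1 (congrArg Prod.fst hx)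
      obtain ⟨z, hz⟩ := (he' x.2).1 (congrArg Prod.snd hx)
      exact ⟨((y, z) : K₁ × K₂), Prod.ext hy hz⟩
    · rintro ⟨y, rfl⟩
      exact Prod.ext (he.apply_apply_eq_zero y.1) (he'.apply_apply_eq_zero y.2)
    · obtain ⟨y, hy⟩ := hs x.1
      obtain ⟨z, hz⟩ := hs' x.2
      exact ⟨((y, z) : M₁ × M₂), Prod.ext hy hz⟩

end Triples

/-! ### Every `T`-module is a triple (Peirce decomposition) -/

section Decomposition

variable {A B U : Type u} [Ring A] [Ring B] [AddCommGroup U] [Module B U] [Module Aᵐᵒᵖ U]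
  [SMulCommClass B Aᵐᵒᵖ U]

theorem TriRing.mk_mul_mk (a a' : A) (u u' : U) (b b' : B) :
    (⟨a, u, b⟩ : TriRing A B U) * ⟨a', u', b'⟩ =
      ⟨a * a', MulOpposite.op a' • u + b • u', b * b'⟩ := rfl

theorem TriRing.mk_add_mk (a a' : A) (u u' : U) (b b' : B) :
    (⟨a, u, b⟩ : TriRing A B U) + ⟨a', u', b'⟩ = ⟨a + a', u + u', b + b'⟩ := rfl

theorem TriRing.mk_zero_smul {X : Type*} [AddCommGroup X] [Module (TriRing A B U) X] (x : X) :
    (⟨0, 0, 0⟩ : TriRing A B U) • x = 0 := zero_smul (TriRing A B U) x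

theorem TriRing.mk_one_smul {X : Type*} [AddCommGroup X] [Module (TriRing A B U) X] (x : X) :
    (⟨1, 0, 1⟩ : TriRing A B U) • x = x := one_smul (TriRing A B U) x

variable (A B U) in
/-- The component `X₁` of a module over the triangular ring. -/
def FstPart (X : Type u) [AddCommGroup X] [Module (TriRing A B U) X] : AddSubgroup X where
  carrier := {x | (⟨1, 0, 0⟩ : TriRing A B U) • x = x}
  zero_mem' := smul_zero _
  add_mem' {x y} hx hy := by
    simp only [Set.mem_ofPred_eq, smul_add] at *
    rw [hx, hy]
  neg_mem' {x} hx := by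
    simp only [Set.mem_ofPred_eq, smul_neg] at *
    rw [hx]

variable (A B U) in
/-- The component `X₂` of a module over the triangular ring. -/
def SndPart (X : Type u) [AddCommGroup X] [Module (TriRing A B U) X] : AddSubgroup X where
  carrier := {x | (⟨0, 0, 1⟩ : TriRing A B U) • x = x}
  zero_mem' := smul_zero _
  add_mem' {x y} hx hy := by
    simp only [Set.mem_ofPred_eq, smul_add] at *
    rw [hx, hy]
  neg_mem' {x} hx := by
    simp only [Set.mem_ofPred_eq, smul_neg] at *
    rw [hx]

variable {X : Type u} [AddCommGroup X] [Module (TriRing A B U) X]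

instance : Module A (FstPart A B U X) where
  smul a x := ⟨(⟨a, 0, 0⟩ : TriRing A B U) • x.1, by
    change (⟨1, 0, 0⟩ : TriRing A B U) • _ = _
    rw [← mul_smul, TriRing.mk_mul_mk]
    simp⟩
  one_smul x := Subtype.ext x.2
  mul_smul a a' x := Subtype.ext (by
    change (⟨a * a', 0, 0⟩ : TriRing A B U) • x.1 = (⟨a, 0, 0⟩ : TriRing A B U) • (⟨a', 0, 0⟩ : TriRing A B U) • x.1
    rw [← mul_smul, TriRing.mk_mul_mk]
    simp)
  smul_zero a := Subtype.ext (smul_zero _)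
  smul_add a x y := Subtype.ext (smul_add _ _ _)
  add_smul a a' x := Subtype.ext (by
    change (⟨a + a', 0, 0⟩ : TriRing A B U) • x.1 = (⟨a, 0, 0⟩ : TriRing A B U) • x.1 + (⟨a', 0, 0⟩ : TriRing A B U) • x.1
    rw [← add_smul, TriRing.mk_add_mk]
    simp)
  zero_smul x := Subtype.ext (zero_smul _ _)

instance : Module B (SndPart A B U X) where
  smul b x := ⟨(⟨0, 0, b⟩ : TriRing A B U) • x.1, by
    change (⟨0, 0, 1⟩ : TriRing A B U) • _ = _
    rw [← mul_smul, TriRing.mk_mul_mk]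
    simp⟩
  one_smul x := Subtype.ext x.2
  mul_smul a a' x := Subtype.ext (by
    change (⟨0, 0, a * a'⟩ : TriRing A B U) • x.1 = (⟨0, 0, a⟩ : TriRing A B U) • (⟨0, 0, a'⟩ : TriRing A B U) • x.1
    rw [← mul_smul, TriRing.mk_mul_mk]
    simp)
  smul_zero a := Subtype.ext (smul_zero _)
  smul_add a x y := Subtype.ext (smul_add _ _ _)
  add_smul a a' x := Subtype.ext (by
    change (⟨0, 0, a + a'⟩ : TriRing A B U) • x.1 = (⟨0, 0, a⟩ : TriRing A B U) • x.1 + (⟨0, 0, a'⟩ : TriRing A B U) • x.1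
    rw [← add_smul, TriRing.mk_add_mk]
    simp)
  zero_smul x := Subtype.ext (zero_smul _ _)

/-- Every module over the triangular ring is given by a triple. -/
theorem exists_equiv_triModule (X : Type u) [AddCommGroup X] [Module (TriRing A B U) X] :
    ∃ (X₁ : ModuleCat.{u} A) (X₂ : ModuleCat.{u} B) (φ : BTensor A B U X₁ →ₗ[B] X₂),
      Nonempty (X ≃ₗ[TriRing A B U] TriModule φ) := by
  have hu : ∀ (u : U) (x : X), (⟨0, 0, 1⟩ : TriRing A B U) • (⟨0, u, 0⟩ : TriRing A B U) • x =
      (⟨0, u, 0⟩ : TriRing A B U) • x := fun u x => by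
    rw [← mul_smul, TriRing.mk_mul_mk]
    simp
  obtain ⟨φ, hφ⟩ := BTensor.exists_lift (A := A) (B := B) (U := U) (M := FstPart A B U X)
    (Y := SndPart A B U X) (fun u x => ⟨(⟨0, u, 0⟩ : TriRing A B U) • x.1, hu u x.1⟩)
    (fun u v x => Subtype.ext (by
      change (⟨0, u + v, 0⟩ : TriRing A B U) • x.1 = (⟨0, u, 0⟩ : TriRing A B U) • x.1 + (⟨0, v, 0⟩ : TriRing A B U) • x.1
      rw [← add_smul, TriRing.mk_add_mk]
      simp))
    (fun u x y => Subtype.ext (smul_add _ _ _))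
    (fun b u x => Subtype.ext (by
      change (⟨0, b • u, 0⟩ : TriRing A B U) • x.1 = (⟨0, 0, b⟩ : TriRing A B U) • (⟨0, u, 0⟩ : TriRing A B U) • x.1
      rw [← mul_smul, TriRing.mk_mul_mk]
      simp))
    (fun a u x => Subtype.ext (by
      change (⟨0, MulOpposite.op a • u, 0⟩ : TriRing A B U) • x.1 = (⟨0, u, 0⟩ : TriRing A B U) • (⟨a, 0, 0⟩ : TriRing A B U) • x.1
      rw [← mul_smul, TriRing.mk_mul_mk]
      simp))
  -- Addition of the two Peirce components. For linearity, `t` is split into its three entries; the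
  -- products `h3`, `h4`, `h5` vanish because the idempotents are orthogonal.
  let ι : TriModule φ →ₗ[TriRing A B U] X :=
    { toFun := fun z => z.1.1 + z.2.1
      map_add' := fun z w => by
        change (z.1.1 + w.1.1) + (z.2.1 + w.2.1) = _
        abel
      map_smul' := fun t z => by
        have h1 : (t • z).1.1 = (⟨t.a, 0, 0⟩ : TriRing A B U) • z.1.1 := rfl
        have h2 : (t • z).2.1 = (⟨0, t.u, 0⟩ : TriRing A B U) • z.1.1 +
            (⟨0, 0, t.b⟩ : TriRing A B U) • z.2.1 := by
          rw [TriModule.smul_def, hφ]; rfl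
        have h3 : (⟨t.a, 0, 0⟩ : TriRing A B U) • z.2.1 = 0 := by
          have h : (⟨0, 0, 1⟩ : TriRing A B U) • z.2.1 = z.2.1 := z.2.2
          rw [← h, ← mul_smul, TriRing.mk_mul_mk]
          simp [TriRing.mk_zero_smul]
        have h4 : (⟨0, t.u, 0⟩ : TriRing A B U) • z.2.1 = 0 := by
          have h : (⟨0, 0, 1⟩ : TriRing A B U) • z.2.1 = z.2.1 := z.2.2
          rw [← h, ← mul_smul, TriRing.mk_mul_mk]
          simp [TriRing.mk_zero_smul]
        have h5 : (⟨0, 0, t.b⟩ : TriRing A B U) • z.1.1 = 0 := by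
          have h : (⟨1, 0, 0⟩ : TriRing A B U) • z.1.1 = z.1.1 := z.1.2
          rw [← h, ← mul_smul, TriRing.mk_mul_mk]
          simp [TriRing.mk_zero_smul]
        have ht : t = (⟨t.a, 0, 0⟩ : TriRing A B U) + (⟨0, t.u, 0⟩ : TriRing A B U) +
            (⟨0, 0, t.b⟩ : TriRing A B U) := by
          ext <;> simp
        rw [h1, h2, RingHom.id_apply]
        conv_rhs => rw [ht]
        simp only [add_smul, smul_add, h3, h4, h5]
        abel }
  refine ⟨ModuleCat.of A (FstPart A B U X), ModuleCat.of B (SndPart A B U X), φ,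
    ⟨(LinearEquiv.ofBijective ι ⟨?_, fun x => ?_⟩).symm⟩⟩
  · rw [injective_iff_map_eq_zero]
    intro z hz
    have hz : z.1.1 + z.2.1 = 0 := hz
    have h1 : (⟨1, 0, 0⟩ : TriRing A B U) • z.1.1 = z.1.1 := z.1.2
    have h2 : (⟨0, 0, 1⟩ : TriRing A B U) • z.2.1 = z.2.1 := z.2.2
    have h3 : (⟨1, 0, 0⟩ : TriRing A B U) • z.2.1 = 0 := by
      rw [← h2, ← mul_smul, TriRing.mk_mul_mk]
      simp [TriRing.mk_zero_smul]
    have h4 : z.1.1 = 0 := by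
      have := congrArg ((⟨1, 0, 0⟩ : TriRing A B U) • ·) hz
      simpa [smul_add, h1, h3] using this
    rw [h4, zero_add] at hz
    exact Prod.ext (Subtype.ext h4) (Subtype.ext hz)
  · have h1 : (⟨1, 0, 0⟩ : TriRing A B U) • x ∈ FstPart A B U X := by
      change (⟨1, 0, 0⟩ : TriRing A B U) • _ = _
      rw [← mul_smul, TriRing.mk_mul_mk]
      simp
    have h2 : (⟨0, 0, 1⟩ : TriRing A B U) • x ∈ SndPart A B U X := by
      change (⟨0, 0, 1⟩ : TriRing A B U) • _ = _
      rw [← mul_smul, TriRing.mk_mul_mk]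
      simp
    refine ⟨((⟨_, h1⟩, ⟨_, h2⟩) : FstPart A B U X × SndPart A B U X), ?_⟩
    change (⟨1, 0, 0⟩ : TriRing A B U) • x + (⟨0, 0, 1⟩ : TriRing A B U) • x = x
    rw [← add_smul, TriRing.mk_add_mk]
    simp [TriRing.mk_one_smul]

end Decomposition

/-! ### Isomorphisms, direct sums and projectives among triples -/

section Triples

variable {A B U : Type u} [Ring A] [Ring B] [AddCommGroup U] [Module B U] [Module Aᵐᵒᵖ U]
  [SMulCommClass B Aᵐᵒᵖ U]
variable {M₁ M₂ N₁ N₂ K₁ K₂ : Type u} [AddCommGroup M₁] [Module A M₁] [AddCommGroup M₂] [Module B M₂]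
  [AddCommGroup N₁] [Module A N₁] [AddCommGroup N₂] [Module B N₂]
  [AddCommGroup K₁] [Module A K₁] [AddCommGroup K₂] [Module B K₂]
  {φ : BTensor A B U M₁ →ₗ[B] M₂} {ψ : BTensor A B U N₁ →ₗ[B] N₂} {κ : BTensor A B U K₁ →ₗ[B] K₂}

/-- An isomorphism of triples. -/
noncomputable def TriModule.equiv (e₁ : M₁ ≃ₗ[A] N₁) (e₂ : M₂ ≃ₗ[B] N₂)
    (h : e₂.toLinearMap ∘ₗ φ = ψ ∘ₗ BTensor.map B U e₁.toLinearMap) :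
    TriModule φ ≃ₗ[TriRing A B U] TriModule ψ :=
  LinearEquiv.ofBijective (TriModule.hom e₁.toLinearMap e₂.toLinearMap h)
    ⟨fun _ _ hzw => Prod.ext (e₁.injective (congrArg Prod.fst hzw))
      (e₂.injective (congrArg Prod.snd hzw)),
    fun z => ⟨((e₁.symm z.1, e₂.symm z.2) : M₁ × M₂),
      Prod.ext (e₁.apply_symm_apply _) (e₂.apply_symm_apply _)⟩⟩

/-- The components of a short exact sequence of modules over the triangular ring. -/
theorem SES.exists_triple {X Y Z : Type u} [AddCommGroup X] [Module (TriRing A B U) X]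
    [AddCommGroup Y] [Module (TriRing A B U) Y] [AddCommGroup Z] [Module (TriRing A B U) Z]
    {f : X →ₗ[TriRing A B U] Y} {g : Y →ₗ[TriRing A B U] Z} (h : SES f g)
    (eK : X ≃ₗ[TriRing A B U] TriModule κ) (eM : Y ≃ₗ[TriRing A B U] TriModule φ)
    (eN : Z ≃ₗ[TriRing A B U] TriModule ψ) :
    ∃ (f₁ : K₁ →ₗ[A] M₁) (f₂ : K₂ →ₗ[B] M₂) (g₁ : M₁ →ₗ[A] N₁) (g₂ : M₂ →ₗ[B] N₂),
      f₂ ∘ₗ κ = φ ∘ₗ BTensor.map B U f₁ ∧ g₂ ∘ₗ φ = ψ ∘ₗ BTensor.map B U g₁ ∧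
      SES f₁ g₁ ∧ SES f₂ g₂ := by
  have h' := ((h.of_left_equiv eK.symm).of_right_equiv eN).of_mid_equiv eM
  obtain ⟨f₁, f₂, hf, ef⟩ := TriModule.exists_hom
    (eM.toLinearMap ∘ₗ f ∘ₗ eK.symm.toLinearMap)
  obtain ⟨g₁, g₂, hg, eg⟩ := TriModule.exists_hom
    ((eN.toLinearMap ∘ₗ g) ∘ₗ eM.symm.toLinearMap)
  rw [ef, eg, TriModule.ses_iff hf hg] at h'
  exact ⟨f₁, f₂, g₁, g₂, hf, hg, h'⟩

/-- Cokernels of the vertical monomorphisms between two short exact rows. -/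
theorem SES.coker_row {R : Type u} [Ring R] {K M N K' M' N' QK QM QN : Type u}
    [AddCommGroup K] [Module R K] [AddCommGroup M] [Module R M] [AddCommGroup N] [Module R N]
    [AddCommGroup K'] [Module R K'] [AddCommGroup M'] [Module R M'] [AddCommGroup N'] [Module R N']
    [AddCommGroup QK] [Module R QK] [AddCommGroup QM] [Module R QM] [AddCommGroup QN] [Module R QN]
    {a : K →ₗ[R] M} {b : M →ₗ[R] N} (hab : SES a b) {c : K' →ₗ[R] M'} {d : M' →ₗ[R] N'}
    (hcd : SES c d) {k : K →ₗ[R] K'} {qk : K' →ₗ[R] QK} (hk : SES k qk)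
    {m : M →ₗ[R] M'} {qm : M' →ₗ[R] QM} (hm : SES m qm)
    {n : N →ₗ[R] N'} {qn : N' →ₗ[R] QN} (hn : SES n qn)
    (hck : c ∘ₗ k = m ∘ₗ a) (hdm : d ∘ₗ m = n ∘ₗ b) :
    ∃ (f : QK →ₗ[R] QM) (g : QM →ₗ[R] QN), SES f g ∧ f ∘ₗ qk = qm ∘ₗ c := by
  have hck' : ∀ x, c (k x) = m (a x) := LinearMap.congr_fun hck
  have hdm' : ∀ x, d (m x) = n (b x) := LinearMap.congr_fun hdm
  obtain ⟨f, hf⟩ := hk.desc (qm ∘ₗ c) (LinearMap.ext fun x => by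
    simp [hck', hm.exact.apply_apply_eq_zero])
  obtain ⟨g, hg⟩ := hm.desc (qn ∘ₗ d) (LinearMap.ext fun x => by
    simp [hdm', hn.exact.apply_apply_eq_zero])
  have hf' : ∀ x, f (qk x) = qm (c x) := LinearMap.congr_fun hf
  have hg' : ∀ x, g (qm x) = qn (d x) := LinearMap.congr_fun hg
  refine ⟨f, g, ⟨?_, fun q => ⟨fun hq => ?_, ?_⟩, fun q => ?_⟩, hf⟩
  · rw [injective_iff_map_eq_zero]
    intro q hq
    obtain ⟨x, rfl⟩ := hk.surj q
    rw [hf', hm.exact] at hq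
    obtain ⟨y, hy⟩ := hq
    have h0 : n (b y) = 0 := by rw [← hdm', hy, hcd.exact.apply_apply_eq_zero]
    rw [map_eq_zero_iff n hn.inj, hab.exact] at h0
    obtain ⟨z, rfl⟩ := h0
    rw [← hck'] at hy
    rw [← hcd.inj hy, hk.exact.apply_apply_eq_zero]
  · obtain ⟨y, rfl⟩ := hm.surj q
    rw [hg', hn.exact] at hq
    obtain ⟨w, hw⟩ := hq
    obtain ⟨v, rfl⟩ := hab.surj w
    obtain ⟨x, hx⟩ := (hcd.exact (y - m v)).1 (by rw [map_sub, hdm', hw, sub_self])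
    exact ⟨qk x, by rw [hf', hx, map_sub, hm.exact.apply_apply_eq_zero, sub_zero]⟩
  · rintro ⟨y, rfl⟩
    obtain ⟨x, rfl⟩ := hk.surj y
    rw [hf', hg', hcd.exact.apply_apply_eq_zero, map_zero]
  · obtain ⟨y, rfl⟩ := hn.surj q
    obtain ⟨x, rfl⟩ := hcd.surj y
    exact ⟨qm x, hg' x⟩

/-- The direct sum of copies of `(M₁; M₂)_φ` is computed componentwise. -/
theorem TriModule.exists_finsupp_equiv (I : Type u) (φ : BTensor A B U M₁ →ₗ[B] M₂)
    (s : BTensor A B U (I →₀ M₁) →ₗ[B] (I →₀ BTensor A B U M₁))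
    (hs : ∀ u m i, s (BTensor.tmul A B U u m) i = BTensor.tmul A B U u (m i)) :
    Nonempty ((I →₀ TriModule φ) ≃ₗ[TriRing A B U]
      TriModule (Finsupp.mapRange.linearMap φ ∘ₗ s)) := by
  let p₁ : TriModule φ →+ M₁ := AddMonoidHom.fst M₁ M₂
  let p₂ : TriModule φ →+ M₂ := AddMonoidHom.snd M₁ M₂
  let ι : (I →₀ TriModule φ) →ₗ[TriRing A B U] TriModule (Finsupp.mapRange.linearMap φ ∘ₗ s) :=
    { toFun := fun z => ((z.mapRange p₁ (map_zero _), z.mapRange p₂ (map_zero _)) :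
        (I →₀ M₁) × (I →₀ M₂))
      map_add' := fun z w => Prod.ext (Finsupp.mapRange_add (hf := map_zero p₁) (map_add p₁) z w)
        (Finsupp.mapRange_add (hf := map_zero p₂) (map_add p₂) z w)
      map_smul' := fun t z => by
        refine Prod.ext (Finsupp.ext fun i => rfl) (Finsupp.ext fun i => ?_)
        change φ (BTensor.tmul A B U t.u (z i).1) + t.b • (z i).2 =
          φ (s (BTensor.tmul A B U t.u (z.mapRange p₁ (map_zero _))) i) + t.b • (z i).2
        rw [hs]
        rfl }
  refine ⟨LinearEquiv.ofBijective ι ⟨fun z w hzw => Finsupp.ext fun i => Prod.ext ?_ ?_,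
    fun z => ?_⟩⟩
  · exact DFunLike.congr_fun (congrArg Prod.fst hzw) i
  · exact DFunLike.congr_fun (congrArg Prod.snd hzw) i
  · refine ⟨(z.1.mapRange (AddMonoidHom.inl M₁ M₂) (map_zero _) +
      z.2.mapRange (AddMonoidHom.inr M₁ M₂) (map_zero _) : I →₀ M₁ × M₂), Prod.ext ?_ ?_⟩
    · refine Finsupp.ext fun i => ?_
      change z.1 i + 0 = z.1 i
      rw [add_zero]
    · refine Finsupp.ext fun i => ?_
      change 0 + z.2 i = z.2 i
      rw [zero_add]

theorem PModule.exists_finsupp_equiv (I : Type u) :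
    Nonempty ((I →₀ PModule A B U M₁ M₂) ≃ₗ[TriRing A B U]
      PModule A B U (I →₀ M₁) (I →₀ M₂)) := by
  obtain ⟨s, t, hs, hts, hst⟩ := BTensor.exists_finsupp (A := A) (B := B) (U := U) (M := M₁) I
  obtain ⟨e⟩ := TriModule.exists_finsupp_equiv I (LinearMap.inl B (BTensor A B U M₁) M₂) s hs
  have hst' : ∀ x, s (t x) = x := LinearMap.congr_fun hst
  have hts' : ∀ x, t (s x) = x := LinearMap.congr_fun hts
  let e₂ : (BTensor A B U (I →₀ M₁) × (I →₀ M₂)) ≃ₗ[B] (I →₀ BTensor A B U M₁ × M₂) :=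
    LinearEquiv.ofLinearMap
      ((Finsupp.mapRange.linearMap (LinearMap.inl B (BTensor A B U M₁) M₂) ∘ₗ s).coprod
        (Finsupp.mapRange.linearMap (LinearMap.inr B (BTensor A B U M₁) M₂)))
      ((t ∘ₗ Finsupp.mapRange.linearMap (LinearMap.fst B (BTensor A B U M₁) M₂)).prod
        (Finsupp.mapRange.linearMap (LinearMap.snd B (BTensor A B U M₁) M₂)))
      (by
        refine LinearMap.ext fun z => Finsupp.ext fun i => Prod.ext ?_ ?_ <;>
        simp [hst'])
      (by
        refine LinearMap.ext fun z => Prod.ext ?_ ?_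
        · have : Finsupp.mapRange.linearMap (LinearMap.fst B (BTensor A B U M₁) M₂)
              (Finsupp.mapRange.linearMap (LinearMap.inl B (BTensor A B U M₁) M₂) (s z.1) +
                Finsupp.mapRange.linearMap (LinearMap.inr B (BTensor A B U M₁) M₂) z.2) = s z.1 := by
            refine Finsupp.ext fun i => ?_
            simp
          exact (congrArg t this).trans (hts' _)
        · refine Finsupp.ext fun i => ?_
          simp)
  refine ⟨e.trans (TriModule.equiv (LinearEquiv.refl A _) e₂.symm ?_)⟩
  refine LinearMap.ext fun z => ?_
  rw [LinearMap.comp_apply, LinearEquiv.coe_coe, LinearEquiv.symm_apply_eq]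
  have : BTensor.map B U (LinearEquiv.refl A (I →₀ M₁)).toLinearMap z = z :=
    LinearMap.congr_fun BTensor.map_id z
  change _ = e₂ (LinearMap.inl B _ _ (BTensor.map B U _ z))
  rw [this]
  simp [e₂]

/-- `(P₁; (U ⊗ P₁) ⊕ P₂)` is projective if `P₁` and `P₂` are. -/
instance PModule.projective [Module.Projective A M₁] [Module.Projective B M₂] :
    Module.Projective (TriRing A B U) (PModule A B U M₁ M₂) := by
  refine Module.Projective.of_lifting_property'' fun f hf => ?_
  obtain ⟨X₁, X₂, ξ, ⟨e⟩⟩ := exists_equiv_triModule (A := A) (B := B) (U := U)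
    (PModule A B U M₁ M₂ →₀ TriRing A B U)
  obtain ⟨f₁, f₂, hf', ef⟩ := TriModule.exists_hom (f ∘ₗ e.symm.toLinearMap)
  have hsurj : Function.Surjective (TriModule.hom f₁ f₂ hf') := by
    rw [← ef]
    exact hf.comp e.symm.surjective
  obtain ⟨h₁, hh₁⟩ := Module.projective_lifting_property f₁ LinearMap.id (fun y => by
    obtain ⟨x, hx⟩ := hsurj ((y, 0) : M₁ × BTensor A B U M₁ × M₂)
    exact ⟨x.1, congrArg Prod.fst hx⟩)
  obtain ⟨h₂, hh₂⟩ := Module.projective_lifting_property f₂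
    (LinearMap.inr B (BTensor A B U M₁) M₂) (fun y => by
    obtain ⟨x, hx⟩ := hsurj ((0, y) : M₁ × BTensor A B U M₁ × M₂)
    exact ⟨x.2, congrArg Prod.snd hx⟩)
  -- A map out of `p(M₁, M₂)` is freely determined by a map on `M₁` and a map on `M₂`, so the
  -- section of `f` is assembled from separate lifts over `A` and `B`.
  let h : PModule A B U M₁ M₂ →ₗ[TriRing A B U] TriModule ξ :=
    TriModule.hom h₁ ((ξ ∘ₗ BTensor.map B U h₁).coprod h₂) (LinearMap.coprod_inl _ _)
  have hfh : ∀ z, TriModule.hom f₁ f₂ hf' (h z) = z := fun z => by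
    refine Prod.ext (LinearMap.congr_fun hh₁ z.1) ?_
    change f₂ (((ξ ∘ₗ BTensor.map B U h₁).coprod h₂) z.2) = z.2
    rw [← LinearMap.comp_apply, LinearMap.comp_coprod, ← LinearMap.comp_assoc, hf',
      LinearMap.comp_assoc, ← BTensor.map_comp, hh₁, hh₂, BTensor.map_id, LinearMap.comp_id,
      LinearMap.coprod_inl_inr]
    rfl
  refine ⟨e.symm.toLinearMap ∘ₗ h, LinearMap.ext fun z => ?_⟩
  rw [← ef] at hfh
  exact hfh z

end Triples

/-! ### Components of `G_C`-projective `T`-modules -/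

section Structure

variable {A B U : Type u} [Ring A] [Ring B] [AddCommGroup U] [Module B U] [Module Aᵐᵒᵖ U]
  [SMulCommClass B Aᵐᵒᵖ U]
variable {C₁ C₂ : Type u} [AddCommGroup C₁] [Module A C₁] [AddCommGroup C₂] [Module B C₂]

/-- Compatibility (a) in usable form: a projective resolution of `N` through `P` is spliced with an
`Add(C₁)`-coresolution through `X`. Exactness after tensoring yields injectivity on both sides of
`N`. Only exactness of the coresolution is needed, hence the arbitrary `𝓕`. -/
theorem IsCompatible.tensor_injective (hU : IsCompatible A B U C₁ C₂) {K P N X L : Type u}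
    [AddCommGroup K] [Module A K] [AddCommGroup P] [Module A P] [AddCommGroup N] [Module A N]
    [AddCommGroup X] [Module A X] [AddCommGroup L] [Module A L] [Module.Projective A P]
    {f : K →ₗ[A] P} {g : P →ₗ[A] N} (h : SES f g) {i : N →ₗ[A] X} {j : X →ₗ[A] L} (h' : SES i j)
    (hX : IsAdd A C₁ X) {𝓕 : ModuleCat.{u} A → Prop} (hL : HasCores A C₁ 𝓕 L) :
    Function.Injective (BTensor.map B U f) ∧ Function.Injective (BTensor.map B U i) := by
  obtain ⟨P', d, ε, hP', hε, he, hd, -⟩ := hasRes (R := A) K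
  obtain ⟨X', ε', d', hX', ⟨hε', he', hd'⟩, -⟩ := hL
  let S : TwoSided A :=
    { P := fun n => match n with
        | 0 => ModuleCat.of A P
        | n + 1 => P' n
      A := fun n => match n with
        | 0 => ModuleCat.of A X
        | n + 1 => X' n
      dP := fun n => match n with
        | 0 => f ∘ₗ ε
        | n + 1 => d n
      mid := i ∘ₗ g
      dA := fun n => match n with
        | 0 => ε' ∘ₗ j
        | n + 1 => d' n }
  have hS : S.IsExact := by
    refine ⟨fun n => ?_, h.exact_splice hε h'.inj, h'.exact_splice h.surj hε', fun n => ?_⟩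
    · cases n with
      | zero =>
        intro x
        rw [← he x]
        exact map_eq_zero_iff f h.inj
      | succ n => exact hd n
    · cases n with
      | zero =>
        intro x
        rw [he' x]
        constructor
        · rintro ⟨y, rfl⟩
          obtain ⟨z, rfl⟩ := h'.surj y
          exact ⟨z, rfl⟩
        · rintro ⟨z, rfl⟩
          exact ⟨j z, rfl⟩
      | succ n => exact hd' n
  have hSC : S.ProjAdd C₁ := by
    refine ⟨fun n => ?_, fun n => ?_⟩
    · cases n with
      | zero => exact inferInstanceAs (Module.Projective A P)
      | succ n => exact hP' n
    · cases n with
      | zero => exact hX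
      | succ n => exact hX' n
  obtain ⟨e₁, e₂, -, -⟩ := hU.tensor_exact S hS hSC
  have e₁ : Function.Exact (BTensor.map B U (d 0)) (BTensor.map B U (f ∘ₗ ε)) := e₁ 0
  have e₂ : Function.Exact (BTensor.map B U (f ∘ₗ ε)) (BTensor.map B U (i ∘ₗ g)) := e₂
  rw [BTensor.map_comp] at e₁
  rw [BTensor.map_comp, BTensor.map_comp] at e₂
  constructor
  · rw [injective_iff_map_eq_zero]
    -- Lift `z` to the next projective: the lift dies in `U ⊗ P`, hence comes from one projective
    -- further left, and so `z` is zero.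
    intro z hz
    obtain ⟨w, rfl⟩ := BTensor.map_surjective (B := B) (U := U) hε z
    obtain ⟨v, rfl⟩ := (e₁ w).1 hz
    exact (BTensor.map_exact (B := B) (U := U) he hε).apply_apply_eq_zero v
  · rw [injective_iff_map_eq_zero]
    intro z hz
    obtain ⟨w, rfl⟩ := BTensor.map_surjective (B := B) (U := U) h.surj z
    obtain ⟨v, rfl⟩ := (e₂ w).1 hz
    exact (BTensor.map_exact (B := B) (U := U) h.exact h.surj).apply_apply_eq_zero _

/-- Compatibility (b) in usable form: the left half of a defining sequence of `Q` is a projective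
resolution that stays exact under `Hom(-, U ⊗ X)`. -/
theorem IsCompatible.extVan (hU : IsCompatible A B U C₁ C₂) {Q X : Type u} [AddCommGroup Q]
    [Module B Q] [AddCommGroup X] [Module A X] (hQ : IsGProj B C₂ Q) (hX : IsAdd A C₁ X) :
    ExtVan B Q (BTensor A B U X) := by
  obtain ⟨S, h₁, h₂, h₃, ⟨e⟩⟩ := hQ
  exact (S.hasRes h₁ h₂.1 e).extVan (ModuleCat.of B (BTensor A B U X))
    (hU.hom_exact S h₁ h₂ h₃ (ModuleCat.of A X) hX)

variable {M₁ M₂ : Type u} [AddCommGroup M₁] [Module A M₁] [AddCommGroup M₂] [Module B M₂]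
  {φ : BTensor A B U M₁ →ₗ[B] M₂}

/-- The components of a module in `Add(p(C₁, C₂))`. -/
theorem IsAdd.triModule (h : IsAdd (TriRing A B U) (PModule A B U C₁ C₂) (TriModule φ)) :
    IsAdd A C₁ M₁ ∧ Function.Injective φ ∧
      IsAdd B C₂ (M₂ ⧸ LinearMap.range φ) := by
  obtain ⟨I, i, p, hip⟩ := isAdd_iff_retract.1 h
  obtain ⟨e⟩ := PModule.exists_finsupp_equiv (A := A) (B := B) (U := U) (M₁ := C₁) (M₂ := C₂) I
  obtain ⟨i₁, i₂, hi, ei⟩ := TriModule.exists_hom (e.toLinearMap ∘ₗ i)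
  obtain ⟨p₁, p₂, hp, ep⟩ := TriModule.exists_hom (p ∘ₗ e.symm.toLinearMap)
  have hpi : TriModule.hom p₁ p₂ hp ∘ₗ TriModule.hom i₁ i₂ hi =
      TriModule.hom LinearMap.id LinearMap.id (by rw [BTensor.map_id]; rfl) := by
    rw [← ei, ← ep]
    refine LinearMap.ext fun z => ?_
    have : p (e.symm (e (i z))) = z := by
      rw [e.symm_apply_apply]; exact LinearMap.congr_fun hip z
    exact this
  rw [TriModule.hom_comp, TriModule.hom_eq_iff] at hpi
  obtain ⟨h₁, h₂⟩ := hpi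
  refine ⟨(IsAdd.finsupp_self I).retract h₁, ?_, ?_⟩
  · have : Function.Injective (LinearMap.inl B (BTensor A B U (I →₀ C₁)) (I →₀ C₂) ∘ₗ
        BTensor.map B U i₁) := by
      refine LinearMap.inl_injective.comp (Function.LeftInverse.injective
        (g := BTensor.map B U p₁) fun z => ?_)
      rw [← LinearMap.comp_apply, ← BTensor.map_comp, h₁, BTensor.map_id]; rfl
    rw [← hi, LinearMap.coe_comp] at this
    exact this.of_comp
  · let i' : (M₂ ⧸ LinearMap.range φ) →ₗ[B] (I →₀ C₂) :=
      (LinearMap.range φ).liftQ (LinearMap.snd B _ _ ∘ₗ i₂) (by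
        rintro _ ⟨x, rfl⟩
        exact congrArg Prod.snd (LinearMap.congr_fun hi x))
    refine (IsAdd.finsupp_self I).retract (i := i')
      (p := (LinearMap.range φ).mkQ ∘ₗ p₂ ∘ₗ LinearMap.inr B _ _) ?_
    refine Submodule.linearMap_qext _ (LinearMap.ext fun x => ?_)
    change (LinearMap.range φ).mkQ (p₂ (0, (i₂ x).2)) = (LinearMap.range φ).mkQ x
    -- Write `i₂ x` as the sum of its two coordinates; `p₂` sends the `U ⊗ C₁^(I)` coordinate into
    -- the range of `φ`, so the other one alone recovers `x` modulo that range.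
    have hx : p₂ (0, (i₂ x).2) = x - φ (BTensor.map B U p₁ (i₂ x).1) := by
      have e₁ : p₂ (i₂ x) = x := LinearMap.congr_fun h₂ x
      have e₂ : p₂ ((i₂ x).1, 0) = φ (BTensor.map B U p₁ (i₂ x).1) :=
        LinearMap.congr_fun hp (i₂ x).1
      rw [← e₂, eq_sub_iff_add_eq, ← map_add, Prod.mk_add_mk, zero_add, add_zero]
      exact e₁
    rw [hx, map_sub, sub_eq_self]
    simp

theorem IsGProj.exists_triple_cosyzygy
    (hT : IsWT (TriRing A B U) (PModule A B U C₁ C₂))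
    (hM : IsGProj (TriRing A B U) (PModule A B U C₁ C₂) (TriModule φ)) :
    ∃ (X₁ : ModuleCat.{u} A) (X₂ : ModuleCat.{u} B) (α : BTensor A B U X₁ →ₗ[B] X₂)
      (N₁ : ModuleCat.{u} A) (N₂ : ModuleCat.{u} B) (ν : BTensor A B U N₁ →ₗ[B] N₂)
      (f₁ : M₁ →ₗ[A] X₁) (f₂ : M₂ →ₗ[B] X₂) (g₁ : X₁ →ₗ[A] N₁) (g₂ : X₂ →ₗ[B] N₂),
      IsAdd (TriRing A B U) (PModule A B U C₁ C₂) (TriModule α) ∧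
      IsGProj (TriRing A B U) (PModule A B U C₁ C₂) (TriModule ν) ∧
      f₂ ∘ₗ φ = α ∘ₗ BTensor.map B U f₁ ∧ g₂ ∘ₗ α = ν ∘ₗ BTensor.map B U g₁ ∧
      SES f₁ g₁ ∧ SES f₂ g₂ := by
  obtain ⟨X, N, f, g, hX, hN, h⟩ := hM.exists_ses hT.perp
  obtain ⟨X₁, X₂, α, ⟨eX⟩⟩ := exists_equiv_triModule (A := A) (B := B) (U := U) X
  obtain ⟨N₁, N₂, ν, ⟨eN⟩⟩ := exists_equiv_triModule (A := A) (B := B) (U := U) N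
  obtain ⟨f₁, f₂, g₁, g₂, hs⟩ := h.exists_triple (LinearEquiv.refl _ _) eX eN
  exact ⟨X₁, X₂, α, N₁, N₂, ν, f₁, f₂, g₁, g₂, hX.of_equiv eX, hN.of_equiv eN, hs⟩

/-- The class `False` makes the Hom conditions vacuous: orthogonality of first components is not yet
known at this point, and mere exactness suffices for compatibility (a). -/
theorem IsGProj.fst_hasCores (hT : IsWT (TriRing A B U) (PModule A B U C₁ C₂))
    (hM : IsGProj (TriRing A B U) (PModule A B U C₁ C₂) (TriModule φ)) :
    HasCores A C₁ (fun _ => False) M₁ := by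
  refine HasCores.of_class (fun N₁ => ∃ (N₂ : ModuleCat.{u} B) (ν : BTensor A B U N₁ →ₗ[B] N₂),
    IsGProj (TriRing A B U) (PModule A B U C₁ C₂) (TriModule ν)) ?_ (ModuleCat.of A M₁)
    ⟨ModuleCat.of B M₂, φ, hM⟩
  rintro N₁ ⟨N₂, ν, hν⟩
  obtain ⟨X₁, X₂, α, L₁, L₂, μ, f₁, f₂, g₁, g₂, hα, hμ, -, -, hs, -⟩ :=
    hν.exists_triple_cosyzygy hT
  exact ⟨X₁, L₁, f₁, g₁, hα.triModule.1, ⟨L₂, μ, hμ⟩, hs, fun F hF => hF.elim⟩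

theorem IsGProj.tensor_injective_of_projective (hT : IsWT (TriRing A B U) (PModule A B U C₁ C₂))
    (hU : IsCompatible A B U C₁ C₂)
    (hM : IsGProj (TriRing A B U) (PModule A B U C₁ C₂) (TriModule φ))
    {K P : Type u} [AddCommGroup K] [Module A K] [AddCommGroup P] [Module A P]
    [Module.Projective A P] {f : K →ₗ[A] P} {g : P →ₗ[A] M₁} (h : SES f g) :
    Function.Injective (BTensor.map B U f) := by
  obtain ⟨X₁, X₂, α, N₁, N₂, ν, f₁, f₂, g₁, g₂, hα, hν, -, -, hs, -⟩ :=
    hM.exists_triple_cosyzygy hT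
  exact (hU.tensor_injective h hs hα.triModule.1 (hν.fst_hasCores hT)).1

theorem IsGProj.tensor_injective_of_isAdd (hT : IsWT (TriRing A B U) (PModule A B U C₁ C₂))
    (hU : IsCompatible A B U C₁ C₂) {X N₁ N₂ : Type u} [AddCommGroup X] [Module A X]
    [AddCommGroup N₁] [Module A N₁] [AddCommGroup N₂] [Module B N₂]
    {ν : BTensor A B U N₁ →ₗ[B] N₂} (hX : IsAdd A C₁ X)
    (hN : IsGProj (TriRing A B U) (PModule A B U C₁ C₂) (TriModule ν))
    {f : M₁ →ₗ[A] X} {g : X →ₗ[A] N₁} (h : SES f g) :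
    Function.Injective (BTensor.map B U f) := by
  obtain ⟨K, i, p, hs⟩ := exists_free_ses A M₁
  exact (hU.tensor_injective hs h hX (hN.fst_hasCores hT)).2

/-- Embed the triple in a member of `Add(C)`, whose structure map `α` is injective. Since `U ⊗ f₁`
is injective by (a), so is `α ∘ (U ⊗ f₁) = f₂ ∘ φ`, and hence `φ`. -/
theorem IsGProj.structure_injective (hT : IsWT (TriRing A B U) (PModule A B U C₁ C₂))
    (hU : IsCompatible A B U C₁ C₂)
    (hM : IsGProj (TriRing A B U) (PModule A B U C₁ C₂) (TriModule φ)) :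
    Function.Injective φ := by
  obtain ⟨X₁, X₂, α, N₁, N₂, ν, f₁, f₂, g₁, g₂, hα, hν, hf, -, hs, -⟩ :=
    hM.exists_triple_cosyzygy hT
  have : Function.Injective (f₂ ∘ₗ φ) := by
    rw [hf]
    exact hα.triModule.2.1.comp (hν.tensor_injective_of_isAdd hT hU hα.triModule.1 hs)
  rw [LinearMap.coe_comp] at this
  exact this.of_comp

theorem IsGProj.exists_triple_syzygy
    (hT : IsWT (TriRing A B U) (PModule A B U C₁ C₂))
    (hM : IsGProj (TriRing A B U) (PModule A B U C₁ C₂) (TriModule φ)) :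
    ∃ (K₁ : ModuleCat.{u} A) (K₂ : ModuleCat.{u} B) (κ : BTensor A B U K₁ →ₗ[B] K₂)
      (P₁ : ModuleCat.{u} A) (P₂ : ModuleCat.{u} B)
      (f₁ : K₁ →ₗ[A] P₁) (f₂ : K₂ →ₗ[B] BTensor A B U P₁ × P₂)
      (g₁ : P₁ →ₗ[A] M₁) (g₂ : BTensor A B U P₁ × P₂ →ₗ[B] M₂),
      IsGProj (TriRing A B U) (PModule A B U C₁ C₂) (TriModule κ) ∧
      Module.Projective A P₁ ∧ Module.Projective B P₂ ∧
      f₂ ∘ₗ κ = LinearMap.inl B _ _ ∘ₗ BTensor.map B U f₁ ∧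
      g₂ ∘ₗ LinearMap.inl B _ _ = φ ∘ₗ BTensor.map B U g₁ ∧
      SES f₁ g₁ ∧ SES f₂ g₂ := by
  obtain ⟨L₁, l₁, p₁, h₁⟩ := exists_free_ses A M₁
  obtain ⟨L₂, l₂, p₂, h₂⟩ := exists_free_ses B M₂
  -- A projective cover by `p(A^(M₁), B^(M₂))` rather than by a free `T`-module keeps both
  -- components explicit.
  let g : PModule A B U (M₁ →₀ A) (M₂ →₀ B) →ₗ[TriRing A B U] TriModule φ :=
    TriModule.hom p₁ ((φ ∘ₗ BTensor.map B U p₁).coprod p₂) (LinearMap.coprod_inl _ _)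
  have hg : Function.Surjective g := fun z => by
    obtain ⟨x, hx⟩ := h₁.surj z.1
    obtain ⟨y, hy⟩ := h₂.surj z.2
    refine ⟨((x, (0, y)) : (M₁ →₀ A) × BTensor A B U (M₁ →₀ A) × (M₂ →₀ B)), Prod.ext hx ?_⟩
    change φ (BTensor.map B U p₁ 0) + p₂ y = z.2
    rw [map_zero, map_zero, zero_add, hy]
  have hs := SES.ker_subtype g hg
  obtain ⟨K₁, K₂, κ, ⟨eK⟩⟩ := exists_equiv_triModule (A := A) (B := B) (U := U) (LinearMap.ker g)
  obtain ⟨f₁, f₂, g₁, g₂, hf, hg', hs₁, hs₂⟩ :=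
    hs.exists_triple eK (LinearEquiv.refl _ _) (LinearEquiv.refl _ _)
  exact ⟨K₁, K₂, κ, ModuleCat.of A (M₁ →₀ A), ModuleCat.of B (M₂ →₀ B), f₁, f₂, g₁, g₂,
    (IsGProj.ker hT.perp hs hT.projective hM).of_equiv eK,
    inferInstanceAs (Module.Projective A (M₁ →₀ A)),
    inferInstanceAs (Module.Projective B (M₂ →₀ B)), hf, hg', hs₁, hs₂⟩

-- The test objects `(0; F)` and, below, `(F; U ⊗ F)` are summands of `p(C₁^(I), C₂^(I))`;
-- orthogonality of a triple to them is what yields orthogonality of `coker φ` and of `M₁`.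
variable (A B U C₁ C₂) in
theorem IsAdd.triModule_zero (F : Type u) [AddCommGroup F] [Module B F] (hF : IsAdd B C₂ F) :
    IsAdd (TriRing A B U) (PModule A B U C₁ C₂)
      (TriModule (0 : BTensor A B U PUnit.{u + 1} →ₗ[B] F)) := by
  obtain ⟨I, i, p, hip⟩ := isAdd_iff_retract.1 hF
  obtain ⟨e⟩ := PModule.exists_finsupp_equiv (A := A) (B := B) (U := U) (M₁ := C₁) (M₂ := C₂) I
  refine ((IsAdd.finsupp_self I).of_equiv e).retract
    (i := TriModule.hom 0 (LinearMap.inr B _ _ ∘ₗ i) (by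
      rw [BTensor.map_zero, LinearMap.comp_zero, LinearMap.comp_zero]))
    (p := TriModule.hom 0 (p ∘ₗ LinearMap.snd B _ _) (by
      rw [LinearMap.comp_assoc, LinearMap.snd_comp_inl, LinearMap.comp_zero, LinearMap.zero_comp])) ?_
  exact LinearMap.ext fun z => Prod.ext rfl (LinearMap.congr_fun hip z.2)

variable (A B U C₁ C₂) in
theorem IsAdd.triModule_id (F : Type u) [AddCommGroup F] [Module A F] (hF : IsAdd A C₁ F) :
    IsAdd (TriRing A B U) (PModule A B U C₁ C₂)
      (TriModule (LinearMap.id : BTensor A B U F →ₗ[B] BTensor A B U F)) := by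
  obtain ⟨I, i, p, hip⟩ := isAdd_iff_retract.1 hF
  obtain ⟨e⟩ := PModule.exists_finsupp_equiv (A := A) (B := B) (U := U) (M₁ := C₁) (M₂ := C₂) I
  refine ((IsAdd.finsupp_self I).of_equiv e).retract
    (i := TriModule.hom i (LinearMap.inl B _ _ ∘ₗ BTensor.map B U i) rfl)
    (p := TriModule.hom p (BTensor.map B U p ∘ₗ LinearMap.fst B _ _) rfl) ?_
  refine LinearMap.ext fun z => Prod.ext (LinearMap.congr_fun hip z.1) ?_
  change BTensor.map B U p (BTensor.map B U i z.2) = z.2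
  rw [← LinearMap.comp_apply, ← BTensor.map_comp, hip, BTensor.map_id]
  rfl

/-- The cokernel of the structure map of a `p(C₁, C₂)`-Gorenstein projective module is
left orthogonal to `Add(C₂)`. -/
theorem IsGProj.isPerp_coker (hT : IsWT (TriRing A B U) (PModule A B U C₁ C₂))
    (hU : IsCompatible A B U C₁ C₂)
    (hM : IsGProj (TriRing A B U) (PModule A B U C₁ C₂) (TriModule φ))
    {Q : Type u} [AddCommGroup Q] [Module B Q] {q : M₂ →ₗ[B] Q} (hq : SES φ q) :
    IsPerp B C₂ Q := by
  intro F hF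
  refine ExtVan.of_class (fun Q => ∃ (M₁ : ModuleCat.{u} A) (M₂ : ModuleCat.{u} B)
    (φ : BTensor A B U M₁ →ₗ[B] M₂) (q : M₂ →ₗ[B] Q), SES φ q ∧
    IsGProj (TriRing A B U) (PModule A B U C₁ C₂) (TriModule φ)) ?_ (ModuleCat.of B Q)
    ⟨ModuleCat.of A M₁, ModuleCat.of B M₂, φ, q, hq, hM⟩
  rintro Q ⟨M₁, M₂, φ, q, hq, hM⟩
  obtain ⟨K₁, K₂, κ, P₁, P₂, f₁, f₂, g₁, g₂, hκ, hP₁, hP₂, hf, hg, hs₁, hs₂⟩ :=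
    hM.exists_triple_syzygy hT
  have hk := SES.mkQ_range κ (hκ.structure_injective hT hU)
  obtain ⟨a, b, hab, ha⟩ := (hs₁.tensor (hM.tensor_injective_of_projective hT hU hs₁)).coker_row
    hs₂ hk SES.inl_snd hq hf hg
  refine ⟨ModuleCat.of B (K₂ ⧸ LinearMap.range κ), P₂, a, b, ⟨K₁, K₂, κ, _, hk, hκ⟩, hP₂, hab,
    fun k => ?_⟩
  -- Maps from a triple to `(0; F)` are maps from the cokernel of its structure map to `F`. Hence
  -- `k` is extended by extending `k'` over `T`; the extension kills the summand `U ⊗ P₁` and is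
  -- determined by its restriction to `P₂`.
  let k' : TriModule κ →ₗ[TriRing A B U] TriModule (0 : BTensor A B U PUnit.{u + 1} →ₗ[B] F) :=
    TriModule.hom 0 (k ∘ₗ (LinearMap.range κ).mkQ) (by
      rw [LinearMap.comp_assoc, hk.comp_eq_zero, LinearMap.comp_zero, LinearMap.zero_comp])
  obtain ⟨h, hh⟩ := (hM.isPerp.extVan (IsAdd.triModule_zero A B U C₁ C₂ F hF)).extend
    ((TriModule.ses_iff hf hg).2 ⟨hs₁, hs₂⟩) k'
  obtain ⟨h₁, h₂, hh', rfl⟩ := TriModule.exists_hom h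
  rw [TriModule.hom_comp, TriModule.hom_eq_iff] at hh
  refine ⟨h₂ ∘ₗ LinearMap.inr B _ _, ?_⟩
  refine Submodule.linearMap_qext _ (LinearMap.ext fun x => ?_)
  have e₁ : h₂ (f₂ x) = k ((LinearMap.range κ).mkQ x) := LinearMap.congr_fun hh.2 x
  have e₂ : h₂ ((f₂ x).1, 0) = 0 := LinearMap.congr_fun hh' (f₂ x).1
  have e₃ : a ((LinearMap.range κ).mkQ x) = (f₂ x).2 := LinearMap.congr_fun ha x
  change h₂ (0, a ((LinearMap.range κ).mkQ x)) = k ((LinearMap.range κ).mkQ x)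
  rw [← e₁, e₃, ← zero_add (h₂ (0, _)), ← e₂, ← map_add, Prod.mk_add_mk, zero_add, add_zero]

/-- A cosyzygy of the triple induces a short exact sequence of cokernels of structure maps, since by
(a) the first row stays exact under `U ⊗ -`. The class of all such cokernels is thus closed under
cosyzygies. -/
theorem IsGProj.coker_structure (hT : IsWT (TriRing A B U) (PModule A B U C₁ C₂))
    (hU : IsCompatible A B U C₁ C₂)
    (hM : IsGProj (TriRing A B U) (PModule A B U C₁ C₂) (TriModule φ))
    {Q : Type u} [AddCommGroup Q] [Module B Q] {q : M₂ →ₗ[B] Q} (hq : SES φ q) :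
    IsGProj B C₂ Q := by
  refine IsGProj.of_class (fun Q => ∃ (M₁ : ModuleCat.{u} A) (M₂ : ModuleCat.{u} B)
    (φ : BTensor A B U M₁ →ₗ[B] M₂) (q : M₂ →ₗ[B] Q), SES φ q ∧
    IsGProj (TriRing A B U) (PModule A B U C₁ C₂) (TriModule φ)) ?_ (ModuleCat.of B Q)
    ⟨ModuleCat.of A M₁, ModuleCat.of B M₂, φ, q, hq, hM⟩
  rintro Q ⟨M₁, M₂, φ, q, hq, hM⟩
  refine ⟨hM.isPerp_coker hT hU hq, ?_⟩
  obtain ⟨X₁, X₂, α, N₁, N₂, ν, f₁, f₂, g₁, g₂, hα, hν, hf, hg, hs₁, hs₂⟩ :=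
    hM.exists_triple_cosyzygy hT
  obtain ⟨hα₁, hα₂, hα₃⟩ := hα.triModule
  have hn := SES.mkQ_range ν (hν.structure_injective hT hU)
  obtain ⟨a, b, hab, -⟩ := (hs₁.tensor (hν.tensor_injective_of_isAdd hT hU hα₁ hs₁)).coker_row
    hs₂ hq (SES.mkQ_range α hα₂) hn hf hg
  exact ⟨ModuleCat.of B (X₂ ⧸ LinearMap.range α), ModuleCat.of B (N₂ ⧸ LinearMap.range ν), a, b,
    hα₃, ⟨N₁, N₂, ν, _, hn, hν⟩, hab⟩

theorem IsGProj.isPerp_fst (hT : IsWT (TriRing A B U) (PModule A B U C₁ C₂))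
    (hU : IsCompatible A B U C₁ C₂)
    (hM : IsGProj (TriRing A B U) (PModule A B U C₁ C₂) (TriModule φ)) :
    IsPerp A C₁ M₁ := by
  intro F hF
  refine ExtVan.of_class (fun M₁ => ∃ (M₂ : ModuleCat.{u} B) (φ : BTensor A B U M₁ →ₗ[B] M₂),
    IsGProj (TriRing A B U) (PModule A B U C₁ C₂) (TriModule φ)) ?_ (ModuleCat.of A M₁)
    ⟨ModuleCat.of B M₂, φ, hM⟩
  rintro M₁ ⟨M₂, φ, hM⟩
  obtain ⟨K₁, K₂, κ, P₁, P₂, f₁, f₂, g₁, g₂, hκ, hP₁, hP₂, hf, hg, hs₁, hs₂⟩ :=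
    hM.exists_triple_syzygy hT
  refine ⟨K₁, P₁, f₁, g₁, ⟨K₂, κ, hκ⟩, hP₁, hs₁, fun k => ?_⟩
  have hk := SES.mkQ_range κ (hκ.structure_injective hT hU)
  -- To test against `(F; U ⊗ F)`, `k` must be completed to a morphism of triples. The second
  -- component extends `U ⊗ k` along `κ`; this is possible because `coker κ` is `G_{C₂}`-projective
  -- and (b) kills `Ext^1(coker κ, U ⊗ F)`.
  obtain ⟨l, hl⟩ := (hU.extVan (hκ.coker_structure hT hU hk) hF).extend hk (BTensor.map B U k)
  obtain ⟨h, hh⟩ := (hM.isPerp.extVan (IsAdd.triModule_id A B U C₁ C₂ F hF)).extend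
    ((TriModule.ses_iff hf hg).2 ⟨hs₁, hs₂⟩) (TriModule.hom k l (by rw [hl]; rfl))
  obtain ⟨h₁, h₂, hh', rfl⟩ := TriModule.exists_hom h
  rw [TriModule.hom_comp, TriModule.hom_eq_iff] at hh
  exact ⟨h₁, hh.1⟩

theorem IsGProj.fst (hT : IsWT (TriRing A B U) (PModule A B U C₁ C₂))
    (hU : IsCompatible A B U C₁ C₂)
    (hM : IsGProj (TriRing A B U) (PModule A B U C₁ C₂) (TriModule φ)) :
    IsGProj A C₁ M₁ := by
  refine IsGProj.of_class (fun M₁ => ∃ (M₂ : ModuleCat.{u} B) (φ : BTensor A B U M₁ →ₗ[B] M₂),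
    IsGProj (TriRing A B U) (PModule A B U C₁ C₂) (TriModule φ)) ?_ (ModuleCat.of A M₁)
    ⟨ModuleCat.of B M₂, φ, hM⟩
  rintro M₁ ⟨M₂, φ, hM⟩
  refine ⟨hM.isPerp_fst hT hU, ?_⟩
  obtain ⟨X₁, X₂, α, N₁, N₂, ν, f₁, f₂, g₁, g₂, hα, hν, hf, hg, hs₁, hs₂⟩ :=
    hM.exists_triple_cosyzygy hT
  exact ⟨X₁, N₁, f₁, g₁, hα.triModule.1, ⟨N₂, ν, hν⟩, hs₁⟩

/-- Applied to the `G_C`-projective modules `p(C₁, C₂)` and `p(A, B)`, the structure results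
transfer the w-tilting conditions from `C` to `C₁`, and below to `C₂`. -/
theorem IsWT.fst (hT : IsWT (TriRing A B U) (PModule A B U C₁ C₂))
    (hU : IsCompatible A B U C₁ C₂) : IsWT A C₁ :=
  ⟨(IsGProj.of_isAdd hT.perp .self).isPerp_fst hT hU,
    IsGProj.fst hT hU (hT.projective (M := PModule A B U A B))⟩

theorem IsWT.snd (hT : IsWT (TriRing A B U) (PModule A B U C₁ C₂))
    (hU : IsCompatible A B U C₁ C₂) : IsWT B C₂ :=
  ⟨(IsGProj.of_isAdd hT.perp .self).isPerp_coker hT hU SES.inl_snd,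
    IsGProj.coker_structure hT hU (hT.projective (M := PModule A B U A B)) SES.inl_snd⟩

end Structure

/-! ### Building `G_C`-projective `T`-modules from components -/

section Lifting

variable {A B U : Type u} [Ring A] [Ring B] [AddCommGroup U] [Module B U] [Module Aᵐᵒᵖ U]
  [SMulCommClass B Aᵐᵒᵖ U]
variable {C₁ C₂ : Type u} [AddCommGroup C₁] [Module A C₁] [AddCommGroup C₂] [Module B C₂]
variable {M₁ M₂ : Type u} [AddCommGroup M₁] [Module A M₁] [AddCommGroup M₂] [Module B M₂]
  {φ : BTensor A B U M₁ →ₗ[B] M₂}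

/-- `Ext` into `p(C₁^(I), C₂^(I))` controls `Ext` into `Add(p(C₁, C₂))`. -/
theorem isPerp_triModule_iff {X : Type u} [AddCommGroup X] [Module (TriRing A B U) X] :
    IsPerp (TriRing A B U) (PModule A B U C₁ C₂) X ↔
      ∀ I : Type u, ExtVan (TriRing A B U) X (PModule A B U (I →₀ C₁) (I →₀ C₂)) := by
  rw [isPerp_iff]
  refine forall_congr' fun I => ?_
  obtain ⟨e⟩ := PModule.exists_finsupp_equiv (A := A) (B := B) (U := U) (M₁ := C₁) (M₂ := C₂) I
  exact ⟨fun h => h.retract_right (i := e.symm.toLinearMap) (p := e.toLinearMap) (by ext; simp),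
    fun h => h.retract_right (i := e.toLinearMap) (p := e.symm.toLinearMap)
      (LinearMap.ext fun x => e.symm_apply_apply x)⟩

variable (A U) in
/-- The functor `Y ↦ (0; Y)` on morphisms. -/
def TriModule.zeroMap {Y Z : Type u} [AddCommGroup Y] [Module B Y] [AddCommGroup Z] [Module B Z]
    (f : Y →ₗ[B] Z) : TriModule (0 : BTensor A B U PUnit.{u + 1} →ₗ[B] Y) →ₗ[TriRing A B U]
      TriModule (0 : BTensor A B U PUnit.{u + 1} →ₗ[B] Z) :=
  TriModule.hom 0 f (by rw [LinearMap.comp_zero, LinearMap.zero_comp])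

variable (B U) in
/-- The functor `X ↦ (X; U ⊗ X)` on morphisms. -/
noncomputable def TriModule.idMap {X Y : Type u} [AddCommGroup X] [Module A X] [AddCommGroup Y]
    [Module A Y] (f : X →ₗ[A] Y) :
    TriModule (LinearMap.id : BTensor A B U X →ₗ[B] BTensor A B U X) →ₗ[TriRing A B U]
      TriModule (LinearMap.id : BTensor A B U Y →ₗ[B] BTensor A B U Y) :=
  TriModule.hom f (BTensor.map B U f) rfl

variable (A U) in
theorem SES.zeroMap {K X N : Type u} [AddCommGroup K] [Module B K] [AddCommGroup X] [Module B X]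
    [AddCommGroup N] [Module B N] {f : K →ₗ[B] X} {g : X →ₗ[B] N} (h : SES f g) :
    SES (TriModule.zeroMap A U f) (TriModule.zeroMap A U g) :=
  (TriModule.ses_iff _ _).2 ⟨⟨Function.injective_of_subsingleton _,
    fun _ => ⟨fun _ => ⟨0, rfl⟩, fun _ => rfl⟩, fun _ => ⟨0, rfl⟩⟩, h⟩

theorem SES.idMap {K X N : Type u} [AddCommGroup K] [Module A K] [AddCommGroup X] [Module A X]
    [AddCommGroup N] [Module A N] {f : K →ₗ[A] X} {g : X →ₗ[A] N} (h : SES f g)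
    (hf : Function.Injective (BTensor.map B U f)) :
    SES (TriModule.idMap B U f) (TriModule.idMap B U g) :=
  (TriModule.ses_iff _ _).2 ⟨h, h.tensor hf⟩

theorem TriModule.projective_zero (P : Type u) [AddCommGroup P] [Module B P]
    [Module.Projective B P] :
    Module.Projective (TriRing A B U) (TriModule (0 : BTensor A B U PUnit.{u + 1} →ₗ[B] P)) :=
  .of_split (TriModule.hom 0 (LinearMap.inr B _ _) (by
      rw [BTensor.map_zero, LinearMap.comp_zero, LinearMap.comp_zero]))
    (TriModule.hom (φ := LinearMap.inl B (BTensor A B U PUnit.{u + 1}) P) 0 (LinearMap.snd B _ _)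
      (by rw [LinearMap.snd_comp_inl, LinearMap.zero_comp]))
    (LinearMap.ext fun _ => rfl)

theorem TriModule.projective_id (P : Type u) [AddCommGroup P] [Module A P]
    [Module.Projective A P] :
    Module.Projective (TriRing A B U)
      (TriModule (LinearMap.id : BTensor A B U P →ₗ[B] BTensor A B U P)) :=
  .of_split (TriModule.hom LinearMap.id (LinearMap.inl B _ PUnit.{u + 1}) (by
      rw [BTensor.map_id]))
    (TriModule.hom LinearMap.id (LinearMap.fst B _ _) (by rw [BTensor.map_id]; rfl))
    (LinearMap.ext fun _ => rfl)

/-- `Hom_T((0; N), (M₁; M₂)) = Hom_B(N, M₂)`, and `N ↦ (0; N)` is exact and preserves projectives,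
so Ext is computed over `B`. -/
theorem ExtVan.zeroTriple {N : Type u} [AddCommGroup N] [Module B N] (h : ExtVan B N M₂) :
    ExtVan (TriRing A B U) (TriModule (0 : BTensor A B U PUnit.{u + 1} →ₗ[B] N))
      (TriModule φ) := by
  refine ExtVan.of_class (fun X => ∃ N : ModuleCat.{u} B, ExtVan B N M₂ ∧
    X = ModuleCat.of _ (TriModule (0 : BTensor A B U PUnit.{u + 1} →ₗ[B] N))) ?_
    (ModuleCat.of _ (TriModule (0 : BTensor A B U PUnit.{u + 1} →ₗ[B] N)))
    ⟨ModuleCat.of B N, h, rfl⟩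
  rintro _ ⟨N, hN, rfl⟩
  obtain ⟨K, f, g, hs⟩ := exists_free_ses B N
  refine ⟨ModuleCat.of _ (TriModule (0 : BTensor A B U PUnit.{u + 1} →ₗ[B] K)),
    ModuleCat.of _ (TriModule (0 : BTensor A B U PUnit.{u + 1} →ₗ[B] (N →₀ B))),
    TriModule.zeroMap A U f, TriModule.zeroMap A U g,
    ⟨K, ExtVan.ker hs .of_projective hN, rfl⟩, TriModule.projective_zero _, hs.zeroMap A U,
    fun k => ?_⟩
  obtain ⟨k₁, k₂, hk, rfl⟩ := TriModule.exists_hom k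
  obtain ⟨k', rfl⟩ := hN.extend hs k₂
  refine ⟨TriModule.hom 0 k' (by rw [LinearMap.comp_zero, BTensor.map_zero, LinearMap.comp_zero]),
    LinearMap.ext fun z => Prod.ext ?_ rfl⟩
  exact (map_zero k₁).symm

theorem IsGProj.zeroTriple (hT : IsWT (TriRing A B U) (PModule A B U C₁ C₂))
    (hU : IsCompatible A B U C₁ C₂) {G : Type u} [AddCommGroup G] [Module B G]
    (hG : IsGProj B C₂ G) :
    IsGProj (TriRing A B U) (PModule A B U C₁ C₂)
      (TriModule (0 : BTensor A B U PUnit.{u + 1} →ₗ[B] G)) := by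
  refine IsGProj.of_class (fun X => ∃ G : ModuleCat.{u} B, IsGProj B C₂ G ∧
    X = ModuleCat.of _ (TriModule (0 : BTensor A B U PUnit.{u + 1} →ₗ[B] G))) ?_
    (ModuleCat.of _ (TriModule (0 : BTensor A B U PUnit.{u + 1} →ₗ[B] G)))
    ⟨ModuleCat.of B G, hG, rfl⟩
  rintro _ ⟨G, hG, rfl⟩
  obtain ⟨X, N, f, g, hX, hN, h⟩ := hG.exists_ses (hT.snd hU).perp
  -- The second component of `p(C₁^(I), C₂^(I))` has two summands: (b) handles `U ⊗ C₁^(I)` and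
  -- `G_{C₂}`-projectivity handles `C₂^(I)`.
  refine ⟨isPerp_triModule_iff.2 fun I => ExtVan.zeroTriple
      ((hU.extVan hG (.finsupp_self I)).prod_right (hG.isPerp.extVan (.finsupp_self I))),
    ModuleCat.of _ (TriModule (0 : BTensor A B U PUnit.{u + 1} →ₗ[B] X)),
    ModuleCat.of _ (TriModule (0 : BTensor A B U PUnit.{u + 1} →ₗ[B] N)),
    TriModule.zeroMap A U f, TriModule.zeroMap A U g,
    IsAdd.triModule_zero A B U C₁ C₂ X hX, ⟨N, hN, rfl⟩, h.zeroMap A U⟩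

/-- `Hom_T((G; U ⊗ G), (M₁; M₂)) = Hom_A(G, M₁)`, so extension problems reduce to `A`. By (a), `U ⊗
-` preserves the free presentation of `G`, and its kernel is again `G_{C₁}`-projective. -/
theorem IsGProj.extVan_idTriple (hT : IsWT (TriRing A B U) (PModule A B U C₁ C₂))
    (hU : IsCompatible A B U C₁ C₂) {G : Type u} [AddCommGroup G] [Module A G]
    (hG : IsGProj A C₁ G) (hM : IsAdd A C₁ M₁) :
    ExtVan (TriRing A B U) (TriModule (LinearMap.id : BTensor A B U G →ₗ[B] BTensor A B U G))
      (TriModule φ) := by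
  refine ExtVan.of_class (fun X => ∃ G : ModuleCat.{u} A, IsGProj A C₁ G ∧
    X = ModuleCat.of _ (TriModule (LinearMap.id : BTensor A B U G →ₗ[B] BTensor A B U G))) ?_
    (ModuleCat.of _ (TriModule (LinearMap.id : BTensor A B U G →ₗ[B] BTensor A B U G)))
    ⟨ModuleCat.of A G, hG, rfl⟩
  rintro _ ⟨G, hG, rfl⟩
  have hA := hT.fst hU
  obtain ⟨K, f, g, hs⟩ := exists_free_ses A G
  obtain ⟨X, N, i, j, hX, hN, h⟩ := hG.exists_ses hA.perp
  refine ⟨ModuleCat.of _ (TriModule (LinearMap.id : BTensor A B U K →ₗ[B] BTensor A B U K)),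
    ModuleCat.of _ (TriModule (LinearMap.id : BTensor A B U (G →₀ A) →ₗ[B] _)),
    TriModule.idMap B U f, TriModule.idMap B U g,
    ⟨K, IsGProj.ker hA.perp hs (hA.free G) hG, rfl⟩, TriModule.projective_id _,
    hs.idMap (hU.tensor_injective hs h hX (isGProj_iff.1 hN).2).1, fun k => ?_⟩
  obtain ⟨k₁, k₂, hk, rfl⟩ := TriModule.exists_hom k
  rw [LinearMap.comp_id] at hk
  obtain ⟨k', rfl⟩ := (hG.isPerp.extVan hM).extend hs k₁
  refine ⟨TriModule.hom k' (φ ∘ₗ BTensor.map B U k') rfl,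
    LinearMap.ext fun z => Prod.ext rfl ?_⟩
  rw [BTensor.map_comp] at hk
  exact (LinearMap.congr_fun hk z.2).symm

theorem IsGProj.idTriple (hT : IsWT (TriRing A B U) (PModule A B U C₁ C₂))
    (hU : IsCompatible A B U C₁ C₂) {G : Type u} [AddCommGroup G] [Module A G]
    (hG : IsGProj A C₁ G) :
    IsGProj (TriRing A B U) (PModule A B U C₁ C₂)
      (TriModule (LinearMap.id : BTensor A B U G →ₗ[B] BTensor A B U G)) := by
  refine IsGProj.of_class (fun X => ∃ G : ModuleCat.{u} A, IsGProj A C₁ G ∧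
    X = ModuleCat.of _ (TriModule (LinearMap.id : BTensor A B U G →ₗ[B] BTensor A B U G))) ?_
    (ModuleCat.of _ (TriModule (LinearMap.id : BTensor A B U G →ₗ[B] BTensor A B U G)))
    ⟨ModuleCat.of A G, hG, rfl⟩
  rintro _ ⟨G, hG, rfl⟩
  obtain ⟨K, i, p, hs⟩ := exists_free_ses A G
  obtain ⟨X, N, f, g, hX, hN, h⟩ := hG.exists_ses (hT.fst hU).perp
  refine ⟨isPerp_triModule_iff.2 fun I => hG.extVan_idTriple hT hU (.finsupp_self I),
    ModuleCat.of _ (TriModule (LinearMap.id : BTensor A B U X →ₗ[B] BTensor A B U X)),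
    ModuleCat.of _ (TriModule (LinearMap.id : BTensor A B U N →ₗ[B] BTensor A B U N)),
    TriModule.idMap B U f, TriModule.idMap B U g,
    IsAdd.triModule_id A B U C₁ C₂ X hX, ⟨N, hN, rfl⟩,
    h.idMap (hU.tensor_injective hs h hX (isGProj_iff.1 hN).2).2⟩

/-- `p(G, Q)` is an extension of `(G; U ⊗ G)` by `(0; Q)`. -/
theorem IsGProj.pModule (hT : IsWT (TriRing A B U) (PModule A B U C₁ C₂))
    (hU : IsCompatible A B U C₁ C₂) {G Q : Type u} [AddCommGroup G] [Module A G] [AddCommGroup Q]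
    [Module B Q] (hG : IsGProj A C₁ G) (hQ : IsGProj B C₂ Q) :
    IsGProj (TriRing A B U) (PModule A B U C₁ C₂) (PModule A B U G Q) := by
  refine IsGProj.extension hT.perp (f := TriModule.hom 0 (LinearMap.inr B (BTensor A B U G) Q)
    (by rw [BTensor.map_zero, LinearMap.comp_zero, LinearMap.comp_zero]))
    (g := TriModule.hom LinearMap.id (LinearMap.fst B (BTensor A B U G) Q)
      (by rw [BTensor.map_id]; rfl)) ((TriModule.ses_iff _ _).2 ⟨SES.zero_id, ?_⟩)
    (hQ.zeroTriple hT hU) (hG.idTriple hT hU)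
  exact ⟨LinearMap.inr_injective, Function.Exact.inr_fst, LinearMap.fst_surjective⟩

end Lifting

/-! ### The two dimension bounds over `T` -/

section Dimension

variable {A B U : Type u} [Ring A] [Ring B] [AddCommGroup U] [Module B U] [Module Aᵐᵒᵖ U]
  [SMulCommClass B Aᵐᵒᵖ U]
variable {C₁ C₂ : Type u} [AddCommGroup C₁] [Module A C₁] [AddCommGroup C₂] [Module B C₂]
variable {M₁ M₂ : Type u} [AddCommGroup M₁] [Module A M₁] [AddCommGroup M₂] [Module B M₂]
  {φ : BTensor A B U M₁ →ₗ[B] M₂}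

theorem PdLE.zeroTriple (hT : IsWT (TriRing A B U) (PModule A B U C₁ C₂))
    (hU : IsCompatible A B U C₁ C₂) {n : ℕ} {V : Type u} [AddCommGroup V] [Module B V]
    (hV : PdLE B C₂ n V) :
    PdLE (TriRing A B U) (PModule A B U C₁ C₂) n
      (TriModule (0 : BTensor A B U PUnit.{u + 1} →ₗ[B] V)) := by
  induction n generalizing V with
  | zero => exact IsGProj.zeroTriple hT hU hV
  | succ n ih =>
    obtain ⟨K, G, f, g, hs, hG, hK⟩ := hV
    exact .of_ses (hs.zeroMap A U) (hG.zeroTriple hT hU) (ih hK)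

/-- Lower bound: the dimensions of the components of a `T`-module. -/
theorem PdLE.components (hT : IsWT (TriRing A B U) (PModule A B U C₁ C₂))
    (hU : IsCompatible A B U C₁ C₂) {k : ℕ}
    (hk : ∀ G : ModuleCat.{u} A, IsGProj A C₁ G → PdLE B C₂ k (BTensor A B U G)) {n : ℕ}
    (hM : PdLE (TriRing A B U) (PModule A B U C₁ C₂) n (TriModule φ)) :
    PdLE A C₁ n M₁ ∧ PdLE B C₂ (n + k) M₂ := by
  have hB := hT.snd hU
  -- For a `G_C`-projective triple, `N₂` is an extension of the `G_{C₂}`-projective `coker ν` by `U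
  -- ⊗ N₁`, whose dimension is at most `k`.
  have key : ∀ {N₁ N₂ : Type u} [AddCommGroup N₁] [Module A N₁] [AddCommGroup N₂] [Module B N₂]
      {ν : BTensor A B U N₁ →ₗ[B] N₂},
      IsGProj (TriRing A B U) (PModule A B U C₁ C₂) (TriModule ν) → PdLE B C₂ k N₂ := by
    intro N₁ N₂ _ _ _ _ ν hν
    have hq := SES.mkQ_range ν (hν.structure_injective hT hU)
    exact .extension_gproj hB hq (hk (ModuleCat.of A N₁) (hν.fst hT hU))
      (hν.coker_structure hT hU hq)
  induction n generalizing M₁ M₂ with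
  | zero =>
    rw [zero_add]
    exact ⟨IsGProj.fst hT hU hM, key hM⟩
  | succ n ih =>
    obtain ⟨K, G, f, g, hs, hG, hK⟩ := hM
    obtain ⟨G₁, G₂, γ, ⟨eG⟩⟩ := exists_equiv_triModule (A := A) (B := B) (U := U) G
    obtain ⟨K₁, K₂, κ, ⟨eK⟩⟩ := exists_equiv_triModule (A := A) (B := B) (U := U) K
    obtain ⟨f₁, f₂, g₁, g₂, -, -, hs₁, hs₂⟩ := hs.exists_triple eK eG (LinearEquiv.refl _ _)
    have hγ := hG.of_equiv eG
    obtain ⟨h₁, h₂⟩ := ih (hK.of_equiv eK)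
    refine ⟨.of_ses hs₁ (hγ.fst hT hU) h₁, ?_⟩
    rw [Nat.add_right_comm]
    exact .coker hB hs₂ h₂ ((key hγ).mono hB (by omega))

/-- Upper bound: the dimension of a `T`-module in terms of its components. -/
theorem PdLE.triModule (hT : IsWT (TriRing A B U) (PModule A B U C₁ C₂))
    (hU : IsCompatible A B U C₁ C₂) {k : ℕ}
    (hk : ∀ G : ModuleCat.{u} A, IsGProj A C₁ G → PdLE B C₂ k (BTensor A B U G)) {m n : ℕ}
    (hmn : m + k + 1 ≤ n) (h₁ : PdLE A C₁ m M₁) (h₂ : PdLE B C₂ n M₂) :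
    PdLE (TriRing A B U) (PModule A B U C₁ C₂) n (TriModule φ) := by
  have hB := hT.snd hU
  obtain ⟨n, rfl⟩ : ∃ n', n = n' + 1 := ⟨n - 1, by omega⟩
  -- One syzygy step with cover `p(G, B^(M₂))`. Its second component has dimension at most `k ≤ n`,
  -- so the new second component `L` has dimension at most `n`, one less than the bound for `M₂`.
  have key : ∀ {K G : Type u} [AddCommGroup K] [Module A K] [AddCommGroup G] [Module A G]
      {M₁ M₂ : Type u} [AddCommGroup M₁] [Module A M₁] [AddCommGroup M₂] [Module B M₂]
      (φ : BTensor A B U M₁ →ₗ[B] M₂) {n : ℕ}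
      {f : K →ₗ[A] G} {g : G →ₗ[A] M₁}, SES f g → IsGProj A C₁ G → k ≤ n → PdLE B C₂ (n + 1) M₂ →
      ∃ (L : ModuleCat.{u} B) (κ : BTensor A B U K →ₗ[B] L), PdLE B C₂ n L ∧
        (PdLE (TriRing A B U) (PModule A B U C₁ C₂) n (TriModule κ) →
          PdLE (TriRing A B U) (PModule A B U C₁ C₂) (n + 1) (TriModule φ)) := by
    intro K G _ _ _ _ M₁ M₂ _ _ _ _ φ n f g hs hG hkn h₂
    obtain ⟨_, _, q, hq⟩ := exists_free_ses B M₂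
    let g₂ : BTensor A B U G × (M₂ →₀ B) →ₗ[B] M₂ := (φ ∘ₗ BTensor.map B U g).coprod q
    have hg₂ : Function.Surjective g₂ := fun y => by
      obtain ⟨x, hx⟩ := hq.surj y
      exact ⟨(0, x), by simpa [g₂] using hx⟩
    have hs₂ := SES.ker_subtype g₂ hg₂
    have hg₂' : g₂ ∘ₗ LinearMap.inl B _ _ = φ ∘ₗ BTensor.map B U g := LinearMap.coprod_inl _ _
    obtain ⟨κ, hκ⟩ := hs₂.lift (LinearMap.inl B _ _ ∘ₗ BTensor.map B U f) (by
      rw [← LinearMap.comp_assoc, hg₂', LinearMap.comp_assoc, ← BTensor.map_comp,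
        hs.comp_eq_zero, BTensor.map_zero, LinearMap.comp_zero])
    refine ⟨ModuleCat.of B (LinearMap.ker g₂), κ, .ker hB hs₂ ?_ h₂, fun h => ?_⟩
    · exact .extension_gproj hB SES.inl_snd ((hk (ModuleCat.of A G) hG).mono hB hkn) (hB.free M₂)
    · exact .of_ses ((TriModule.ses_iff hκ hg₂').2 ⟨hs, hs₂⟩)
        (IsGProj.pModule hT hU hG (hB.free M₂)) h
  induction m generalizing M₁ M₂ n with
  | zero =>
    -- Even a `G_{C₁}`-projective `M₁` costs one step, taken with `G = M₁`, to reach first component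
    -- zero; this is the `+ 1` in the bound.
    obtain ⟨L, κ, hL, h⟩ := key φ (SES.zero_id (R := A) (M := M₁) (N := PUnit.{u + 1})) h₁
      (by omega) h₂
    obtain rfl : κ = 0 := BTensor.hom_ext fun u m => by
      rw [Subsingleton.elim m 0, BTensor.tmul_zero, map_zero, map_zero]
    exact h (hL.zeroTriple hT hU)
  | succ m ih =>
    obtain ⟨K, G, f, g, hs, hG, hK⟩ := h₁
    obtain ⟨L, κ, hL, h⟩ := key φ hs hG (by omega) h₂
    obtain ⟨n, rfl⟩ : ∃ n', n = n' + 1 := ⟨n - 1, by omega⟩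
    exact h (ih hK n (by omega) hL)

end Dimension

end RelGor

theorem mainTheorem4 {A B U : Type u} [Ring A] [Ring B]
    [AddCommGroup U] [Module B U] [Module Aᵐᵒᵖ U] [SMulCommClass B Aᵐᵒᵖ U]
    (C₁ C₂ : Type u) [AddCommGroup C₁] [Module A C₁] [AddCommGroup C₂] [Module B C₂]
    (hC : RelGor.IsWTilting (RelGor.TriRing A B U) (RelGor.PModule A B U C₁ C₂))
    (hU : RelGor.IsCompatible A B U C₁ C₂)
    (hSG : RelGor.sgpd A B U C₁ C₂ < ⊤)
    (M₁ M₂ : Type u) [AddCommGroup M₁] [Module A M₁] [AddCommGroup M₂] [Module B M₂]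
    (φ : RelGor.BTensor A B U M₁ →ₗ[B] M₂) :
    max (RelGor.gpd A C₁ M₁) (RelGor.gpd B C₂ M₂ - RelGor.sgpd A B U C₁ C₂) ≤
        RelGor.gpd (RelGor.TriRing A B U) (RelGor.PModule A B U C₁ C₂) (RelGor.TriModule φ) ∧
      RelGor.gpd (RelGor.TriRing A B U) (RelGor.PModule A B U C₁ C₂) (RelGor.TriModule φ) ≤
        max (RelGor.gpd A C₁ M₁ + RelGor.sgpd A B U C₁ C₂ + 1) (RelGor.gpd B C₂ M₂) := by
  have hT := hC.isWT
  have hA := hT.fst hU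
  have hB := hT.snd hU
  -- Finiteness of the supremum supplies one natural number `k` bounding the dimension of every `U ⊗
  -- G`.
  obtain ⟨k, hk⟩ := ENat.ne_top_iff_exists.1 hSG.ne
  have hk' : ∀ G : ModuleCat.{u} A, RelGor.IsGProj A C₁ G →
      RelGor.PdLE B C₂ k (RelGor.BTensor A B U G) := fun G hG => by
    rw [← RelGor.gpd_le_iff hB, hk]
    exact le_iSup₂ (f := fun (G : ModuleCat.{u} A) (_ : RelGor.IsGProj A C₁ G) =>
      RelGor.gpd B C₂ (RelGor.BTensor A B U G)) G hG
  rw [← hk]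
  constructor
  · induction hn : RelGor.gpd (RelGor.TriRing A B U) (RelGor.PModule A B U C₁ C₂)
      (RelGor.TriModule φ) using ENat.recTopCoe with
    | top => exact le_top
    | coe n =>
      obtain ⟨h₁, h₂⟩ := ((RelGor.gpd_le_iff hT).1 hn.le).components hT hU hk'
      -- Subtraction in `ℕ∞` is truncated at zero, which is harmless since the right-hand side is
      -- nonnegative.
      refine max_le ((RelGor.gpd_le_iff hA).2 h₁) (tsub_le_iff_right.2 ?_)
      exact_mod_cast (RelGor.gpd_le_iff hB).2 h₂
  · induction hm : RelGor.gpd A C₁ M₁ using ENat.recTopCoe with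
    | top => simp
    | coe m =>
      induction hn : RelGor.gpd B C₂ M₂ using ENat.recTopCoe with
      | top => simp
      | coe n =>
        have h₁ := (RelGor.gpd_le_iff hA).1 hm.le
        -- The bound on `M₂` is weakened to the maximum so that the inequality required by
        -- `PdLE.triModule` holds.
        have h₂ := ((RelGor.gpd_le_iff hB).1 hn.le).mono hB (le_max_right (m + k + 1) n)
        exact_mod_cast (RelGor.gpd_le_iff hT).2
          (RelGor.PdLE.triModule (φ := φ) hT hU hk' (le_max_left _ _) h₁ h₂)
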